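/- Let $G$ be a (second countable) unimodular Lie group with Haar measure $dt$, let $M$ be a smooth manifold of dimension $\ge 1$, possibly with boundary, carrying a smooth right action of $G$ which makes $M\to X=M/G$ a principal $G$-bundle with compact Hausdorff base, and let $d\mathbf x$ be a $G$-invariant measure on $M$ with smooth positive density. For $s\in G$ put $(R_su)(\mathbf x)=u(\mathbf xs)$ on $L^2(M)$, and let $\mathcal B(L^2(M))^G$ be the algebra of bounded operators on $L^2(M)$ commuting with all $R_s$. Give $X$ and $(M\times M)/G$ (diagonal action) the quotient measures, characterized by $\int_Y f=\int_{Y/G}\int_G f(yt)\,dt$ for measurable $f\ge 0$ on $Y=M$, respectively $Y=M\times M$. For a positive operator $B$ on $L^2(G)$ commuting with right translations let $\mathrm{tr}_G(B)=\|f\|^2_{L^2(G)}$ if $B=L_f^*L_f$ for some $f\in L^2(G)$ whose left convolution operator $L_f$, $(L_fu)(t)=\int_G f(s)u(s^{-1}t)\,ds$, is bounded, and $\mathrm{tr}_G(B)=\infty$ otherwise. A measurable global section of $M\to X$ gives $M\cong G\times X$ and $L^2(M)\cong L^2(G)\otimes L^2(X)\cong\bigoplus_l L^2(G)\otimes\psi_l$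 for an orthonormal basis $(\psi_l)$ of $L^2(X)$; for positive $A\in\mathcal B(L^2(M))^G$ with diagonal matrix elements $A_{ll}$ put $\mathrm{Tr}_G(A)=\sum_l\mathrm{tr}_G(A_{ll})\in[0,\infty]$. Let $H^\infty(M)=\bigcap_{s\in\mathbb N}H^s(M)$, where $H^s(M)$ is the $G$-invariant $L^2$-Sobolev space of order $s$ on the interior of $M$: its norm is assembled from the $H^s$ norms in local coordinates over a cover of $M$, of bounded multiplicity, by $G$-translates of finitely many relatively compact coordinate patches, the coordinates being translated along. Then the quotient measures and a measurable global section exist, and for every choice of the section and of the orthonormal basis the following hold. (1) For every $A\in\mathcal B(L^2(M))^G$ with Schwartz kernel $K_A$, $$\mathrm{Tr}_G(A^*A)=\int_{(M\times M)/G}|K_A|^2 ,$$ where the right-hand side is $\infty$ if $K_A$ is not a square-integrable function on $(M\times M)/G$. (2) If $P\in\mathcal B(L^2(M))^G$ is a self-adjoint projection with $\mathrm{im}(P)\subset H^\infty(M)$, then $K_P\in L^2\big((M\times M)/G\big)$, $\mathrm{Tr}_G(P^*P)=\int_{(M\times M)/G}|K_P|^2$, and $\mathrm{Tr}_G(P)<\infty$.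 -/

import Mathlib

open MeasureTheory MulOpposite
open scoped ENNReal Manifold ContDiff

noncomputable section

namespace InvariantTrace

/-! ### Free right actions, orbit spaces and quotient measures

A right action of `G` on `Y` is an action of `Gᵐᵒᵖ`; the point `y · g` is `op g • y`. -/

/-- The orbit space `Y / G` of a right action, with the quotient topology and the quotient
σ-algebra. -/
abbrev OrbitSpace (G Y : Type*) [Group G] [MulAction Gᵐᵒᵖ Y] : Type _ :=
  Quotient (MulAction.orbitRel Gᵐᵒᵖ Y)

/-- The projection onto the orbit space. -/
def toOrbit (G : Type*) {Y : Type*} [Group G] [MulAction Gᵐᵒᵖ Y] (y : Y) : OrbitSpace G Y :=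
  Quotient.mk (MulAction.orbitRel Gᵐᵒᵖ Y) y

/-- The integral over an orbit, `y G ↦ ∫ f (y t) dt`, with respect to a left Haar measure `dt`. -/
def orbitIntegral {G Y : Type*} [Group G] [MulAction Gᵐᵒᵖ Y] [MeasurableSpace G]
    [MeasurableMul G] (haar : Measure G) [haar.IsMulLeftInvariant] (f : Y → ℝ≥0∞) :
    OrbitSpace G Y → ℝ≥0∞ :=
  Quotient.lift (fun y => ∫⁻ t, f (op t • y) ∂haar) (by
    rintro a b hab
    obtain ⟨g, rfl⟩ := (MulAction.orbitRel_apply.mp hab : a ∈ MulAction.orbit Gᵐᵒᵖ b)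
    have h := lintegral_mul_left_eq_self (μ := haar) (fun t => f (op t • b)) (unop g)
    simp only [op_mul, op_unop, mul_smul] at h
    exact h)

/-- `ν` is the quotient of the measure `μ` on `Y` by the Haar measure `dt`:
`∫_Y f dμ = ∫_{Y/G} (∫_G f (y t) dt) dν` for all measurable `f ≥ 0`. -/
structure IsQuotientMeasure {G Y : Type*} [Group G] [MulAction Gᵐᵒᵖ Y] [MeasurableSpace G]
    [MeasurableMul G] [MeasurableSpace Y] (haar : Measure G) [haar.IsMulLeftInvariant]
    (μ : Measure Y) (ν : Measure (OrbitSpace G Y)) : Prop where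
  sigmaFinite : SigmaFinite ν
  lintegral_eq : ∀ f : Y → ℝ≥0∞, Measurable f →
    ∫⁻ y, f y ∂μ = ∫⁻ q, orbitIntegral haar f q ∂ν

/-- The right action of the Lie group `G` on the manifold `M` (possibly with boundary) makes
`M → M / G` a smooth principal bundle with compact Hausdorff base. Local triviality: over a
neighbourhood of each point of the base, i.e. on an invariant open set `W`, there is a smooth
equivariant map `τ : W → G`, `τ (y g) = τ y g`; the local trivialization is
`y ↦ (y G, τ y)`, and `y ↦ y (τ y)⁻¹` is the local section. In particular the action is free. -/
structure IsPrincipalBundle {EG HG E H : Type*} [NormedAddCommGroup EG] [NormedSpace ℝ EG]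
    [TopologicalSpace HG] [NormedAddCommGroup E] [NormedSpace ℝ E] [TopologicalSpace H]
    (IG : ModelWithCorners ℝ EG HG) (I : ModelWithCorners ℝ E H)
    (G M : Type*) [Group G] [TopologicalSpace G] [ChartedSpace HG G]
    [TopologicalSpace M] [ChartedSpace H M] [MulAction Gᵐᵒᵖ M] : Prop where
  smooth : ContMDiff (I.prod IG) I ∞ (fun p : M × G => op p.2 • p.1)
  locallyTrivial : ∀ x : M, ∃ W : Set M, IsOpen W ∧ x ∈ W ∧
    (∀ y ∈ W, ∀ g : G, op g • y ∈ W) ∧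
    ∃ τ : M → G, ContMDiffOn I IG ∞ τ W ∧ ∀ y ∈ W, ∀ g : G, τ (op g • y) = τ y * g
  compact_base : CompactSpace (OrbitSpace G M)
  t2_base : T2Space (OrbitSpace G M)

/-- In every chart `μ` has a smooth positive density with respect to Lebesgue measure. -/
def IsSmoothMeasure {n : ℕ} {H M : Type*} [TopologicalSpace H]
    (I : ModelWithCorners ℝ (EuclideanSpace ℝ (Fin n)) H) [TopologicalSpace M]
    [ChartedSpace H M] [MeasurableSpace M] (μ : Measure M) : Prop :=
  ∀ c : M, ∃ ρ : EuclideanSpace ℝ (Fin n) → ℝ,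
    ContDiffOn ℝ ∞ ρ (extChartAt I c).target ∧ (∀ y ∈ (extChartAt I c).target, 0 < ρ y) ∧
    (μ.restrict (extChartAt I c).source).map (extChartAt I c) =
      (volume.restrict (extChartAt I c).target).withDensity (fun y => ENNReal.ofReal (ρ y))

/-! ### Invariant operators and Schwartz kernels -/

/-- The unitary translation `(R_s u)(x) = u (x s)` on `L²(M)`. -/
def rightTranslation {G M : Type*} [Group G] [MulAction Gᵐᵒᵖ M] [MeasurableSpace M]
    [MeasurableConstSMul Gᵐᵒᵖ M] (μ : Measure M) [SMulInvariantMeasure Gᵐᵒᵖ M μ] (s : G) :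
    Lp ℂ 2 μ →ₗᵢ[ℂ] Lp ℂ 2 μ :=
  Lp.compMeasurePreservingₗᵢ ℂ (fun x : M => op s • x) (measurePreserving_smul (op s) μ)

/-- The bounded operator `A` commutes with all translations `R_s`, `s ∈ G`. -/
def IsInvariantOperator (G : Type*) {M : Type*} [Group G] [MulAction Gᵐᵒᵖ M] [MeasurableSpace M]
    [MeasurableConstSMul Gᵐᵒᵖ M] {μ : Measure M} [SMulInvariantMeasure Gᵐᵒᵖ M μ]
    (A : Lp ℂ 2 μ →L[ℂ] Lp ℂ 2 μ) : Prop :=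
  ∀ (s : G) (u : Lp ℂ 2 μ), A (rightTranslation μ s u) = rightTranslation μ s (A u)

/-- Smooth compactly supported functions. -/
def IsTestFunction {E H N : Type*} [NormedAddCommGroup E] [NormedSpace ℝ E] [TopologicalSpace H]
    (I : ModelWithCorners ℝ E H) [TopologicalSpace N] [ChartedSpace H N] (φ : N → ℂ) : Prop :=
  ContMDiff I 𝓘(ℝ, ℂ) ∞ φ ∧ HasCompactSupport φ

/-- The Schwartz kernel of the operator `A` on `L²(M)` is the locally integrable function `K`:
`∫ χ (A φ) dμ = ∬ K(x, y) χ(x) φ(y) dμ(x) dμ(y)` for all test functions `φ`, `χ`. -/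
def IsSchwartzKernel {E H M : Type*} [NormedAddCommGroup E] [NormedSpace ℝ E]
    [TopologicalSpace H] (I : ModelWithCorners ℝ E H) [TopologicalSpace M] [ChartedSpace H M]
    [MeasurableSpace M] {μ : Measure M} (A : Lp ℂ 2 μ →L[ℂ] Lp ℂ 2 μ) (K : M × M → ℂ) : Prop :=
  LocallyIntegrable K (μ.prod μ) ∧
  ∀ φ χ : M → ℂ, IsTestFunction I φ → IsTestFunction I χ →
    ∀ u : Lp ℂ 2 μ, u =ᵐ[μ] φ →
      ∫ x, χ x * A u x ∂μ = ∫ z, K z * (χ z.1 * φ z.2) ∂(μ.prod μ)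

/-! ### Sobolev spaces -/

/-- `g` is the weak partial derivative `∂_{α 0} ⋯ ∂_{α (k-1)} w` on the open set `Ω`. -/
def IsWeakPartial {n k : ℕ} (Ω : Set (EuclideanSpace ℝ (Fin n))) (α : Fin k → Fin n)
    (w g : EuclideanSpace ℝ (Fin n) → ℂ) : Prop :=
  ∀ φ : EuclideanSpace ℝ (Fin n) → ℂ, ContDiff ℝ ∞ φ → HasCompactSupport φ → tsupport φ ⊆ Ω →
    ∫ x in Ω, w x * iteratedFDeriv ℝ k φ x (fun j => EuclideanSpace.single (α j) 1) =
      (-1) ^ k * ∫ x in Ω, g x * φ x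

/-- The squared norm of `w` in `H^s(Ω)`: the sum of the squared `L²(Ω)` norms of the weak
derivatives of order at most `s`; it is `∞` if one of these does not exist in `L²(Ω)`. -/
def sobolevSq {n : ℕ} (s : ℕ) (Ω : Set (EuclideanSpace ℝ (Fin n)))
    (w : EuclideanSpace ℝ (Fin n) → ℂ) : ℝ≥0∞ :=
  ∑ k ∈ Finset.range (s + 1), ∑ α : Fin k → Fin n,
    ⨅ (g : EuclideanSpace ℝ (Fin n) → ℂ)
      (_ : MemLp g 2 (volume.restrict Ω) ∧ IsWeakPartial Ω α w g), ∫⁻ x in Ω, ‖g x‖ₑ ^ 2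

/-- A cover of `M` of bounded multiplicity by translates `U i · t` (`t ∈ T`) of finitely many open
sets `U i`, each relatively compact in the domain of a chart. The coordinates used on `U i · t` are
the translates by `t` of the chart around `center i`. -/
structure TranslateCover {E H : Type*} [NormedAddCommGroup E] [NormedSpace ℝ E]
    [TopologicalSpace H] (I : ModelWithCorners ℝ E H) (G M : Type*) [Group G]
    [TopologicalSpace M] [ChartedSpace H M] [MulAction Gᵐᵒᵖ M] where
  card : ℕ
  center : Fin card → M
  U : Fin card → Set M
  T : Set G
  isOpen : ∀ i, IsOpen (U i)
  isCompact_closure : ∀ i, IsCompact (closure (U i))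
  closure_subset : ∀ i, closure (U i) ⊆ (extChartAt I (center i)).source
  covers : ∀ x : M, ∃ i, ∃ t ∈ T, ∃ y ∈ U i, op t • y = x
  multiplicity : ∃ m : ℕ, ∀ x : M,
    {p : Fin card × G | p.2 ∈ T ∧ ∃ y ∈ U p.1, op p.2 • y = x}.encard ≤ m

/-- The squared `H^s` norm of `u` on the interior of `M`, assembled from the local norms of `u`
in the coordinates of the cover. -/
def TranslateCover.sobolevSq {n : ℕ} {H G M : Type*} [TopologicalSpace H]
    {I : ModelWithCorners ℝ (EuclideanSpace ℝ (Fin n)) H} [Group G] [TopologicalSpace M]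
    [ChartedSpace H M] [MulAction Gᵐᵒᵖ M] (𝒰 : TranslateCover I G M) (s : ℕ) (u : M → ℂ) :
    ℝ≥0∞ :=
  ∑ i : Fin 𝒰.card, ∑' t : 𝒰.T,
    InvariantTrace.sobolevSq s (interior (extChartAt I (𝒰.center i) '' 𝒰.U i))
      (fun y => u (op (t : G) • (extChartAt I (𝒰.center i)).symm y))

/-- `u ∈ H^s(M)`, the invariant Sobolev space of integer order `s` on the interior of `M`. When
`M / G` is compact, different covers give equivalent norms. -/
def MemSobolev {n : ℕ} {H : Type*} (G : Type*) {M : Type*} [TopologicalSpace H]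
    (I : ModelWithCorners ℝ (EuclideanSpace ℝ (Fin n)) H) [Group G] [TopologicalSpace M]
    [ChartedSpace H M] [MulAction Gᵐᵒᵖ M] (s : ℕ) (u : M → ℂ) : Prop :=
  ∃ 𝒰 : TranslateCover I G M, 𝒰.sobolevSq s u < ⊤

/-! ### The trace on the group von Neumann algebra -/

/-- `A = L_f`: the bounded operator `A` on `L²(G)` extends left convolution by `f`,
`φ ↦ (t ↦ ∫ f(s) φ(s⁻¹ t) ds)`, from the test functions. -/
def IsLeftConvolution {EG HG G : Type*} [NormedAddCommGroup EG] [NormedSpace ℝ EG]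
    [TopologicalSpace HG] (IG : ModelWithCorners ℝ EG HG) [Group G] [TopologicalSpace G]
    [ChartedSpace HG G] [MeasurableSpace G] {haar : Measure G}
    (f : Lp ℂ 2 haar) (A : Lp ℂ 2 haar →L[ℂ] Lp ℂ 2 haar) : Prop :=
  ∀ φ : G → ℂ, IsTestFunction IG φ → ∀ u : Lp ℂ 2 haar, u =ᵐ[haar] φ →
    A u =ᵐ[haar] fun t => ∫ s, f s * φ (s⁻¹ * t) ∂haar

/-- The trace `tr_G` on positive operators `B` on `L²(G)` commuting with right translations:
`tr_G (L_f^* L_f) = ‖f‖²` for `f ∈ L²(G)` with `L_f` bounded, and `tr_G B = ∞` if `B` is not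
of this form. -/
def groupTrace {EG HG G : Type*} [NormedAddCommGroup EG] [NormedSpace ℝ EG]
    [TopologicalSpace HG] (IG : ModelWithCorners ℝ EG HG) [Group G] [TopologicalSpace G]
    [ChartedSpace HG G] [MeasurableSpace G] {haar : Measure G}
    (B : Lp ℂ 2 haar →L[ℂ] Lp ℂ 2 haar) : ℝ≥0∞ :=
  ⨅ (A : Lp ℂ 2 haar →L[ℂ] Lp ℂ 2 haar) (f : Lp ℂ 2 haar)
    (_ : IsLeftConvolution IG f A ∧ B = A.adjoint ∘L A), ‖f‖ₑ ^ 2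

/-! ### The decomposition `L²(M) ≅ L²(G) ⊗ L²(M / G)` and the trace on invariant operators -/

/-- A measurable trivialization `M ≃ G × M/G`, `x ↦ (τ x, x G)`, with `τ (x g) = τ x g`.
It amounts to the measurable global section `q ↦ toEquiv.symm (1, q)`. -/
structure MeasurableTrivialization (G M : Type*) [Group G] [MulAction Gᵐᵒᵖ M]
    [MeasurableSpace G] [MeasurableSpace M] extends M ≃ᵐ G × OrbitSpace G M where
  snd_eq : ∀ x : M, (toEquiv x).2 = toOrbit G x
  equivariant : ∀ (x : M) (g : G), (toEquiv (op g • x)).1 = (toEquiv x).1 * g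

section Tensor

variable {G M : Type*} [Group G] [MulAction Gᵐᵒᵖ M] [MeasurableSpace G] [MeasurableMul G]
  [MeasurableSpace M] {haar : Measure G} [haar.IsMulLeftInvariant] [SFinite haar]
  {μ : Measure M} {ν : Measure (OrbitSpace G M)}

theorem MeasurableTrivialization.measurePreserving (e : MeasurableTrivialization G M)
    (hν : IsQuotientMeasure haar μ ν) :
    MeasurePreserving e.toMeasurableEquiv μ (haar.prod ν) := by
  have := hν.sigmaFinite
  refine ⟨e.toMeasurableEquiv.measurable, ?_⟩
  ext B hB
  rw [Measure.map_apply e.toMeasurableEquiv.measurable hB,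
    ← lintegral_indicator_one (e.toMeasurableEquiv.measurable hB),
    hν.lintegral_eq _ (measurable_one.indicator (e.toMeasurableEquiv.measurable hB)),
    Measure.prod_apply_symm hB]
  refine lintegral_congr fun q => ?_
  induction q using Quotient.inductionOn with
  | h x =>
    change ∫⁻ t, _ ∂haar = _
    have key : ∀ t : G, (e.toMeasurableEquiv ⁻¹' B).indicator (1 : M → ℝ≥0∞) (op t • x) =
        ((fun s => (s, toOrbit G x)) ⁻¹' B).indicator 1 ((e.toEquiv x).1 * t) := by
      intro t
      have h1 : e.toMeasurableEquiv (op t • x) = ((e.toEquiv x).1 * t, toOrbit G x) := by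
        refine Prod.ext (e.equivariant x t) ((e.snd_eq _).trans ?_)
        exact Quotient.sound (MulAction.mem_orbit x (op t))
      by_cases hm : ((e.toEquiv x).1 * t, toOrbit G x) ∈ B
      · rw [Set.indicator_of_mem, Set.indicator_of_mem]
        · rfl
        · exact hm
        · exact (Set.mem_preimage.trans (h1 ▸ Iff.rfl)).mpr hm
      · rw [Set.indicator_of_notMem, Set.indicator_of_notMem]
        · exact hm
        · exact fun h => hm (h1 ▸ h)
    rw [lintegral_congr key, lintegral_mul_left_eq_self
      (((fun s => (s, toOrbit G x)) ⁻¹' B).indicator 1),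
      lintegral_indicator_one (measurable_prodMk_right hB)]
    rfl

theorem MeasurableTrivialization.eLpNorm_tensor (e : MeasurableTrivialization G M)
    (hν : IsQuotientMeasure haar μ ν) (u : Lp ℂ 2 haar) (ψ : Lp ℂ 2 ν) :
    MemLp (fun x : M => u (e.toEquiv x).1 * ψ (toOrbit G x)) 2 μ ∧
      eLpNorm (fun x : M => u (e.toEquiv x).1 * ψ (toOrbit G x)) 2 μ =
        eLpNorm u 2 haar * eLpNorm ψ 2 ν := by
  have := hν.sigmaFinite
  have hfun : (fun x : M => u (e.toEquiv x).1 * ψ (toOrbit G x)) =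
      (fun z : G × OrbitSpace G M => u z.1 * ψ z.2) ∘ e.toMeasurableEquiv := by
    funext x
    simp only [Function.comp_apply, ← e.snd_eq]
    rfl
  have hmeas : AEStronglyMeasurable (fun z : G × OrbitSpace G M => u z.1 * ψ z.2)
      (haar.prod ν) :=
    (Lp.aestronglyMeasurable u).comp_fst.mul (Lp.aestronglyMeasurable ψ).comp_snd
  have hnorm : eLpNorm (fun z : G × OrbitSpace G M => u z.1 * ψ z.2) 2 (haar.prod ν) =
      eLpNorm u 2 haar * eLpNorm ψ 2 ν := by
    simp only [eLpNorm_eq_lintegral_rpow_enorm_toReal two_ne_zero ENNReal.ofNat_ne_top,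
      enorm_mul, ENNReal.toReal_ofNat]
    rw [← ENNReal.mul_rpow_of_nonneg _ _ (by norm_num), ← lintegral_prod_mul
      ((Lp.aestronglyMeasurable u).enorm.pow_const _)
      ((Lp.aestronglyMeasurable ψ).enorm.pow_const _)]
    simp only [ENNReal.mul_rpow_of_nonneg _ _ (zero_le_two : (0 : ℝ) ≤ 2)]
  have hE := eLpNorm_comp_measurePreserving (p := 2) hmeas (e.measurePreserving hν)
  rw [hfun]
  refine ⟨⟨hmeas.comp_measurePreserving (e.measurePreserving hν), ?_⟩, hE.trans hnorm⟩
  rw [hE, hnorm]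
  exact ENNReal.mul_lt_top (Lp.memLp u).2 (Lp.memLp ψ).2

/-- The embedding `L²(G) → L²(G) ⊗ ψ ⊆ L²(M)`, `u ↦ (x ↦ u(τ x) ψ(x G))`. -/
def MeasurableTrivialization.embed (e : MeasurableTrivialization G M)
    (hν : IsQuotientMeasure haar μ ν) (ψ : Lp ℂ 2 ν) : Lp ℂ 2 haar →L[ℂ] Lp ℂ 2 μ :=
  LinearMap.mkContinuous
    { toFun := fun u => (e.eLpNorm_tensor hν u ψ).1.toLp
      map_add' := by
        intro u v
        rw [← MemLp.toLp_add]
        refine MemLp.toLp_congr _ _ ?_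
        have := hν.sigmaFinite
        have h := (Measure.quasiMeasurePreserving_fst.comp
          (e.measurePreserving hν).quasiMeasurePreserving).ae (Lp.coeFn_add u v)
        filter_upwards [h] with x hx
        have hx' : (u + v : Lp ℂ 2 haar) (e.toEquiv x).1 =
          u (e.toEquiv x).1 + v (e.toEquiv x).1 := hx
        simp only [Pi.add_apply, hx', add_mul]
      map_smul' := by
        intro c u
        rw [RingHom.id_apply, ← MemLp.toLp_const_smul]
        refine MemLp.toLp_congr _ _ ?_
        have := hν.sigmaFinite
        have h := (Measure.quasiMeasurePreserving_fst.comp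
          (e.measurePreserving hν).quasiMeasurePreserving).ae (Lp.coeFn_smul c u)
        filter_upwards [h] with x hx
        have hx' : (c • u : Lp ℂ 2 haar) (e.toEquiv x).1 = c • u (e.toEquiv x).1 := hx
        simp only [Pi.smul_apply, hx', smul_mul_assoc] }
    ‖ψ‖ (fun u => by
      change ‖(e.eLpNorm_tensor hν u ψ).1.toLp‖ ≤ _
      rw [Lp.norm_toLp, (e.eLpNorm_tensor hν u ψ).2, ENNReal.toReal_mul, mul_comm]
      rfl)

/-- The trace `Tr_G A = ∑ₗ tr_G (Aₗₗ)` of a positive invariant operator `A` on `L²(M)`, where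
`Aₗₗ` is the diagonal matrix element of `A` on the summand `L²(G) ⊗ ψₗ ≅ L²(G)` of
`L²(M) ≅ ⨁ₗ L²(G) ⊗ ψₗ`, for an orthonormal basis `(ψₗ)` of `L²(M / G)`. -/
def invariantTrace {EG HG ι : Type*} [NormedAddCommGroup EG] [NormedSpace ℝ EG]
    [TopologicalSpace HG] (IG : ModelWithCorners ℝ EG HG) [TopologicalSpace G]
    [ChartedSpace HG G] (e : MeasurableTrivialization G M) (hν : IsQuotientMeasure haar μ ν)
    (ψ : HilbertBasis ι ℂ (Lp ℂ 2 ν)) (A : Lp ℂ 2 μ →L[ℂ] Lp ℂ 2 μ) : ℝ≥0∞ :=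
  ∑' l : ι, groupTrace IG ((e.embed hν (ψ l)).adjoint ∘L A ∘L e.embed hν (ψ l))

end Tensor

end InvariantTrace

end

noncomputable section

namespace InvariantTrace

open Filter Topology
open scoped InnerProductSpace ComplexConjugate

set_option linter.unusedSectionVars false

/-! ### Haar measures of unimodular groups -/

/-! A measurable section, recorded by an equivariant map τ : M → G, identifies M with G × X, where X
= M/G, and the measure on M with Haar measure times ν. In the same way (x, y) ↦ (x τ(y)⁻¹, yG)
identifies (M × M)/G with M × X carrying μ × ν (`measurePreserving_pairEquiv`). An invariant kernel
is thus K(x, y) = k(x τ(y)⁻¹, yG), and the integral of |K|² over (M × M)/G is ‖k‖².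

For β in L²(X) the operator T : u ↦ A(u ⊗ β) from L²(G) to L²(M) is equivariant. Such a T has the
form u ↦ F * u with F in L²(M) exactly when T φₙ converges along an approximate identity φₙ, and
then F is the limit. The central fact is tr_G(T*T) = ‖F‖² (`IsEquivariant.groupTrace_eq`). It rests
on `IsEquivariant.exists_of_adjoint_comp_eq`: the norms ‖Tu‖ depend only on T*T, hence so do the
convergence of T φₙ and the norm of the limit. One may therefore replace T by |T|, which acts on
L²(G) and is still equivariant.

Taking β = ψ_l gives Tr_G(A*A) = ∑ ‖F_l‖². If this is finite, the F_l are the slices ∫ k(·, q)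
ψ_l(q) dν(q) of a single k with ‖k‖² equal to the trace (`exists_kernel_of_invariantTrace_lt_top`),
and the kernel built from k is the Schwartz kernel of A (`isSchwartzKernel_kernel`). Conversely, a
square-integrable kernel has convolution operators as components, and Bessel's inequality makes the
trace finite. Uniqueness of Schwartz kernels (`IsSchwartzKernel.ae_eq`) matches the two directions.

For a projection P*P = P, so it remains to prove that the trace is finite. Functions in H^n are
locally bounded up to the boundary (`MemSobolev.exists_bound_nhds`), and Baire's theorem turns this
into local estimates |Pu| ≤ c‖u‖. So P followed by restriction to a suitable set C of finite measure
is Hilbert–Schmidt. Since X is compact, C can be chosen so that every orbit spends Haar time at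
least c₀ > 0 in it. Averaging over G then bounds ∑ ‖P(φₙ ⊗ ψ_l)‖² uniformly in n
(`mul_sum_enorm_sq_le`). Weak compactness produces the F_l, and n → ∞ bounds the trace. -/

/-- A Haar measure which is also right invariant is invariant under inversion. -/
theorem isInvInvariant_of_isMulRightInvariant {G : Type*} [Group G] [TopologicalSpace G]
    [IsTopologicalGroup G] [LocallyCompactSpace G] [SecondCountableTopology G]
    [MeasurableSpace G] [BorelSpace G] (haar : Measure G) [haar.IsHaarMeasure]
    [haar.IsMulRightInvariant] : haar.IsInvInvariant := by
  constructor
  -- Right invariance makes the inverted measure left invariant, hence a multiple c of Haar measure;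
  -- inverting twice gives c² = 1.
  let c : ℝ≥0∞ := Measure.haarScalarFactor haar.inv haar
  have hc : haar.inv = c • haar := Measure.isMulLeftInvariant_eq_smul haar.inv haar
  have h2 : haar = c ^ 2 • haar := by
    conv_lhs => rw [← Measure.inv_inv haar, hc, Measure.inv_def, Measure.map_smul,
      ← Measure.inv_def, hc, smul_smul, ← pow_two]
  have K : TopologicalSpace.PositiveCompacts G := Classical.arbitrary _
  have h3 : c ^ 2 * haar K = 1 ^ 2 * haar K := by
    conv_rhs => rw [h2]
    simp
  have h4 : c ^ 2 = 1 ^ 2 :=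
    (ENNReal.mul_left_inj (Measure.measure_pos_of_nonempty_interior _ K.interior_nonempty).ne'
      K.isCompact.measure_lt_top.ne).1 h3
  have h5 : c = 1 := (ENNReal.pow_right_strictMono two_ne_zero).injective h4
  rw [hc, h5, one_smul]

/-! ### Existence of quotient measures -/

/-- For an equivariant τ the weight w ∘ τ has integral one along every orbit, by left invariance. It
replaces a cut-off function for averaging over orbits. -/
theorem exists_measurable_lintegral_eq_one {α : Type*} [MeasurableSpace α] (ρ : Measure α)
    [SigmaFinite ρ] [NeZero ρ] : ∃ w : α → ℝ≥0∞, Measurable w ∧ ∫⁻ a, w a ∂ρ = 1 := by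
  obtain ⟨s, hs, hs0, hst⟩ : ∃ s : Set α, MeasurableSet s ∧ ρ s ≠ 0 ∧ ρ s ≠ ⊤ := by
    by_contra! H
    have : ρ Set.univ = 0 := by
      rw [← iUnion_spanningSets ρ]
      refine measure_iUnion_null fun n => ?_
      by_contra h0
      exact (measure_spanningSets_lt_top ρ n).ne (H _ (measurableSet_spanningSets ρ n) h0)
    exact NeZero.ne ρ (Measure.measure_univ_eq_zero.mp this)
  refine ⟨s.indicator fun _ => (ρ s)⁻¹, measurable_const.indicator hs, ?_⟩
  rw [lintegral_indicator_const hs, ENNReal.inv_mul_cancel hs0 hst]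

/-- The sets where k ≥ 1/(n+1) have finite measure by Markov's inequality and exhaust the space. -/
theorem sigmaFinite_of_pos_of_lintegral_ne_top {α : Type*} [MeasurableSpace α] {ρ : Measure α}
    {k : α → ℝ≥0∞} (hk : Measurable k) (hpos : ∀ a, 0 < k a) (hfin : ∫⁻ a, k a ∂ρ ≠ ⊤) :
    SigmaFinite ρ := by
  refine ⟨⟨⟨fun n : ℕ => {a | ((n : ℝ≥0∞) + 1)⁻¹ ≤ k a}, fun _ => trivial, fun n => ?_, ?_⟩⟩⟩
  · refine (meas_ge_le_lintegral_div hk.aemeasurable (by simp) (by simp)).trans_lt ?_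
    exact ENNReal.div_lt_top hfin (by simp)
  · refine Set.eq_univ_of_forall fun a => Set.mem_iUnion.mpr ?_
    obtain ⟨n, hn⟩ := ENNReal.exists_inv_nat_lt (hpos a).ne'
    exact ⟨n, (ENNReal.inv_le_inv.mpr le_self_add).trans hn.le⟩

section Quotient

variable {G Y : Type*} [Group G] [MulAction Gᵐᵒᵖ Y]

theorem measurable_toOrbit [MeasurableSpace Y] : Measurable (toOrbit G : Y → OrbitSpace G Y) :=
  measurable_quotient_mk''

theorem toOrbit_smul (g : G) (y : Y) : toOrbit G (op g • y) = toOrbit G y :=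
  Quotient.sound (MulAction.mem_orbit y (op g))

theorem exists_smul_eq_of_toOrbit_eq {x y : Y} (h : toOrbit G x = toOrbit G y) :
    ∃ g : G, op g • y = x := by
  obtain ⟨g, hg⟩ := MulAction.orbitRel_apply.mp (Quotient.exact h)
  exact ⟨unop g, hg⟩

theorem orbitIntegral_toOrbit [MeasurableSpace G] [MeasurableMul G] (haar : Measure G) [haar.IsMulLeftInvariant]
    (f : Y → ℝ≥0∞) (y : Y) :
    orbitIntegral haar f (toOrbit G y) = ∫⁻ t, f (op t • y) ∂haar := rfl

/-- The orbit integral of a weight along an equivariant map into `G` that integrates to one. -/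
theorem orbitIntegral_weight [MeasurableSpace G] [MeasurableMul G] (haar : Measure G) [haar.IsMulLeftInvariant]
    {τ : Y → G} (hτ : ∀ y g, τ (op g • y) = τ y * g) {w : G → ℝ≥0∞}
    (hw : Measurable w) (hw1 : ∫⁻ t, w t ∂haar = 1) (f : OrbitSpace G Y → ℝ≥0∞)
    (q : OrbitSpace G Y) :
    orbitIntegral haar (fun y => w (τ y) * f (toOrbit G y)) q = f q := by
  induction q using Quotient.inductionOn with
  | h y =>
    change ∫⁻ t, w (τ (op t • y)) * f (toOrbit G (op t • y)) ∂haar = f (toOrbit G y)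
    simp only [hτ, toOrbit_smul]
    have hm : Measurable fun t => w (τ y * t) := hw.comp (measurable_const_mul _)
    rw [lintegral_mul_const _ hm, lintegral_mul_left_eq_self w, hw1, one_mul]

variable [MeasurableSpace G] [MeasurableSpace Y]

theorem measurable_orbitIntegral [MeasurableMul G] (haar : Measure G) [haar.IsMulLeftInvariant]
    [SFinite haar] (hsmul : Measurable fun p : Y × G => op p.2 • p.1) {f : Y → ℝ≥0∞}
    (hf : Measurable f) : Measurable (orbitIntegral haar f : OrbitSpace G Y → ℝ≥0∞) := by
  refine measurable_from_quotient.mpr ?_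
  exact (hf.comp hsmul).lintegral_prod_right'

/-- The defining formula is inverted by lifting f to a function on Y whose orbit integral is f
again. In particular the quotient measure is computed from μ. -/
theorem IsQuotientMeasure.lintegral_quotient [MeasurableMul G] {haar : Measure G}
    [haar.IsMulLeftInvariant] {μ : Measure Y} {ν : Measure (OrbitSpace G Y)}
    (hν : IsQuotientMeasure haar μ ν) {τ : Y → G} (hτm : Measurable τ)
    (hτ : ∀ y g, τ (op g • y) = τ y * g) {w : G → ℝ≥0∞}
    (hw : Measurable w) (hw1 : ∫⁻ t, w t ∂haar = 1) {f : OrbitSpace G Y → ℝ≥0∞}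
    (hf : Measurable f) :
    ∫⁻ q, f q ∂ν = ∫⁻ y, w (τ y) * f (toOrbit G y) ∂μ := by
  have hm : Measurable fun y => w (τ y) * f (toOrbit G y) :=
    (hw.comp hτm).mul (hf.comp measurable_toOrbit)
  rw [hν.lintegral_eq _ hm]
  exact (lintegral_congr (orbitIntegral_weight haar hτ hw hw1 f)).symm

/-- An invariant σ-finite measure on a space with a measurable equivariant map into `G` has a
quotient measure. -/
theorem exists_isQuotientMeasure [MeasurableMul₂ G] [MeasurableInv G] (haar : Measure G)
    [haar.IsMulLeftInvariant] [haar.IsInvInvariant] [SigmaFinite haar] [NeZero haar]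
    [MeasurableConstSMul Gᵐᵒᵖ Y] (μ : Measure Y) [SigmaFinite μ] [SMulInvariantMeasure Gᵐᵒᵖ Y μ]
    (hsmul : Measurable fun p : Y × G => op p.2 • p.1) {τ : Y → G} (hτm : Measurable τ)
    (hτ : ∀ y g, τ (op g • y) = τ y * g) :
    ∃ ν : Measure (OrbitSpace G Y), IsQuotientMeasure haar μ ν := by
  obtain ⟨w, hw, hw1⟩ := exists_measurable_lintegral_eq_one haar
  have hwτ : Measurable fun y => w (τ y) := hw.comp hτm
  -- The density w(τ y) gives each orbit total weight one, so the push-forward counts every orbit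
  -- once.
  let ν : Measure (OrbitSpace G Y) := (μ.withDensity fun y => w (τ y)).map (toOrbit G)
  have key : ∀ f : Y → ℝ≥0∞, Measurable f →
      ∫⁻ y, f y ∂μ = ∫⁻ q, orbitIntegral haar f q ∂ν := by
    intro f hf
    have hF : Measurable fun p : Y × G => f (op p.2 • p.1) := hf.comp hsmul
    have hO : Measurable fun y => orbitIntegral haar f (toOrbit G y) :=
      (measurable_orbitIntegral haar hsmul hf).comp measurable_toOrbit
    rw [lintegral_map (measurable_orbitIntegral haar hsmul hf) measurable_toOrbit,
      lintegral_withDensity_eq_lintegral_mul _ hwτ hO]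
    simp only [Pi.mul_apply, orbitIntegral_toOrbit]
    -- The factor 1 = ∫ w(τ y t⁻¹) dt is inserted, which needs inversion invariance; then Tonelli
    -- and the substitution y ↦ y t in the invariant measure μ move the translation onto f.
    calc ∫⁻ y, f y ∂μ = ∫⁻ y, ∫⁻ t, w (τ y * t⁻¹) * f y ∂haar ∂μ := by
          refine lintegral_congr fun y => ?_
          have h := lintegral_div_left_eq_self (μ := haar) w (τ y)
          simp only [div_eq_mul_inv] at h
          have hm : Measurable fun t => w (τ y * t⁻¹) := hw.comp (measurable_inv.const_mul _)
          rw [lintegral_mul_const _ hm, h, hw1, one_mul]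
      _ = ∫⁻ t, ∫⁻ y, w (τ y * t⁻¹) * f y ∂μ ∂haar := by
          refine lintegral_lintegral_swap (Measurable.aemeasurable ?_)
          exact (hw.comp ((hτm.comp measurable_fst).mul measurable_snd.inv)).mul
            (hf.comp measurable_fst)
      _ = ∫⁻ t, ∫⁻ y, w (τ y) * f (op t • y) ∂μ ∂haar := by
          refine lintegral_congr fun t => ?_
          have hm : Measurable fun y => w (τ y * t⁻¹) * f y :=
            (hw.comp (hτm.mul_const _)).mul hf
          rw [← (measurePreserving_smul (op t) μ).lintegral_comp hm]
          simp only [hτ, mul_inv_cancel_right]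
      _ = ∫⁻ y, ∫⁻ t, w (τ y) * f (op t • y) ∂haar ∂μ := by
          refine lintegral_lintegral_swap (Measurable.aemeasurable ?_)
          exact (hwτ.comp measurable_snd).mul (hF.comp measurable_swap)
      _ = _ := by
          refine lintegral_congr fun y => ?_
          exact lintegral_const_mul _ (hF.comp measurable_prodMk_left)
  refine ⟨ν, ?_, key⟩
  -- The orbit integral of a strictly positive integrable function is strictly positive and
  -- integrable for ν, which gives σ-finiteness.
  obtain ⟨h, hpos, hm, hlt⟩ := exists_pos_lintegral_lt_of_sigmaFinite μ (one_ne_zero (α := ℝ≥0∞))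
  have hm' : Measurable fun y => (h y : ℝ≥0∞) := hm.coe_nnreal_ennreal
  refine sigmaFinite_of_pos_of_lintegral_ne_top (measurable_orbitIntegral haar hsmul hm')
    (fun q => ?_) ((key _ hm').symm.trans_lt (hlt.trans ENNReal.one_lt_top)).ne
  induction q using Quotient.inductionOn with
  | h y =>
    change 0 < ∫⁻ t, (h (op t • y) : ℝ≥0∞) ∂haar
    have hm2 : Measurable fun t => (h (op t • y) : ℝ≥0∞) :=
      (hm'.comp hsmul).comp measurable_prodMk_left
    rw [pos_iff_ne_zero, Ne, lintegral_eq_zero_iff hm2]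
    intro H
    have : ∀ᵐ _ ∂haar, False := by
      filter_upwards [H] with t ht
      exact (hpos (op t • y)).ne' (by simpa using ht)
    exact NeZero.ne haar (by simpa using this)

end Quotient

/-! ### Measurable trivializations -/

section Trivialization

variable {G M : Type*} [Group G] [MulAction Gᵐᵒᵖ M] [MeasurableSpace G] [MeasurableSpace M]

/-- A measurable equivariant map `τ : M → G` is the first component of a trivialization. -/
def MeasurableTrivialization.ofEquivariant [MeasurableInv G]
    (hsmul : Measurable fun p : M × G => op p.2 • p.1) (τ : M → G) (hτm : Measurable τ)
    (hτ : ∀ y g, τ (op g • y) = τ y * g) : MeasurableTrivialization G M where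
  toFun x := (τ x, toOrbit G x)
  invFun p := op p.1 • (Quotient.lift (fun x : M => op (τ x)⁻¹ • x) (by
    rintro a b hab
    obtain ⟨g, rfl⟩ := (MulAction.orbitRel_apply.mp hab : a ∈ MulAction.orbit Gᵐᵒᵖ b)
    have := hτ b (unop g)
    simp only [op_unop] at this
    simp only [this, smul_smul, mul_inv_rev, op_mul, op_inv, op_unop]
    simp) : OrbitSpace G M → M) p.2
  left_inv x := by
    change op (τ x) • op (τ x)⁻¹ • x = x
    simp
  right_inv p := by
    obtain ⟨g, q⟩ := p
    induction q using Quotient.inductionOn with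
    | h x =>
      change (τ (op g • op (τ x)⁻¹ • x), toOrbit G (op g • op (τ x)⁻¹ • x)) = (g, toOrbit G x)
      simp only [hτ, toOrbit_smul, mul_inv_cancel, one_mul]
  measurable_toFun := hτm.prodMk measurable_toOrbit
  measurable_invFun := by
    have h1 : Measurable (Quotient.lift (fun x : M => op (τ x)⁻¹ • x) (by
        rintro a b hab
        obtain ⟨g, rfl⟩ := (MulAction.orbitRel_apply.mp hab : a ∈ MulAction.orbit Gᵐᵒᵖ b)
        have := hτ b (unop g)
        simp only [op_unop] at this
        simp only [this, smul_smul, mul_inv_rev, op_mul, op_inv, op_unop]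
        simp) : OrbitSpace G M → M) :=
      measurable_from_quotient.mpr (hsmul.comp (measurable_id.prodMk hτm.inv))
    exact hsmul.comp ((h1.comp measurable_snd).prodMk measurable_fst)
  snd_eq _ := rfl
  equivariant := hτ

/-- The measurable section `q ↦ e⁻¹ (1, q)` of a trivialization. -/
def MeasurableTrivialization.section (e : MeasurableTrivialization G M)
    (q : OrbitSpace G M) : M := e.toEquiv.symm (1, q)

/-- The component in `G` of a trivialization. -/
def MeasurableTrivialization.coord (e : MeasurableTrivialization G M) (x : M) : G :=
  (e.toEquiv x).1

variable (e : MeasurableTrivialization G M)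

theorem MeasurableTrivialization.measurable_section : Measurable e.section :=
  e.toMeasurableEquiv.symm.measurable.comp measurable_prodMk_left

theorem MeasurableTrivialization.measurable_coord : Measurable e.coord :=
  measurable_fst.comp e.toMeasurableEquiv.measurable

theorem MeasurableTrivialization.coord_smul (x : M) (g : G) :
    e.coord (op g • x) = e.coord x * g := e.equivariant x g

theorem MeasurableTrivialization.apply_eq (x : M) : e.toEquiv x = (e.coord x, toOrbit G x) :=
  Prod.ext rfl (e.snd_eq x)

theorem MeasurableTrivialization.coord_section (q : OrbitSpace G M) :
    e.coord (e.section q) = 1 := by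
  simp [MeasurableTrivialization.coord, MeasurableTrivialization.section]

theorem MeasurableTrivialization.toOrbit_section (q : OrbitSpace G M) :
    toOrbit G (e.section q) = q := by
  rw [← e.snd_eq]; simp [MeasurableTrivialization.section]

theorem MeasurableTrivialization.smul_section (x : M) :
    op (e.coord x) • e.section (toOrbit G x) = x := by
  apply e.toEquiv.injective
  rw [e.apply_eq, e.apply_eq, e.coord_smul, e.coord_section, one_mul, toOrbit_smul,
    e.toOrbit_section]

theorem MeasurableTrivialization.section_toOrbit (x : M) :
    e.section (toOrbit G x) = op (e.coord x)⁻¹ • x := by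
  conv_rhs => rw [← e.smul_section x, smul_smul, e.coord_smul, e.coord_section, one_mul]
  simp

/-- A principal bundle over a second countable base has a measurable trivialization. -/
theorem exists_measurableTrivialization [TopologicalSpace G] [BorelSpace G]
    [TopologicalSpace M] [SecondCountableTopology M] [BorelSpace M] [MeasurableInv G]
    (hsmul : Measurable fun p : M × G => op p.2 • p.1)
    (hloc : ∀ x : M, ∃ W : Set M, IsOpen W ∧ x ∈ W ∧ (∀ y ∈ W, ∀ g : G, op g • y ∈ W) ∧
      ∃ τ : M → G, ContinuousOn τ W ∧ ∀ y ∈ W, ∀ g : G, τ (op g • y) = τ y * g) :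
    Nonempty (MeasurableTrivialization G M) := by
  classical
  choose W hWo hxW hWi τ hτc hτ using hloc
  obtain ⟨T, hTc, hT⟩ := TopologicalSpace.isOpen_iUnion_countable W hWo
  have hcov : ⋃ x ∈ T, W x = Set.univ := by
    rw [hT]; exact Set.eq_univ_of_forall fun x => Set.mem_iUnion.mpr ⟨x, hxW x⟩
  rcases T.eq_empty_or_nonempty with rfl | hTne
  · have hM : IsEmpty M := by
      rw [← Set.univ_eq_empty_iff, ← hcov]; simp
    exact ⟨.ofEquivariant hsmul (fun _ => 1) measurable_const (fun y => (hM.false y).elim)⟩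
  obtain ⟨f, rfl⟩ := hTc.exists_eq_range hTne
  have hex : ∀ y : M, ∃ n, y ∈ W (f n) := by
    intro y
    have : y ∈ ⋃ x ∈ Set.range f, W x := hcov ▸ Set.mem_univ y
    simpa using this
  have hinv : ∀ (x y : M) (g : G), op g • y ∈ W x ↔ y ∈ W x := by
    refine fun x y g => ⟨fun h => ?_, fun h => hWi x y h g⟩
    simpa using hWi x _ h g⁻¹
  -- The index of the first trivializing set containing y. These sets are invariant, so the index is
  -- constant on orbits and the local maps glue to an equivariant map.
  let N : M → ℕ := fun y => Nat.find (hex y)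
  have hN : ∀ y (g : G), N (op g • y) = N y := by
    intro y g
    simp only [N, hinv]
  have hNm : Measurable N := measurable_find hex fun n => (hWo _).measurableSet
  refine ⟨.ofEquivariant hsmul (fun y => τ (f (N y)) y) ?_ ?_⟩
  · intro s hs
    have : (fun y => τ (f (N y)) y) ⁻¹' s =
        ⋃ n, N ⁻¹' {n} ∩ (W (f n) ∩ τ (f n) ⁻¹' s) := by
      ext y
      simp only [Set.mem_preimage, Set.mem_iUnion, Set.mem_inter_iff, Set.mem_singleton_iff]
      constructor
      · exact fun h => ⟨N y, rfl, Nat.find_spec (hex y), h⟩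
      · rintro ⟨n, rfl, -, h⟩
        exact h
    rw [this]
    refine .iUnion fun n => (hNm (measurableSet_singleton n)).inter ?_
    have := (hτc (f n)).measurable_piecewise (continuousOn_const (c := (1 : G)))
      (hWo (f n)).measurableSet
    convert (hWo (f n)).measurableSet.inter (this hs) using 1
    ext y
    by_cases hy : y ∈ W (f n) <;> simp [hy]
  · intro y g
    rw [hN]
    exact hτ _ _ (Nat.find_spec (hex y)) g

end Trivialization

/-! ### Measures with a smooth positive density -/

section SmoothMeasure

variable {n : ℕ} {H M : Type*} [TopologicalSpace H]
  {I : ModelWithCorners ℝ (EuclideanSpace ℝ (Fin n)) H} [TopologicalSpace M]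
  [ChartedSpace H M]

/-- When there is a boundary the target need not be open; it is the intersection of an open set with
the closed range of `I`. -/
theorem measurableSet_extChartAt_target (c : M) : MeasurableSet (extChartAt I c).target := by
  rw [extChartAt_target]
  exact ((chartAt H c).open_target.preimage I.continuous_symm).measurableSet.inter
    I.isClosed_range.measurableSet

variable [MeasurableSpace M] [BorelSpace M] {μ : Measure M}

/-- The change of variables formula in a chart, with a density that is bounded from above and from
below near any given point. -/
theorem IsSmoothMeasure.exists_density (hμ : IsSmoothMeasure I μ) (c : M) :
    ∃ ρ : EuclideanSpace ℝ (Fin n) → ℝ, ContinuousOn ρ (extChartAt I c).target ∧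
      (∀ y ∈ (extChartAt I c).target, 0 < ρ y) ∧
      ∀ f : EuclideanSpace ℝ (Fin n) → ℝ≥0∞,
        AEMeasurable f (volume.restrict (extChartAt I c).target) →
        ∫⁻ x in (extChartAt I c).source, f (extChartAt I c x) ∂μ =
          ∫⁻ y in (extChartAt I c).target, ENNReal.ofReal (ρ y) * f y := by
  obtain ⟨ρ, hρ, hpos, hmap⟩ := hμ c
  have hchart : AEMeasurable (extChartAt I c) (μ.restrict (extChartAt I c).source) :=
    (continuousOn_extChartAt c).aemeasurable (isOpen_extChartAt_source c).measurableSet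
  have hρm : AEMeasurable (fun y => ENNReal.ofReal (ρ y))
      (volume.restrict (extChartAt I c).target) :=
    (hρ.continuousOn.aemeasurable (measurableSet_extChartAt_target c)).ennreal_ofReal
  refine ⟨ρ, hρ.continuousOn, hpos, fun f hf => ?_⟩
  have hac : AEMeasurable f ((volume.restrict (extChartAt I c).target).withDensity
      fun y => ENNReal.ofReal (ρ y)) := hf.mono_ac (withDensity_absolutelyContinuous _ _)
  rw [← lintegral_map' (hmap ▸ hac) hchart, hmap,
    lintegral_withDensity_eq_lintegral_mul₀ hρm hf]
  rfl

/-- On the part of a small coordinate ball lying in the chart target the density stays below its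
value at the centre plus one. -/
theorem IsSmoothMeasure.isLocallyFiniteMeasure (hμ : IsSmoothMeasure I μ) :
    IsLocallyFiniteMeasure μ := by
  refine ⟨fun x => ?_⟩
  obtain ⟨ρ, hρ, -, hInt⟩ := hμ.exists_density x
  have hx : extChartAt I x x ∈ (extChartAt I x).target := mem_extChartAt_target x
  obtain ⟨ε, hε, hb⟩ := Metric.mem_nhdsWithin_iff.mp
    ((hρ _ hx).eventually (gt_mem_nhds (lt_add_one (ρ (extChartAt I x x)))))
  set B := Metric.ball (extChartAt I x x) ε
  have hB : MeasurableSet B := Metric.isOpen_ball.measurableSet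
  have hS : MeasurableSet (extChartAt I x).source := (isOpen_extChartAt_source x).measurableSet
  refine ⟨(extChartAt I x).source ∩ extChartAt I x ⁻¹' B, ?_, ?_⟩
  · exact inter_mem (extChartAt_source_mem_nhds x)
      ((continuousAt_extChartAt x).preimage_mem_nhds (Metric.ball_mem_nhds _ hε))
  · have h := hInt (B.indicator 1) (measurable_one.indicator hB).aemeasurable
    have h1 : ∫⁻ y in (extChartAt I x).source, B.indicator 1 (extChartAt I x y) ∂μ =
        μ ((extChartAt I x).source ∩ extChartAt I x ⁻¹' B) := by
      have hm : MeasurableSet ((extChartAt I x).source ∩ extChartAt I x ⁻¹' B) :=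
        ((continuousOn_extChartAt x).isOpen_inter_preimage
          (isOpen_extChartAt_source x) Metric.isOpen_ball).measurableSet
      rw [← lintegral_indicator hS, ← lintegral_indicator_one hm]
      refine lintegral_congr fun y => ?_
      exact congrFun (Set.indicator_indicator (extChartAt I x).source
        (extChartAt I x ⁻¹' B) (1 : M → ℝ≥0∞)) y
    rw [← h1, h]
    calc ∫⁻ y in (extChartAt I x).target, ENNReal.ofReal (ρ y) * B.indicator 1 y
        ≤ ∫⁻ y in (extChartAt I x).target,
            B.indicator (fun _ => ENNReal.ofReal (ρ (extChartAt I x x) + 1)) y := by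
          refine setLIntegral_mono' (measurableSet_extChartAt_target x) fun y hy => ?_
          by_cases hyB : y ∈ B
          · simp only [Set.indicator_of_mem hyB, Pi.one_apply, mul_one]
            exact ENNReal.ofReal_le_ofReal (hb ⟨hyB, hy⟩).le
          · simp [hyB]
      _ ≤ ∫⁻ y, B.indicator (fun _ => ENNReal.ofReal (ρ (extChartAt I x x) + 1)) y :=
          setLIntegral_le_lintegral _ _
      _ < ⊤ := by
          rw [lintegral_indicator_const hB]
          exact ENNReal.mul_lt_top ENNReal.ofReal_lt_top measure_ball_lt_top

/-- A property valid almost everywhere in a chart domain with respect to Lebesgue measure is valid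
almost everywhere with respect to `μ`. -/
theorem IsSmoothMeasure.ae_of_ae_chart (hμ : IsSmoothMeasure I μ) (c : M)
    {p : EuclideanSpace ℝ (Fin n) → Prop}
    (hp : ∀ᵐ y, y ∈ (extChartAt I c).target → p y) :
    ∀ᵐ x ∂μ, x ∈ (extChartAt I c).source → p (extChartAt I c x) := by
  obtain ⟨ρ, -, -, hmap⟩ := hμ c
  have hchart : AEMeasurable (extChartAt I c) (μ.restrict (extChartAt I c).source) :=
    (continuousOn_extChartAt c).aemeasurable (isOpen_extChartAt_source c).measurableSet
  have hp' : ∀ᵐ y ∂(volume.restrict (extChartAt I c).target), p y :=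
    (ae_restrict_iff' (measurableSet_extChartAt_target c)).mpr hp
  refine (ae_restrict_iff' (isOpen_extChartAt_source c).measurableSet).mp ?_
  refine ae_of_ae_map hchart ?_
  rw [hmap]
  exact (withDensity_absolutelyContinuous _ _).ae_le hp'

end SmoothMeasure

/-! ### The orbit space of `M × M` -/

section Pairs

variable {G M : Type*} [Group G] [MulAction Gᵐᵒᵖ M] [MeasurableSpace G]
  [MeasurableSpace M] (e : MeasurableTrivialization G M)

/-- The orbit space of `M × M` is `M × M / G`: the class of `(x, y)` corresponds to
`(x (τ y)⁻¹, y G)`. -/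
def MeasurableTrivialization.pairEquiv [MeasurableInv G]
    (hsmul : Measurable fun p : M × G => op p.2 • p.1) :
    M × OrbitSpace G M ≃ᵐ OrbitSpace G (M × M) where
  toFun p := toOrbit G (p.1, e.section p.2)
  invFun := Quotient.lift (fun z : M × M => (op (e.coord z.2)⁻¹ • z.1, toOrbit G z.2)) (by
    rintro a b hab
    obtain ⟨g, rfl⟩ := (MulAction.orbitRel_apply.mp hab : a ∈ MulAction.orbit Gᵐᵒᵖ b)
    have := e.coord_smul b.2 (unop g)
    simp only [op_unop] at this
    refine Prod.ext ?_ (toOrbit_smul (unop g) b.2)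
    simp only [Prod.smul_snd, Prod.smul_fst, this, smul_smul, mul_inv_rev, op_mul, op_inv,
      op_unop]
    simp)
  left_inv p := by
    change (op (e.coord (e.section p.2))⁻¹ • p.1, toOrbit G (e.section p.2)) = p
    simp [e.coord_section, e.toOrbit_section]
  right_inv q := by
    induction q using Quotient.inductionOn with
    | h z =>
      change toOrbit G (op (e.coord z.2)⁻¹ • z.1, e.section (toOrbit G z.2)) = toOrbit G z
      rw [e.section_toOrbit]
      exact toOrbit_smul _ z
  measurable_toFun := measurable_toOrbit.comp
    (measurable_fst.prodMk (e.measurable_section.comp measurable_snd))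
  measurable_invFun := by
    refine measurable_from_quotient.mpr ?_
    exact (hsmul.comp (measurable_fst.prodMk (e.measurable_coord.comp measurable_snd).inv)).prodMk
      (measurable_toOrbit.comp measurable_snd)

theorem MeasurableTrivialization.pairEquiv_symm_toOrbit [MeasurableInv G]
    (hsmul : Measurable fun p : M × G => op p.2 • p.1) (z : M × M) :
    (e.pairEquiv hsmul).symm (toOrbit G z) = (op (e.coord z.2)⁻¹ • z.1, toOrbit G z.2) := rfl

/-- Both integrals are lifted with the same weight w(τ y), to M × M and to M. For fixed y the inner
integrals over x differ by the substitution x ↦ x τ(y), which μ does not see. -/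
theorem MeasurableTrivialization.measurePreserving_pairEquiv [MeasurableMul G] [MeasurableInv G]
    {haar : Measure G} [haar.IsMulLeftInvariant] [SigmaFinite haar] [NeZero haar]
    [MeasurableConstSMul Gᵐᵒᵖ M] {μ : Measure M} [SigmaFinite μ] [SMulInvariantMeasure Gᵐᵒᵖ M μ]
    {ν : Measure (OrbitSpace G M)} (hν : IsQuotientMeasure haar μ ν)
    {ν₂ : Measure (OrbitSpace G (M × M))} (hν₂ : IsQuotientMeasure haar (μ.prod μ) ν₂)
    (hsmul : Measurable fun p : M × G => op p.2 • p.1) :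
    MeasurePreserving (e.pairEquiv hsmul) (μ.prod ν) ν₂ := by
  have := hν.sigmaFinite
  obtain ⟨w, hw, hw1⟩ := exists_measurable_lintegral_eq_one haar
  refine ⟨(e.pairEquiv hsmul).measurable, ?_⟩
  ext B hB
  rw [Measure.map_apply (e.pairEquiv hsmul).measurable hB,
    ← lintegral_indicator_one hB, ← lintegral_indicator_one
      ((e.pairEquiv hsmul).measurable hB)]
  set f : OrbitSpace G (M × M) → ℝ≥0∞ := B.indicator 1
  have hf : Measurable f := measurable_one.indicator hB
  have hfe : Measurable fun p => f (e.pairEquiv hsmul p) :=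
    hf.comp (e.pairEquiv hsmul).measurable
  change ∫⁻ p, f (e.pairEquiv hsmul p) ∂_ = _
  have h2 := hν₂.lintegral_quotient (τ := fun z : M × M => e.coord z.2)
    (e.measurable_coord.comp measurable_snd) (fun z g => e.coord_smul z.2 g) hw hw1 hf
  have hF : Measurable fun q => ∫⁻ x, f (e.pairEquiv hsmul (x, q)) ∂μ :=
    hfe.lintegral_prod_left'
  have hwf : Measurable fun z : M × M => w (e.coord z.2) * f (toOrbit G z) :=
    (hw.comp (e.measurable_coord.comp measurable_snd)).mul (hf.comp measurable_toOrbit)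
  rw [h2, lintegral_prod_symm _ hfe.aemeasurable, lintegral_prod_symm _ hwf.aemeasurable,
    hν.lintegral_quotient e.measurable_coord e.coord_smul hw hw1 hF]
  refine lintegral_congr fun y => ?_
  have hm : Measurable fun x => f (toOrbit G (x, y)) :=
    (hf.comp measurable_toOrbit).comp measurable_prodMk_right
  change _ = ∫⁻ x, w (e.coord y) * f (toOrbit G (x, y)) ∂μ
  rw [lintegral_const_mul _ hm]
  congr 1
  rw [← (measurePreserving_smul (op (e.coord y)) μ).lintegral_comp hm]
  refine lintegral_congr fun x => ?_
  congr 1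
  apply (e.pairEquiv hsmul).symm.injective
  rw [e.pairEquiv_symm_toOrbit, MeasurableEquiv.symm_apply_apply]
  simp

end Pairs

/-! ### Tensor products of test functions of one variable -/

/-- Test functions of one variable with support in the interval `(a, b)`. -/
structure IsIntervalTest (a b : ℝ) (f : ℝ → ℝ) : Prop where
  contDiff : ContDiff ℝ ∞ f
  compact : HasCompactSupport f
  subset : tsupport f ⊆ Set.Ioo a b

theorem IsIntervalTest.integrable {a b : ℝ} {f : ℝ → ℝ} (hf : IsIntervalTest a b f) :
    Integrable f := hf.contDiff.continuous.integrable_of_hasCompactSupport hf.compact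

theorem IsIntervalTest.const_mul {a b : ℝ} {f : ℝ → ℝ} (hf : IsIntervalTest a b f) (c : ℝ) :
    IsIntervalTest a b (fun x => c * f x) :=
  ⟨contDiff_const.mul hf.contDiff, hf.compact.mul_left,
    (tsupport_mul_subset_right (f := fun _ => c) (g := f)).trans hf.subset⟩

/-- A test function `φ ≥ 0` on an interval is the sum of a multiple of a fixed test function `η` and
of the derivative of a test function. -/
theorem IsIntervalTest.exists_primitive {a b : ℝ} {φ η : ℝ → ℝ} (hφ : IsIntervalTest a b φ)
    (hη : IsIntervalTest a b η) (hφ0 : ∀ x, 0 ≤ φ x) (hη0 : ∀ x, 0 ≤ η x) (hη1 : ∫ x, η x = 1) :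
    ∃ Φ : ℝ → ℝ, IsIntervalTest a b Φ ∧ (∀ x, φ x = deriv Φ x + (∫ t, φ t) * η x) ∧
      ∀ x, |Φ x| ≤ 2 * ∫ t, φ t := by
  set c := ∫ t, φ t
  have hc : 0 ≤ c := integral_nonneg hφ0
  -- Subtracting the mass of φ leaves a function of integral zero, so its primitive vanishes on both
  -- sides of the support. Its L¹ norm, at most 2c, bounds the primitive.
  set ψ : ℝ → ℝ := fun x => φ x - c * η x
  have hψs : ContDiff ℝ ∞ ψ := hφ.contDiff.sub (contDiff_const.mul hη.contDiff)
  have hψi : Integrable ψ := hφ.integrable.sub (hη.integrable.const_mul c)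
  have hψ0 : ∫ x, ψ x = 0 := by
    rw [integral_sub hφ.integrable (hη.integrable.const_mul c), integral_const_mul, hη1]
    simp [c]
  have hψn : ∫ x, ‖ψ x‖ ≤ 2 * c := by
    calc ∫ x, ‖ψ x‖ ≤ ∫ x, (φ x + c * η x) := by
          refine integral_mono hψi.norm (hφ.integrable.add (hη.integrable.const_mul c)) fun x => ?_
          refine (norm_sub_le _ _).trans_eq ?_
          rw [Real.norm_of_nonneg (hφ0 x), Real.norm_of_nonneg (mul_nonneg hc (hη0 x))]
      _ = 2 * c := by
          rw [integral_add hφ.integrable (hη.integrable.const_mul c), integral_const_mul, hη1]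
          ring
  set K := tsupport φ ∪ tsupport η
  have hK : IsCompact K := hφ.compact.union hη.compact
  have hKs : K ⊆ Set.Ioo a b := Set.union_subset hφ.subset hη.subset
  have hKne : K.Nonempty := by
    by_contra h
    rw [Set.not_nonempty_iff_eq_empty, Set.union_empty_iff] at h
    have : η = 0 := tsupport_eq_empty_iff.mp h.2
    simp [this] at hη1
  have hψK : ∀ x, x ∉ K → ψ x = 0 := by
    intro x hx
    rw [Set.mem_union, not_or] at hx
    simp [ψ, image_eq_zero_of_notMem_tsupport hx.1, image_eq_zero_of_notMem_tsupport hx.2]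
  obtain ⟨a', ha'K, ha'⟩ := hK.exists_isLeast hKne
  obtain ⟨b', hb'K, hb'⟩ := hK.exists_isGreatest hKne
  -- Room is left between the support of ψ and the ends of the interval, so that the closed support
  -- of the primitive stays in the open interval.
  obtain ⟨a₁, ha₁, ha₁'⟩ := exists_between (hKs ha'K).1
  obtain ⟨b₁, hb₁, hb₁'⟩ := exists_between (hKs hb'K).2
  have hψa : ∀ x ≤ a₁, ψ x = 0 := fun x hx => hψK x fun h => by
    have := ha' h; linarith
  have hψb : ∀ x, b₁ ≤ x → ψ x = 0 := fun x hx => hψK x fun h => by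
    have := hb' h; linarith
  set Φ : ℝ → ℝ := fun x => ∫ t in a..x, ψ t
  have hd : ∀ x, HasDerivAt Φ (ψ x) x := fun x =>
    (hψs.continuous.integral_hasStrictDerivAt a x).hasDerivAt
  have hderiv : deriv Φ = ψ := funext fun x => (hd x).deriv
  have hzero : ∀ x, x ∉ Set.Icc a₁ b₁ → Φ x = 0 := by
    intro x hx
    rw [Set.mem_Icc, not_and_or, not_le, not_le] at hx
    rcases hx with hx | hx
    · refine intervalIntegral.integral_zero_ae (ae_of_all _ fun t ht => hψa t ?_)
      have := ht.2
      rcases max_cases a x with h | h <;> linarith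
    · rw [← hψ0]
      refine intervalIntegral.integral_eq_integral_of_support_subset fun t ht => ?_
      constructor
      · by_contra h
        exact ht (hψa t (by linarith))
      · by_contra h
        exact ht (hψb t (by linarith))
  have hts : tsupport Φ ⊆ Set.Icc a₁ b₁ :=
    closure_minimal (fun x hx => by_contra fun h => hx (hzero x h)) isClosed_Icc
  refine ⟨Φ, ⟨?_, ?_, ?_⟩, fun x => ?_, fun x => ?_⟩
  · rw [contDiff_infty_iff_deriv, hderiv]
    exact ⟨fun x => (hd x).differentiableAt, hψs⟩
  · exact isCompact_Icc.of_isClosed_subset (isClosed_tsupport _) hts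
  · exact hts.trans fun x hx => ⟨ha₁.trans_le hx.1, hx.2.trans_lt hb₁'⟩
  · rw [hderiv]; simp [ψ]
  · refine le_trans ?_ hψn
    rw [← Real.norm_eq_abs]
    refine (intervalIntegral.norm_integral_le_integral_norm_uIoc (f := ψ)).trans ?_
    exact setIntegral_le_integral hψi.norm (ae_of_all _ fun t => norm_nonneg _)

theorem exists_isIntervalTest {a b : ℝ} (hab : a < b) :
    ∃ (η : ℝ → ℝ) (B : ℝ), IsIntervalTest a b η ∧ (∀ x, 0 ≤ η x) ∧ (∀ x, η x ≤ B) ∧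
      ∫ x, η x = 1 := by
  let β : ContDiffBump ((a + b) / 2) :=
    ⟨(b - a) / 8, (b - a) / 4, by linarith, by linarith⟩
  have hts : tsupport (β.normed volume) ⊆ Set.Ioo a b := by
    rw [β.tsupport_normed_eq, Real.closedBall_eq_Icc]
    intro x hx
    change x ∈ Set.Icc ((a + b) / 2 - (b - a) / 4) ((a + b) / 2 + (b - a) / 4) at hx
    constructor <;> linarith [hx.1, hx.2]
  obtain ⟨B, hB⟩ := β.hasCompactSupport_normed.exists_bound_of_continuous
    (β.continuous_normed (μ := volume))
  exact ⟨β.normed volume, B, ⟨β.contDiff_normed (n := ⊤), β.hasCompactSupport_normed, hts⟩,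
    β.nonneg_normed, fun x => (le_abs_self _).trans (hB x), β.integral_normed⟩

section Tensor

variable {n : ℕ}

/-- The function `x ↦ ∏ f i (x i)`. -/
def tensorTest (f : Fin n → ℝ → ℝ) (x : EuclideanSpace ℝ (Fin n)) : ℂ :=
  ((∏ i, f i (x i) : ℝ) : ℂ)

/-- The open box with sides `(a i, b i)`. -/
def openBox (a b : Fin n → ℝ) : Set (EuclideanSpace ℝ (Fin n)) :=
  {x | ∀ i, x i ∈ Set.Ioo (a i) (b i)}

theorem contDiff_coord (i : Fin n) : ContDiff ℝ ∞ fun x : EuclideanSpace ℝ (Fin n) => x i :=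
  (EuclideanSpace.proj (𝕜 := ℝ) i).contDiff

theorem isOpen_openBox (a b : Fin n → ℝ) : IsOpen (openBox a b) := by
  have : openBox a b = ⋂ i, (fun x : EuclideanSpace ℝ (Fin n) => x i) ⁻¹' Set.Ioo (a i) (b i) := by
    ext x; simp [openBox]
  rw [this]
  exact isOpen_iInter_of_finite fun i => isOpen_Ioo.preimage (contDiff_coord i).continuous

theorem contDiff_tensorTest {f : Fin n → ℝ → ℝ} (hf : ∀ i, ContDiff ℝ ∞ (f i)) :
    ContDiff ℝ ∞ (tensorTest f) := by
  have h : ContDiff ℝ ∞ fun x : EuclideanSpace ℝ (Fin n) => ∏ i, f i (x i) :=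
    contDiff_prod fun i _ => (hf i).comp (contDiff_coord i)
  exact Complex.ofRealCLM.contDiff.comp h

theorem tensorTest_eq_zero {f : Fin n → ℝ → ℝ} {x : EuclideanSpace ℝ (Fin n)} {i : Fin n}
    (h : f i (x i) = 0) : tensorTest f x = 0 := by
  rw [tensorTest, Finset.prod_eq_zero (Finset.mem_univ i) h, Complex.ofReal_zero]

theorem tsupport_tensorTest_subset {a b : Fin n → ℝ} {f : Fin n → ℝ → ℝ}
    (hf : ∀ i, IsIntervalTest (a i) (b i) (f i)) :
    HasCompactSupport (tensorTest f) ∧ tsupport (tensorTest f) ⊆ openBox a b := by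
  let K : Set (EuclideanSpace ℝ (Fin n)) :=
    (EuclideanSpace.equiv (Fin n) ℝ).symm '' Set.univ.pi fun i => tsupport (f i)
  have hK : IsCompact K := (isCompact_univ_pi fun i => (hf i).compact).image
    (EuclideanSpace.equiv (Fin n) ℝ).symm.continuous
  have hsub : Function.support (tensorTest f) ⊆ K := by
    intro x hx
    refine ⟨fun i => x i, fun i _ => ?_, rfl⟩
    by_contra h
    exact hx (tensorTest_eq_zero (image_eq_zero_of_notMem_tsupport h))
  refine ⟨HasCompactSupport.of_support_subset_isCompact hK hsub, ?_⟩
  refine (closure_minimal hsub hK.isClosed).trans ?_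
  rintro _ ⟨y, hy, rfl⟩ i
  exact (hf i).subset (hy i trivial)

theorem hasDerivAt_tensorTest_update {f : Fin n → ℝ → ℝ} {j : Fin n} {x : EuclideanSpace ℝ (Fin n)}
    (hf : DifferentiableAt ℝ (f j) (x j)) :
    HasDerivAt (fun t : ℝ => tensorTest f (x + t • EuclideanSpace.single j 1))
      (tensorTest (Function.update f j (deriv (f j))) x) 0 := by
  have h1 : ∀ t : ℝ, tensorTest f (x + t • EuclideanSpace.single j 1) =
      ((f j (x j + t) * ∏ i ∈ Finset.univ.erase j, f i (x i) : ℝ) : ℂ) := by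
    intro t
    rw [tensorTest, ← Finset.mul_prod_erase _ _ (Finset.mem_univ j)]
    congr 2
    · simp
    · refine Finset.prod_congr rfl fun i hi => ?_
      simp [Finset.ne_of_mem_erase hi]
  have h2 : tensorTest (Function.update f j (deriv (f j))) x =
      ((deriv (f j) (x j) * ∏ i ∈ Finset.univ.erase j, f i (x i) : ℝ) : ℂ) := by
    rw [tensorTest, ← Finset.mul_prod_erase _ _ (Finset.mem_univ j)]
    congr 2
    · simp
    · refine Finset.prod_congr rfl fun i hi => ?_
      simp [Finset.ne_of_mem_erase hi]
  simp only [h1, h2]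
  have h3 : HasDerivAt (fun t : ℝ => f j (x j + t)) (deriv (f j) (x j)) 0 := by
    have := hf.hasDerivAt
    rw [← add_zero (x j)] at this
    have h4 := this.comp_const_add (x j) 0
    simpa using h4
  exact (h3.mul_const _).ofReal_comp

-- Injectivity of α means that no coordinate is differentiated twice, so each factor receives at
-- most one derivative. The induction removes the first direction, whose factor is still untouched
-- by the others.
open Classical in
theorem iteratedFDeriv_tensorTest {f : Fin n → ℝ → ℝ} (hf : ∀ i, ContDiff ℝ ∞ (f i)) :
    ∀ (k : ℕ) (α : Fin k → Fin n), Function.Injective α → ∀ x : EuclideanSpace ℝ (Fin n),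
      iteratedFDeriv ℝ k (tensorTest f) x (fun j => EuclideanSpace.single (α j) 1) =
        tensorTest (fun i => if i ∈ Set.range α then deriv (f i) else f i) x := by
  intro k
  induction k with
  | zero =>
    intro α _ x
    rw [iteratedFDeriv_zero_apply]
    congr 1
  | succ k ih =>
    intro α hα x
    rw [iteratedFDeriv_succ_apply_left]
    have hdiff : DifferentiableAt ℝ (iteratedFDeriv ℝ k (tensorTest f)) x :=
      (contDiff_tensorTest hf).differentiable_iteratedFDeriv
        (by exact_mod_cast WithTop.coe_lt_top _) x
    have hline : HasDerivAt (fun t : ℝ => iteratedFDeriv ℝ k (tensorTest f)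
        (x + t • EuclideanSpace.single (α 0) 1))
        (fderiv ℝ (iteratedFDeriv ℝ k (tensorTest f)) x (EuclideanSpace.single (α 0) 1)) 0 :=
      hdiff.hasFDerivAt.hasLineDerivAt _
    have h1 := (ContinuousMultilinearMap.apply ℝ (fun _ : Fin k => EuclideanSpace ℝ (Fin n)) ℂ
      (fun j => EuclideanSpace.single (α j.succ) 1)).hasFDerivAt.comp_hasDerivAt 0 hline
    have hα' : Function.Injective fun j : Fin k => α j.succ :=
      hα.comp (Fin.succ_injective k)
    have h0 : α 0 ∉ Set.range fun j : Fin k => α j.succ := by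
      rintro ⟨j, hj⟩
      exact (Fin.succ_ne_zero j) (hα hj)
    set g : Fin n → ℝ → ℝ :=
      fun i => if i ∈ Set.range (fun j : Fin k => α j.succ) then deriv (f i) else f i with hg
    have hg0 : g (α 0) = f (α 0) := if_neg h0
    have h2 : HasDerivAt (fun t : ℝ => tensorTest g (x + t • EuclideanSpace.single (α 0) 1))
        (tensorTest (Function.update g (α 0) (deriv (g (α 0)))) x) 0 := by
      refine hasDerivAt_tensorTest_update ?_
      rw [hg0]
      exact ((hf (α 0)).differentiable (by simp)) _
    have h3 := h1.unique (h2.congr_of_eventuallyEq (Eventually.of_forall fun t => by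
      exact ih _ hα' (x + t • EuclideanSpace.single (α 0) 1)))
    refine Eq.trans ?_ (h3.trans ?_)
    · rfl
    · congr 1
      funext i
      by_cases hi : i = α 0
      · subst hi
        simp [hg0]
      · rw [Function.update_of_ne hi]
        simp only [hg, Set.mem_range, Fin.exists_fin_succ, Ne.symm hi, false_or]

end Tensor

/-! ### Boundedness of Sobolev functions on a box -/

section Box

variable {n : ℕ}

theorem integrableOn_mul_tensorTest {a b : Fin n → ℝ} {w : EuclideanSpace ℝ (Fin n) → ℂ}
    (hw : IntegrableOn w (openBox a b)) {F : EuclideanSpace ℝ (Fin n) → ℂ} (hF : Continuous F)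
    (hFs : HasCompactSupport F) (hFb : tsupport F ⊆ openBox a b) :
    Integrable fun x => w x * F x := by
  obtain ⟨C, hC⟩ := hFs.exists_bound_of_continuous hF
  have h1 : IntegrableOn (fun x => w x * F x) (openBox a b) :=
    hw.mul_bdd hF.aestronglyMeasurable (ae_of_all _ hC)
  refine (integrableOn_iff_integrable_of_support_subset fun x hx => ?_).mp h1
  exact hFb (subset_tsupport _ (right_ne_zero_of_mul hx))

open Classical in
/-- If the mixed weak derivatives of `w` exist in `L²`, the pairing of `w` with tensor products of
nonnegative test functions `φ i` is bounded by a multiple of `∏ ∫ φ i`. -/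
theorem exists_bound_pairing_tensorTest {a b : Fin n → ℝ} (hab : ∀ i, a i < b i)
    {Ω : Set (EuclideanSpace ℝ (Fin n))} (hQ : openBox a b ⊆ Ω)
    {w : EuclideanSpace ℝ (Fin n) → ℂ} (hw : IntegrableOn w (openBox a b))
    (hfin : volume (openBox a b) ≠ ⊤)
    (hweak : ∀ k ≤ n, ∀ α : Fin k → Fin n, ∃ g : EuclideanSpace ℝ (Fin n) → ℂ,
      MemLp g 2 (volume.restrict Ω) ∧ IsWeakPartial Ω α w g) :
    ∃ C : ℝ, ∀ φ : Fin n → ℝ → ℝ, (∀ i, IsIntervalTest (a i) (b i) (φ i)) →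
      (∀ i x, 0 ≤ φ i x) →
      ‖∫ x, w x * tensorTest φ x‖ ≤ C * ∏ i, ∫ t, φ i t := by
  choose η B hη hη0 hηB hη1 using fun i => exists_isIntervalTest (hab i)
  have hB0 : ∀ i, 0 ≤ B i := fun i => (hη0 i 0).trans (hηB i 0)
  -- A set S of coordinates becomes a multi-index by increasing enumeration: no repetition, and
  -- order at most n.
  have hg : ∀ S : Finset (Fin n), ∃ g : EuclideanSpace ℝ (Fin n) → ℂ,
      MemLp g 2 (volume.restrict Ω) ∧ IsWeakPartial Ω (S.orderEmbOfFin rfl) w g := fun S =>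
    hweak S.card (by simpa using S.card_le_univ) _
  choose g hgL hgw using hg
  have hgi : ∀ S, IntegrableOn (g S) (openBox a b) := by
    intro S
    have : IsFiniteMeasure (volume.restrict (openBox a b)) :=
      ⟨by simpa using hfin.lt_top⟩
    exact ((hgL S).mono_measure (Measure.restrict_mono hQ le_rfl)).integrable one_le_two
  -- Each summand is a sup bound for the test functions, up to the factor ∏ ∫ φ i, times the L¹ norm
  -- of the mixed weak derivative along S.
  refine ⟨∑ S ∈ Finset.univ.powerset, (∏ i, (2 + B i)) * ∫ x in openBox a b, ‖g S x‖,
    fun φ hφ hφ0 => ?_⟩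
  choose Φ hΦ hΦe hΦb using fun i =>
    (hφ i).exists_primitive (hη i) (hφ0 i) (hη0 i) (hη1 i)
  set c : Fin n → ℝ := fun i => ∫ t, φ i t
  have hc : ∀ i, 0 ≤ c i := fun i => integral_nonneg (hφ0 i)
  -- the test function whose mixed derivative along `S` is a summand of `∏ φ i`
  let F : Finset (Fin n) → Fin n → ℝ → ℝ :=
    fun S i => if i ∈ S then Φ i else fun x => c i * η i x
  let DF : Finset (Fin n) → Fin n → ℝ → ℝ :=
    fun S i => if i ∈ S then deriv (Φ i) else fun x => c i * η i x
  have hF : ∀ S i, IsIntervalTest (a i) (b i) (F S i) := by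
    intro S i
    by_cases h : i ∈ S
    · simpa only [F, h, if_true] using hΦ i
    · simpa only [F, h, if_false] using (hη i).const_mul (c i)
  have hiter : ∀ S x, iteratedFDeriv ℝ S.card (tensorTest (F S)) x
      (fun j => EuclideanSpace.single (S.orderEmbOfFin rfl j) 1) = tensorTest (DF S) x := by
    intro S x
    rw [iteratedFDeriv_tensorTest (fun i => (hF S i).contDiff) _ _
      (S.orderEmbOfFin rfl).injective x]
    congr 1
    funext i
    by_cases h : i ∈ S <;> simp [F, DF, h]
  -- Expansion of ∏ (Φ i' + c i η i) over the set S of factors in which the derivative is chosen.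
  have hsum : ∀ x, tensorTest φ x = ∑ S ∈ Finset.univ.powerset, tensorTest (DF S) x := by
    intro x
    simp only [tensorTest, ← Complex.ofReal_sum]
    congr 1
    rw [Finset.prod_congr rfl fun i _ => hΦe i (x i), Finset.prod_add]
    refine Finset.sum_congr rfl fun S _ => ?_
    rw [← Finset.prod_sdiff (Finset.subset_univ S), mul_comm]
    congr 1
    · refine Finset.prod_congr rfl fun i hi => ?_
      simp [DF, (Finset.mem_sdiff.mp hi).2, c]
    · refine Finset.prod_congr rfl fun i hi => ?_
      simp [DF, hi]
  have hDF : ∀ S i, IsIntervalTest (a i) (b i) (DF S i) := by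
    intro S i
    by_cases h : i ∈ S
    · have : DF S i = deriv (Φ i) := by simp [DF, h]
      rw [this]
      exact ⟨(contDiff_infty_iff_deriv.mp (hΦ i).contDiff).2, (hΦ i).compact.deriv,
        (tsupport_deriv_subset).trans (hΦ i).subset⟩
    · simpa only [DF, h, if_false] using (hη i).const_mul (c i)
  have hwDF : ∀ S, Integrable fun x => w x * tensorTest (DF S) x := fun S =>
    integrableOn_mul_tensorTest hw (contDiff_tensorTest fun i => (hDF S i).contDiff).continuous
      (tsupport_tensorTest_subset (hDF S)).1 (tsupport_tensorTest_subset (hDF S)).2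
  have hΩ : ∀ (u : EuclideanSpace ℝ (Fin n) → ℂ) {f : Fin n → ℝ → ℝ},
      (∀ i, IsIntervalTest (a i) (b i) (f i)) →
      ∀ s : Set (EuclideanSpace ℝ (Fin n)), openBox a b ⊆ s →
      ∫ x in s, u x * tensorTest f x = ∫ x, u x * tensorTest f x := by
    intro u f hf s hs
    refine setIntegral_eq_integral_of_forall_compl_eq_zero fun x hx => ?_
    rw [image_eq_zero_of_notMem_tsupport (f := tensorTest f), mul_zero]
    exact fun h => hx (hs ((tsupport_tensorTest_subset hf).2 h))
  have hterm : ∀ S, ‖∫ x, w x * tensorTest (DF S) x‖ ≤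
      ((∏ i, (2 + B i)) * ∫ x in openBox a b, ‖g S x‖) * ∏ i, c i := by
    intro S
    have hFS := tsupport_tensorTest_subset (hF S)
    have hCD := contDiff_tensorTest fun i => (hF S i).contDiff
    have h1 := hgw S (tensorTest (F S)) hCD hFS.1 (hFS.2.trans hQ)
    simp only [hiter] at h1
    rw [hΩ w (hDF S) Ω hQ, hΩ (g S) (hF S) Ω hQ, ← hΩ (g S) (hF S) _ subset_rfl] at h1
    rw [h1, norm_mul, norm_pow, norm_neg, norm_one, one_pow, one_mul]
    -- A factor is at most 2 c i if it is a primitive and at most B i c i otherwise; 2 + B i covers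
    -- both cases.
    have hbd : ∀ x, ‖tensorTest (F S) x‖ ≤ (∏ i, (2 + B i)) * ∏ i, c i := by
      intro x
      rw [tensorTest, Complex.norm_real, Real.norm_eq_abs, Finset.abs_prod,
        ← Finset.prod_mul_distrib]
      refine Finset.prod_le_prod (fun i _ => abs_nonneg _) fun i _ => ?_
      by_cases h : i ∈ S
      · simp only [F, h, if_true]
        refine (hΦb i _).trans ?_
        have := mul_nonneg (hB0 i) (hc i)
        change 2 * c i ≤ _
        nlinarith
      · simp only [F, h, if_false]
        rw [abs_of_nonneg (mul_nonneg (hc i) (hη0 i _))]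
        nlinarith [mul_le_mul_of_nonneg_left (hηB i (x i)) (hc i), hc i]
    calc ‖∫ x in openBox a b, g S x * tensorTest (F S) x‖
        ≤ ∫ x in openBox a b, ‖g S x‖ * ((∏ i, (2 + B i)) * ∏ i, c i) := by
          refine norm_integral_le_of_norm_le ((hgi S).norm.mul_const _)
            (ae_of_all _ fun x => ?_)
          rw [norm_mul]
          exact mul_le_mul_of_nonneg_left (hbd x) (norm_nonneg _)
      _ = _ := by rw [integral_mul_const]; ring
  simp only [hsum, Finset.mul_sum]
  rw [integral_finsetSum _ fun S _ => hwDF S]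
  refine (norm_sum_le _ _).trans ?_
  rw [Finset.sum_mul]
  exact Finset.sum_le_sum fun S _ => hterm S

theorem measurableSet_cube (c : Fin n → ℝ) (r : ℝ) :
    MeasurableSet {x : EuclideanSpace ℝ (Fin n) | ∀ i, |x i - c i| ≤ r} := by
  rw [Set.ofPred_forall]
  refine (isClosed_iInter fun i => isClosed_le ?_ continuous_const).measurableSet
  exact ((contDiff_coord i).continuous.sub continuous_const).abs

/-- Passage from test functions to the indicator functions of cubes. -/
theorem norm_setIntegral_cube_le {a b : Fin n → ℝ} {w : EuclideanSpace ℝ (Fin n) → ℂ}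
    (hw : IntegrableOn w (openBox a b)) {C : ℝ}
    (hC : ∀ φ : Fin n → ℝ → ℝ, (∀ i, IsIntervalTest (a i) (b i) (φ i)) →
      (∀ i x, 0 ≤ φ i x) → ‖∫ x, w x * tensorTest φ x‖ ≤ C * ∏ i, ∫ t, φ i t)
    (hC0 : 0 ≤ C) {c : Fin n → ℝ} {r : ℝ} (hr : 0 < r)
    (hcr : ∀ i, a i < c i - r ∧ c i + r < b i) :
    ‖∫ x in {x : EuclideanSpace ℝ (Fin n) | ∀ i, |x i - c i| ≤ r}, w x‖ ≤ C * (2 * r) ^ n := by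
  obtain ⟨ε₀, hε₀, hε₀'⟩ : ∃ ε₀ > 0, ∀ i, a i < c i - r - ε₀ ∧ c i + r + ε₀ < b i := by
    have h : ∀ᶠ ε in 𝓝[>] (0 : ℝ), ∀ i, a i < c i - r - ε ∧ c i + r + ε < b i := by
      refine eventually_all.mpr fun i => ?_
      have h1 : Tendsto (fun ε : ℝ => c i - r - ε) (𝓝[>] 0) (𝓝 (c i - r - 0)) :=
        ((continuous_const.sub continuous_id).tendsto 0).mono_left nhdsWithin_le_nhds
      have h2 : Tendsto (fun ε : ℝ => c i + r + ε) (𝓝[>] 0) (𝓝 (c i + r + 0)) :=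
        ((continuous_const.add continuous_id).tendsto 0).mono_left nhdsWithin_le_nhds
      rw [sub_zero] at h1
      rw [add_zero] at h2
      exact (h1.eventually (lt_mem_nhds (hcr i).1)).and (h2.eventually (gt_mem_nhds (hcr i).2))
    obtain ⟨ε, hε, hε'⟩ := (h.and self_mem_nhdsWithin).exists
    exact ⟨ε, hε', hε⟩
  let ε : ℕ → ℝ := fun k => ε₀ / (k + 1)
  have hε : ∀ k, 0 < ε k := fun k => by positivity
  have hεle : ∀ k, ε k ≤ ε₀ := fun k => div_le_self hε₀.le (by linarith [k.cast_nonneg (α := ℝ)])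
  have hεlim : Tendsto ε atTop (𝓝 0) :=
    tendsto_const_div_atTop_nhds_zero_nat ε₀ |>.comp (tendsto_add_atTop_nat 1) |>.congr
      fun k => by simp [ε]
  -- Bumps equal to 1 on the side of the cube and supported within ε k of it: their products
  -- decrease to the indicator of the closed cube in the limit, and their integrals are at most 2(r
  -- + ε k).
  let β : ℕ → ∀ i, ContDiffBump (c i) := fun k i => ⟨r, r + ε k, hr, by linarith [hε k]⟩
  let φ : ℕ → Fin n → ℝ → ℝ := fun k i => β k i
  have hφ : ∀ k i, IsIntervalTest (a i) (b i) (φ k i) := by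
    refine fun k i => ⟨(β k i).contDiff, (β k i).hasCompactSupport, ?_⟩
    rw [(β k i).tsupport_eq, Real.closedBall_eq_Icc]
    intro x hx
    change x ∈ Set.Icc (c i - (r + ε k)) (c i + (r + ε k)) at hx
    have := hε₀' i
    have := hεle k
    constructor <;> linarith [hx.1, hx.2]
  have hbound : ∀ k, ‖∫ x, w x * tensorTest (φ k) x‖ ≤ C * ∏ _i : Fin n, (2 * (r + ε k)) := by
    intro k
    refine (hC _ (hφ k) fun i x => (β k i).nonneg).trans ?_
    refine mul_le_mul_of_nonneg_left ?_ hC0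
    refine Finset.prod_le_prod (fun i _ => integral_nonneg fun x => (β k i).nonneg) fun i _ => ?_
    refine ((β k i).integral_le_measure_closedBall (μ := volume)).trans_eq ?_
    rw [measureReal_def, Real.volume_closedBall, ENNReal.toReal_ofReal]
    exact mul_nonneg zero_le_two (add_pos hr (hε k)).le
  have hlimR : Tendsto (fun k => C * ∏ _i : Fin n, (2 * (r + ε k))) atTop
      (𝓝 (C * (2 * r) ^ n)) := by
    simp only [Finset.prod_const, Finset.card_univ, Fintype.card_fin]
    have : Tendsto (fun k => 2 * (r + ε k)) atTop (𝓝 (2 * (r + 0))) :=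
      (tendsto_const_nhds.add hεlim).const_mul 2
    rw [add_zero] at this
    exact (this.pow n).const_mul C
  set Q' := {x : EuclideanSpace ℝ (Fin n) | ∀ i, |x i - c i| ≤ r}
  have hQ'm : MeasurableSet Q' := measurableSet_cube c r
  have hlimL : Tendsto (fun k => ∫ x, w x * tensorTest (φ k) x) atTop (𝓝 (∫ x in Q', w x)) := by
    rw [← integral_indicator hQ'm]
    refine tendsto_integral_of_dominated_convergence
      ((openBox a b).indicator fun x => ‖w x‖) (fun k => ?_) ?_ (fun k => ae_of_all _ fun x => ?_)
      (ae_of_all _ fun x => ?_)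
    · exact (integrableOn_mul_tensorTest hw
        (contDiff_tensorTest fun i => (hφ k i).contDiff).continuous
        (tsupport_tensorTest_subset (hφ k)).1
        (tsupport_tensorTest_subset (hφ k)).2).aestronglyMeasurable
    · exact (integrable_indicator_iff (isOpen_openBox a b).measurableSet).mpr hw.norm
    · by_cases hx : x ∈ openBox a b
      · rw [Set.indicator_of_mem hx, norm_mul]
        refine mul_le_of_le_one_right (norm_nonneg _) ?_
        rw [tensorTest, Complex.norm_real, Real.norm_eq_abs, Finset.abs_prod]
        refine Finset.prod_le_one (fun i _ => abs_nonneg _) fun i _ => ?_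
        rw [abs_of_nonneg (β k i).nonneg]
        exact (β k i).le_one
      · rw [Set.indicator_of_notMem hx, image_eq_zero_of_notMem_tsupport (f := tensorTest (φ k)),
          mul_zero, norm_zero]
        exact fun h => hx ((tsupport_tensorTest_subset (hφ k)).2 h)
    · by_cases hx : x ∈ Q'
      · rw [Set.indicator_of_mem hx]
        refine tendsto_const_nhds.congr fun k => ?_
        have : tensorTest (φ k) x = 1 := by
          rw [tensorTest, Finset.prod_eq_one fun i _ => ?_, Complex.ofReal_one]
          refine (β k i).one_of_mem_closedBall ?_
          rw [Metric.mem_closedBall, Real.dist_eq]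
          exact hx i
        rw [this, mul_one]
      · rw [Set.indicator_of_notMem hx]
        simp only [Q', Set.mem_ofPred_eq, not_forall, not_le] at hx
        obtain ⟨i, hi⟩ := hx
        have hev : ∀ᶠ k in atTop, ε k < |x i - c i| - r :=
          hεlim.eventually (gt_mem_nhds (by linarith))
        refine tendsto_const_nhds.congr' ?_
        filter_upwards [hev] with k hk
        rw [tensorTest_eq_zero (i := i), mul_zero]
        refine (β k i).zero_of_le_dist ?_
        rw [Real.dist_eq]
        change r + ε k ≤ _
        linarith
  exact le_of_tendsto_of_tendsto hlimL.norm hlimR (Eventually.of_forall hbound)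

/-- Lebesgue differentiation along cubes. -/
theorem ae_norm_le_of_setIntegral_cube_le {a b : Fin n → ℝ} {w : EuclideanSpace ℝ (Fin n) → ℂ}
    (hw : IntegrableOn w (openBox a b)) {C : ℝ}
    (hC : ∀ (c : Fin n → ℝ) (r : ℝ), 0 < r → (∀ i, a i < c i - r ∧ c i + r < b i) →
      ‖∫ x in {x : EuclideanSpace ℝ (Fin n) | ∀ i, |x i - c i| ≤ r}, w x‖ ≤ C * (2 * r) ^ n) :
    ∀ᵐ x, x ∈ openBox a b → ‖w x‖ ≤ C := by
  -- The differentiation theorem is applied in `Fin n → ℝ`, whose closed balls for the sup metric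
  -- are exactly the cubes, and is carried back by this volume-preserving map.
  have hmp := PiLp.volume_preserving_toLp (Fin n)
  have hemb : MeasurableEmbedding (WithLp.toLp 2 : (Fin n → ℝ) → EuclideanSpace ℝ (Fin n)) :=
    (MeasurableEquiv.toLp 2 (Fin n → ℝ)).measurableEmbedding
  set v : EuclideanSpace ℝ (Fin n) → ℂ := (openBox a b).indicator w
  have hv : Integrable v :=
    (integrable_indicator_iff (isOpen_openBox a b).measurableSet).mpr hw
  set W : (Fin n → ℝ) → ℂ := fun y => v (WithLp.toLp 2 y)
  have hW : Integrable W := (hmp.integrable_comp_emb hemb).mpr hv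
  have hae := IsUnifLocDoublingMeasure.ae_tendsto_average volume hW.locallyIntegrable 0
  have hae' : ∀ᵐ y : Fin n → ℝ, WithLp.toLp 2 y ∈ openBox a b → ‖W y‖ ≤ C := by
    filter_upwards [hae] with y hy hyQ
    have hlim := hy (l := 𝓝[>] (0 : ℝ)) (fun _ => y) id tendsto_id
      (Eventually.of_forall fun j => by simp)
    refine le_of_tendsto hlim.norm ?_
    have hsmall : ∀ᶠ r in 𝓝[>] (0 : ℝ), ∀ i, a i < y i - r ∧ y i + r < b i := by
      refine eventually_all.mpr fun i => ?_
      have h1 : Tendsto (fun ε : ℝ => y i - ε) (𝓝[>] 0) (𝓝 (y i - 0)) :=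
        ((continuous_const.sub continuous_id).tendsto 0).mono_left nhdsWithin_le_nhds
      have h2 : Tendsto (fun ε : ℝ => y i + ε) (𝓝[>] 0) (𝓝 (y i + 0)) :=
        ((continuous_const.add continuous_id).tendsto 0).mono_left nhdsWithin_le_nhds
      rw [sub_zero] at h1
      rw [add_zero] at h2
      exact (h1.eventually (lt_mem_nhds (hyQ i).1)).and (h2.eventually (gt_mem_nhds (hyQ i).2))
    filter_upwards [hsmall, self_mem_nhdsWithin] with r hr hr0
    have hr0' : (0 : ℝ) < r := hr0
    have hvol : volume.real (Metric.closedBall y r) = (2 * r) ^ n := by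
      rw [measureReal_def, Real.volume_pi_closedBall y hr0'.le, ENNReal.toReal_ofReal (by positivity),
        Fintype.card_fin]
    set Q' := {x : EuclideanSpace ℝ (Fin n) | ∀ i, |x i - y i| ≤ r}
    have hpre : (WithLp.toLp 2 : (Fin n → ℝ) → EuclideanSpace ℝ (Fin n)) ⁻¹' Q' =
        Metric.closedBall y r := by
      ext z
      simp only [Q', Set.mem_preimage, Set.mem_ofPred_eq, Metric.mem_closedBall,
        dist_pi_le_iff hr0'.le, Real.dist_eq]
    have hQ'sub : Q' ⊆ openBox a b := by
      intro x hx i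
      have h1 := abs_le.mp (hx i)
      constructor <;> linarith [(hr i).1, (hr i).2, h1.1, h1.2]
    have hQ'm : MeasurableSet Q' := measurableSet_cube y r
    have hInt : ∫ z in Metric.closedBall y r, W z = ∫ x in Q', w x := by
      rw [← hpre, hmp.setIntegral_preimage_emb hemb v Q']
      refine setIntegral_congr_fun hQ'm fun x hx => ?_
      exact Set.indicator_of_mem (hQ'sub hx) w
    rw [id, setAverage_eq, hvol, norm_smul, norm_inv, hInt,
      Real.norm_of_nonneg (by positivity : (0 : ℝ) ≤ (2 * r) ^ n)]
    rw [inv_mul_le_iff₀ (by positivity), mul_comm]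
    exact hC y r hr0' hr
  have h3 := (hmp.symm (MeasurableEquiv.toLp 2 (Fin n → ℝ))).quasiMeasurePreserving.ae hae'
  filter_upwards [h3] with x hx hxQ
  have h4 : ‖v x‖ ≤ C := hx hxQ
  rwa [show v x = w x from Set.indicator_of_mem hxQ w] at h4

end Box

/-! ### Local boundedness of functions in the invariant Sobolev spaces -/

/-- An infimum over an empty family is ∞, so a finite Sobolev norm provides every weak derivative.
-/
theorem exists_isWeakPartial_of_sobolevSq_lt_top {n s : ℕ} {Ω : Set (EuclideanSpace ℝ (Fin n))}
    {w : EuclideanSpace ℝ (Fin n) → ℂ} (h : sobolevSq s Ω w < ⊤) (k : ℕ) (hk : k ≤ s)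
    (α : Fin k → Fin n) :
    ∃ g : EuclideanSpace ℝ (Fin n) → ℂ, MemLp g 2 (volume.restrict Ω) ∧ IsWeakPartial Ω α w g := by
  rw [sobolevSq, ENNReal.sum_lt_top] at h
  have h1 := ENNReal.sum_lt_top.mp (h k (Finset.mem_range.mpr (Nat.lt_succ_of_le hk))) α
    (Finset.mem_univ _)
  simp only [iInf_lt_iff] at h1
  obtain ⟨g, hg, -⟩ := h1
  exact ⟨g, hg⟩

/-- Applied to the boundary face of the half space, which the open boxes miss. -/
theorem volume_coord_eq_zero {n : ℕ} (i : Fin n) :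
    volume {z : EuclideanSpace ℝ (Fin n) | z i = 0} = 0 := by
  have h := Measure.addHaar_submodule (volume : Measure (EuclideanSpace ℝ (Fin n)))
    (LinearMap.ker (EuclideanSpace.proj i : EuclideanSpace ℝ (Fin n) →L[ℝ] ℝ).toLinearMap) (by
      intro htop
      have h1 : (EuclideanSpace.single i (1 : ℝ)) ∈
          LinearMap.ker (EuclideanSpace.proj i : EuclideanSpace ℝ (Fin n) →L[ℝ] ℝ).toLinearMap :=
        htop ▸ Submodule.mem_top
      simp at h1)
  exact h

/-- A Sobolev embedding valid up to the boundary. Only mixed derivatives are needed, at most one in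
each coordinate, so order n suffices. The bound on the open box does not deteriorate towards its
faces, so a box with one face on the boundary controls a full relative neighbourhood of a boundary
point. -/
theorem MemSobolev.exists_bound_nhds {n : ℕ} [NeZero n] {G M : Type*} [Group G]
    [TopologicalSpace M] [ChartedSpace (EuclideanHalfSpace n) M]
    [MeasurableSpace M] [BorelSpace M] [MulAction Gᵐᵒᵖ M] [ContinuousConstSMul Gᵐᵒᵖ M]
    {μ : Measure M} [SMulInvariantMeasure Gᵐᵒᵖ M μ] (hμ : IsSmoothMeasure (𝓡∂ n) μ)
    {u : Lp ℂ 2 μ} (hu : MemSobolev G (𝓡∂ n) n u) (x₀ : M) :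
    ∃ N ∈ 𝓝 x₀, ∃ C : ℝ, ∀ᵐ x ∂μ, x ∈ N → ‖u x‖ ≤ C := by
  obtain ⟨𝒰, h𝒰⟩ := hu
  obtain ⟨i, t, ht, y, hy, hyx⟩ := 𝒰.covers x₀
  set φ := extChartAt (𝓡∂ n) (𝒰.center i)
  have hysrc : y ∈ φ.source := 𝒰.closure_subset i (subset_closure hy)
  set p := φ y
  have hpt : p ∈ φ.target := φ.map_source hysrc
  set Ω := interior (φ '' 𝒰.U i)
  set w : EuclideanSpace ℝ (Fin n) → ℂ := fun z => u (op t • φ.symm z) with hwdef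
  have hweak := exists_isWeakPartial_of_sobolevSq_lt_top (s := n) (Ω := Ω) (w := w) (by
    rw [TranslateCover.sobolevSq, ENNReal.sum_lt_top] at h𝒰
    have h1 := h𝒰 i (Finset.mem_univ _)
    exact (ENNReal.le_tsum (⟨t, ht⟩ : 𝒰.T)).trans_lt h1)
  obtain ⟨ρ, hρc, hρ0, hρ⟩ := hμ.exists_density (𝒰.center i)
  -- a small box around `p`, intersected with the half space, lies in `Ω`
  have hS : φ '' 𝒰.U i ∩ {z | ρ p / 2 < ρ z} ∈ 𝓝[Set.range (𝓡∂ n)] p := by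
    refine inter_mem ?_ ?_
    · rw [← map_extChartAt_nhds' hysrc]
      exact image_mem_map ((𝒰.isOpen i).mem_nhds hy)
    · rw [← nhdsWithin_extChartAt_target_eq_of_mem hpt]
      exact (hρc p hpt).eventually (lt_mem_nhds (half_lt_self (hρ0 p hpt)))
  obtain ⟨V, hV, hVS⟩ := mem_nhdsWithin_iff_exists_mem_nhds_inter.mp hS
  obtain ⟨δ, hδ, hbox⟩ : ∃ δ > 0, ∀ z : EuclideanSpace ℝ (Fin n),
      (∀ j, |z j - p j| < δ) → z ∈ V ∩ Metric.ball p 1 := by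
    have hV' : (WithLp.toLp 2 : (Fin n → ℝ) → EuclideanSpace ℝ (Fin n)) ⁻¹'
        (V ∩ Metric.ball p 1) ∈ 𝓝 (WithLp.ofLp p) :=
      (PiLp.continuous_toLp 2 (fun _ : Fin n => ℝ)).continuousAt.preimage_mem_nhds
        (inter_mem hV (Metric.ball_mem_nhds p one_pos))
    obtain ⟨δ, hδ, hb⟩ := Metric.mem_nhds_iff.mp hV'
    refine ⟨δ, hδ, fun z hz => ?_⟩
    refine @hb (WithLp.ofLp z) ?_
    rw [Metric.mem_ball, dist_pi_lt_iff hδ]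
    exact fun j => by simpa [Real.dist_eq] using hz j
  have hrange : Set.range (𝓡∂ n) = {z : EuclideanSpace ℝ (Fin n) | 0 ≤ z 0} :=
    range_modelWithCornersEuclideanHalfSpace n
  have htr : φ.target ⊆ Set.range (𝓡∂ n) := extChartAt_target_subset_range _
  have hp0 : 0 ≤ p 0 := by
    have := htr hpt
    rwa [hrange] at this
  set a : Fin n → ℝ := fun j => if j = 0 then max 0 (p j - δ) else p j - δ with ha
  set b : Fin n → ℝ := fun j => p j + δ with hb
  have haδ : ∀ j, p j - δ ≤ a j := by
    intro j
    by_cases hj : j = 0 <;> simp [ha, hj]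
  have ha0 : 0 ≤ a 0 := by simp [ha]
  have hab : ∀ j, a j < b j := by
    intro j
    by_cases hj : j = 0
    · subst hj
      simp only [ha, hb, if_true]
      refine max_lt ?_ ?_ <;> linarith
    · simp only [ha, hb, hj, if_false]
      linarith
  have hQbox : ∀ z ∈ openBox a b, ∀ j, |z j - p j| < δ := by
    intro z hz j
    rw [abs_lt]
    have := haδ j
    have := (hz j).1
    have := (hz j).2
    constructor <;> linarith
  have hQpos : ∀ z ∈ openBox a b, 0 < z 0 := fun z hz => ha0.trans_lt (hz 0).1
  have hQS : openBox a b ⊆ φ '' 𝒰.U i ∩ {z | ρ p / 2 < ρ z} := fun z hz =>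
    hVS ⟨(hbox z (hQbox z hz)).1, by rw [hrange]; exact (hQpos z hz).le⟩
  have hQΩ : openBox a b ⊆ Ω :=
    interior_maximal (hQS.trans Set.inter_subset_left) (isOpen_openBox a b)
  have hQt : openBox a b ⊆ φ.target := by
    intro z hz
    obtain ⟨y', hy', rfl⟩ := (hQS hz).1
    exact φ.map_source (𝒰.closure_subset i (subset_closure hy'))
  have hQfin : volume (openBox a b) ≠ ⊤ := ((measure_mono fun z hz =>
    (hbox z (hQbox z hz)).2).trans_lt (measure_ball_lt_top (x := p) (r := 1))).ne
  have hQm : MeasurableSet (openBox a b) := (isOpen_openBox a b).measurableSet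
  -- `w` is integrable on the box
  have hut : StronglyMeasurable fun x : M => u (op t • x) :=
    (Lp.stronglyMeasurable u).comp_measurable (measurable_const_smul (op t))
  have hφs : AEMeasurable φ.symm (volume.restrict φ.target) :=
    (continuousOn_extChartAt_symm _).aemeasurable (measurableSet_extChartAt_target _)
  have hwm : AEMeasurable w (volume.restrict φ.target) := hut.measurable.comp_aemeasurable hφs
  have hwL : MemLp w 2 (volume.restrict (openBox a b)) := by
    refine ⟨(hwm.mono_measure (Measure.restrict_mono hQt le_rfl)).aestronglyMeasurable, ?_⟩
    rw [eLpNorm_lt_top_iff_lintegral_rpow_enorm_lt_top two_ne_zero ENNReal.ofNat_ne_top]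
    simp only [ENNReal.toReal_ofNat]
    have hfin : ∫⁻ x in φ.source, ‖u (op t • x)‖ₑ ^ (2 : ℝ) ∂μ < ⊤ := by
      refine (setLIntegral_le_lintegral _ _).trans_lt ?_
      rw [(measurePreserving_smul (op t) μ).lintegral_comp
        (f := fun x => ‖u x‖ₑ ^ (2 : ℝ)) ((Lp.stronglyMeasurable u).enorm.pow_const _)]
      have := (Lp.memLp u).2
      rwa [eLpNorm_lt_top_iff_lintegral_rpow_enorm_lt_top two_ne_zero ENNReal.ofNat_ne_top]
        at this
    have hcv := hρ (fun z => ‖w z‖ₑ ^ (2 : ℝ)) (hwm.enorm.pow_const _)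
    have hsrc : ∫⁻ x in φ.source, ‖w (φ x)‖ₑ ^ (2 : ℝ) ∂μ =
        ∫⁻ x in φ.source, ‖u (op t • x)‖ₑ ^ (2 : ℝ) ∂μ := by
      refine setLIntegral_congr_fun (isOpen_extChartAt_source _).measurableSet fun x hx => ?_
      simp only [hwdef, φ.left_inv hx]
    rw [hsrc] at hcv
    rw [hcv] at hfin
    have hρp : ENNReal.ofReal (ρ p / 2) ≠ 0 := by
      simpa using half_pos (hρ0 p hpt)
    have hle : ENNReal.ofReal (ρ p / 2) * ∫⁻ z in openBox a b, ‖w z‖ₑ ^ (2 : ℝ) < ⊤ := by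
      refine lt_of_le_of_lt ?_ hfin
      rw [← lintegral_const_mul' _ _ ENNReal.ofReal_ne_top]
      refine (setLIntegral_mono' hQm fun z hz => ?_).trans (lintegral_mono_set hQt)
      gcongr
      exact (hQS hz).2.le
    exact (ENNReal.lt_top_of_mul_ne_top_right hle.ne hρp)
  have : IsFiniteMeasure (volume.restrict (openBox a b)) := ⟨by simpa using hQfin.lt_top⟩
  have hwI : IntegrableOn w (openBox a b) := hwL.integrable one_le_two
  obtain ⟨C, hC⟩ := exists_bound_pairing_tensorTest hab hQΩ hwI hQfin hweak
  have hC' : ∀ φ : Fin n → ℝ → ℝ, (∀ i, IsIntervalTest (a i) (b i) (φ i)) →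
      (∀ i x, 0 ≤ φ i x) → ‖∫ x, w x * tensorTest φ x‖ ≤ max C 0 * ∏ i, ∫ t, φ i t :=
    fun φ h1 h2 => (hC φ h1 h2).trans (mul_le_mul_of_nonneg_right (le_max_left _ _)
      (Finset.prod_nonneg fun i _ => integral_nonneg (h2 i)))
  have hae := ae_norm_le_of_setIntegral_cube_le hwI fun c r hr hcr =>
    norm_setIntegral_cube_le hwI hC' (le_max_right _ _) hr hcr
  have hae0 : ∀ᵐ z : EuclideanSpace ℝ (Fin n), z 0 ≠ 0 := by
    rw [ae_iff]
    simpa using volume_coord_eq_zero (0 : Fin n)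
  have hchart := hμ.ae_of_ae_chart (𝒰.center i)
    (p := fun z => (∀ j, |z j - p j| < δ) → ‖w z‖ ≤ max C 0) (by
      filter_upwards [hae, hae0] with z hz hz0 hzt hzδ
      refine hz fun j => ?_
      have hz0' : 0 ≤ z 0 := by
        have := htr hzt
        rwa [hrange] at this
      have h1 := abs_lt.mp (hzδ j)
      by_cases hj : j = 0
      · subst hj
        have : 0 < z 0 := lt_of_le_of_ne hz0' (Ne.symm hz0)
        refine ⟨?_, ?_⟩
        · simp only [ha, if_true]
          exact max_lt this (by linarith)
        · simp only [hb]; linarith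
      · refine ⟨?_, ?_⟩
        · simp only [ha, hj, if_false]; linarith
        · simp only [hb]; linarith)
  -- The estimate near y is carried to x₀ = y t by the translation, which preserves null sets.
  have hyx' : op t⁻¹ • x₀ = y := by rw [← hyx]; simp
  have hcont : ContinuousAt (fun x : M => op t⁻¹ • x) x₀ := (continuous_const_smul _).continuousAt
  refine ⟨{x | op t⁻¹ • x ∈ φ.source ∧ ∀ j, |φ (op t⁻¹ • x) j - p j| < δ}, ?_, max C 0, ?_⟩
  · have h1 : φ.source ∈ 𝓝 y := extChartAt_source_mem_nhds' hysrc
    have h2 : ∀ᶠ x in 𝓝 y, ∀ j, |φ x j - p j| < δ := by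
      refine eventually_all.mpr fun j => ?_
      have h3 : ContinuousAt (fun x => |φ x j - p j|) y :=
        (((contDiff_coord j).continuous.continuousAt.comp
          (continuousAt_extChartAt' hysrc)).sub continuousAt_const).abs
      refine h3.eventually (gt_mem_nhds ?_)
      simpa [p] using hδ
    have h4 : ∀ᶠ x in 𝓝 (op t⁻¹ • x₀), x ∈ φ.source ∧ ∀ j, |φ x j - p j| < δ := by
      rw [hyx']
      exact Filter.Eventually.and h1 h2
    exact hcont.eventually h4
  · filter_upwards [(measurePreserving_smul (op t⁻¹) μ).quasiMeasurePreserving.ae hchart]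
      with x hx hxN
    have h1 := hx hxN.1 hxN.2
    simp only [hwdef] at h1
    rw [φ.left_inv hxN.1] at h1
    simpa using h1

/-! ### Approximate identities -/

/-- An approximate identity of test functions at the identity of the group `G`. -/
structure IsApproxId {EG HG G : Type*} [NormedAddCommGroup EG] [NormedSpace ℝ EG]
    [TopologicalSpace HG] (IG : ModelWithCorners ℝ EG HG) [Group G] [TopologicalSpace G]
    [ChartedSpace HG G] [MeasurableSpace G] (haar : Measure G) (φ : ℕ → G → ℝ) : Prop where
  contMDiff : ∀ n, ContMDiff IG 𝓘(ℝ, ℝ) ∞ (φ n)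
  compact : ∀ n, HasCompactSupport (φ n)
  nonneg : ∀ n s, 0 ≤ φ n s
  integral_eq_one : ∀ n, ∫ s, φ n s ∂haar = 1
  support : ∀ U ∈ 𝓝 (1 : G), ∀ᶠ n in atTop, Function.support (φ n) ⊆ U

section ApproxId

variable {EG HG G : Type*} [NormedAddCommGroup EG] [NormedSpace ℝ EG]
  [TopologicalSpace HG] {IG : ModelWithCorners ℝ EG HG} [Group G] [TopologicalSpace G]
  [ChartedSpace HG G] [MeasurableSpace G] {haar : Measure G} {φ : ℕ → G → ℝ}

theorem exists_isApproxId [FiniteDimensional ℝ EG] [T2Space G] [FirstCountableTopology G]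
    [IsManifold IG ∞ G] [BorelSpace G] [haar.IsOpenPosMeasure] [IsFiniteMeasureOnCompacts haar] :
    ∃ φ : ℕ → G → ℝ, IsApproxId IG haar φ := by
  obtain ⟨U, hU⟩ := (𝓝 (1 : G)).exists_antitone_basis
  have h : ∀ n, ∃ f : SmoothBumpFunction IG (1 : G), tsupport f ⊆ U n := by
    intro n
    obtain ⟨f, -, hf⟩ := (SmoothBumpFunction.nhds_basis_tsupport (I := IG) (1 : G)).mem_iff.mp
      (hU.1.mem_of_mem (i := n) trivial)
    exact ⟨f, hf⟩
  choose f hf using h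
  have hpos : ∀ n, 0 < ∫ s, f n s ∂haar := fun n =>
    (f n).continuous.integral_pos_of_hasCompactSupport_nonneg_nonzero (f n).hasCompactSupport
      (fun s => (f n).nonneg) (x := 1) (by rw [(f n).eq_one]; exact one_ne_zero)
  refine ⟨fun n s => (∫ s, f n s ∂haar)⁻¹ * f n s, fun n => contMDiff_const.mul (f n).contMDiff,
    fun n => (f n).hasCompactSupport.mul_left,
    fun n s => mul_nonneg (inv_nonneg.mpr (hpos n).le) (f n).nonneg, fun n => ?_, fun V hV => ?_⟩
  · rw [integral_const_mul, inv_mul_cancel₀ (hpos n).ne']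
  · obtain ⟨N, -, hN⟩ := hU.1.mem_iff.mp hV
    filter_upwards [eventually_ge_atTop N] with n hn s hs
    exact hN (hU.2 hn (hf n (subset_tsupport _ (right_ne_zero_of_mul hs))))

theorem IsApproxId.isTestFunction (hφ : IsApproxId IG haar φ) (n : ℕ) : IsTestFunction IG fun s => (φ n s : ℂ) :=
  ⟨Complex.ofRealCLM.contDiff.contMDiff.comp (hφ.contMDiff n),
    (hφ.compact n).comp_left (g := fun x : ℝ => (x : ℂ)) Complex.ofReal_zero⟩

theorem IsApproxId.tendsto_integral_smul (hφ : IsApproxId IG haar φ) [BorelSpace G] [SecondCountableTopology G]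
    [IsFiniteMeasureOnCompacts haar]
    {B : Type*} [NormedAddCommGroup B] [NormedSpace ℂ B] [CompleteSpace B] {c : G → B}
    (hc : Continuous c) :
    Tendsto (fun n => ∫ s, (φ n s : ℂ) • c s ∂haar) atTop (𝓝 (c 1)) := by
  rw [Metric.tendsto_atTop']
  intro ε hε
  have hU : {s | dist (c s) (c 1) < ε / 2} ∈ 𝓝 (1 : G) :=
    hc.continuousAt.eventually (Metric.ball_mem_nhds _ (half_pos hε))
  obtain ⟨N, hN⟩ := eventually_atTop.mp (hφ.support _ hU)
  refine ⟨N, fun n hn => ?_⟩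
  have hcont : Continuous (φ n) := (hφ.contMDiff n).continuous
  have hi : Integrable (φ n) haar := hcont.integrable_of_hasCompactSupport (hφ.compact n)
  have hi1 : Integrable (fun s => (φ n s : ℂ) • c s) haar :=
    ((Complex.continuous_ofReal.comp hcont).smul hc).integrable_of_hasCompactSupport
      ((hφ.isTestFunction n).2.smul_right)
  have h1 : c 1 = ∫ s, (φ n s : ℂ) • c 1 ∂haar := by
    rw [integral_smul_const, integral_complex_ofReal, hφ.integral_eq_one]
    simp
  rw [dist_eq_norm]
  conv_lhs => rw [h1]
  have hi2 : Integrable (fun s => (φ n s : ℂ) • c 1) haar := hi.ofReal.smul_const _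
  rw [← integral_sub hi1 hi2]
  refine lt_of_le_of_lt (norm_integral_le_of_norm_le (hi.mul_const (ε / 2))
    (ae_of_all _ fun s => ?_)) ?_
  · rw [← smul_sub, norm_smul, Complex.norm_real, Real.norm_of_nonneg (hφ.nonneg n s)]
    by_cases hs : φ n s = 0
    · simp [hs]
    · refine mul_le_mul_of_nonneg_left ?_ (hφ.nonneg n s)
      have : dist (c s) (c 1) < ε / 2 := hN n hn.le hs
      rw [dist_eq_norm] at this
      exact this.le
  · rw [integral_mul_const, hφ.integral_eq_one, one_mul]
    exact half_lt_self hε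

end ApproxId

/-! ### Convolution on the right -/

/-- The Bochner integral of a family of `L²` functions is computed pointwise. -/
theorem integral_smul_Lp_ae_eq {S M : Type*} [MeasurableSpace S] [MeasurableSpace M]
    {ρ : Measure S} [SFinite ρ] {μ : Measure M} [SigmaFinite μ] {φ : S → ℂ} {c : S → Lp ℂ 2 μ}
    (hφ : AEStronglyMeasurable φ ρ) (hφc : Integrable (fun s => φ s • c s) ρ) {C : S × M → ℂ}
    (hC : AEStronglyMeasurable C (ρ.prod μ)) (hcC : ∀ s, c s =ᵐ[μ] fun x => C (s, x)) :
    (∫ s, φ s • c s ∂ρ : Lp ℂ 2 μ) =ᵐ[μ] fun x => ∫ s, φ s * C (s, x) ∂ρ := by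
  -- On a set of finite measure the L¹ norm of c(s) is at most μ(A)^(1/2) ‖c(s)‖, so integrability
  -- in s of the L² norms gives joint integrability.
  have hInt : ∀ A, MeasurableSet A → μ A < ⊤ →
      Integrable (fun z : S × M => φ z.1 * C z) (ρ.prod (μ.restrict A)) := by
    intro A hA hμA
    have : IsFiniteMeasure (μ.restrict A) := ⟨by simpa using hμA⟩
    have hm : AEStronglyMeasurable (fun z : S × M => φ z.1 * C z) (ρ.prod (μ.restrict A)) :=
      hφ.comp_fst.mul (hC.mono_ac (Measure.AbsolutelyContinuous.rfl.prod
        Measure.absolutelyContinuous_restrict))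
    have hL : ∀ s, MemLp (fun x => C (s, x)) 2 (μ.restrict A) := fun s =>
      ((memLp_congr_ae (hcC s)).mp (Lp.memLp (c s))).restrict A
    rw [integrable_prod_iff hm]
    refine ⟨ae_of_all _ fun s => ((hL s).integrable one_le_two).const_mul (φ s), ?_⟩
    refine Integrable.mono' (hφc.norm.mul_const ((μ A).toReal ^ (1 / 2 : ℝ)))
      hm.norm.integral_prod_right' (ae_of_all _ fun s => ?_)
    rw [Real.norm_of_nonneg (integral_nonneg fun x => norm_nonneg _)]
    simp only [norm_mul, norm_smul]
    rw [integral_const_mul, mul_assoc]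
    refine mul_le_mul_of_nonneg_left ?_ (norm_nonneg _)
    have h1 : eLpNorm (fun x => C (s, x)) 1 (μ.restrict A) ≤
        eLpNorm (fun x => C (s, x)) 2 (μ.restrict A) * (μ A) ^ (1 / 2 : ℝ) := by
      have := eLpNorm_le_eLpNorm_mul_rpow_measure_univ (p := 1) (q := 2) (μ := μ.restrict A)
        one_le_two (hL s).1
      norm_num at this ⊢
      exact this
    have h2 : eLpNorm (fun x => C (s, x)) 2 (μ.restrict A) ≤ eLpNorm (c s) 2 μ := by
      rw [← eLpNorm_congr_ae (ae_restrict_of_ae (hcC s))]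
      exact eLpNorm_mono_measure _ Measure.restrict_le_self
    have h3 : ∫ x in A, ‖C (s, x)‖ ∂μ = (eLpNorm (fun x => C (s, x)) 1 (μ.restrict A)).toReal := by
      rw [eLpNorm_one_eq_lintegral_enorm, integral_norm_eq_lintegral_enorm (hL s).1]
    rw [h3, Lp.norm_def]
    have h4 := h1.trans (mul_le_mul_left h2 _)
    refine (ENNReal.toReal_mono ?_ h4).trans_eq ?_
    · exact (ENNReal.mul_lt_top (Lp.memLp (c s)).2
        (ENNReal.rpow_lt_top_of_nonneg (by norm_num) hμA.ne)).ne
    · rw [ENNReal.toReal_mul, ENNReal.toReal_rpow]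
  refine ae_eq_of_forall_setIntegral_eq_of_sigmaFinite (fun A hA hμA => ?_) (fun A hA hμA => ?_)
    fun A hA hμA => ?_
  · have : IsFiniteMeasure (μ.restrict A) := ⟨by simpa using hμA⟩
    exact ((Lp.memLp _).restrict A).integrable one_le_two
  · exact (hInt A hA hμA).integral_prod_right
  -- Integration over A is the pairing with an indicator, a bounded functional that passes through
  -- the Bochner integral; Fubini does the rest.
  · rw [← L2.inner_indicatorConstLp_one (𝕜 := ℂ) hA hμA.ne, ← innerSL_apply_apply ℂ,
      ← ContinuousLinearMap.integral_comp_comm _ hφc,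
      integral_integral_swap (f := fun x s => φ s * C (s, x)) (hInt A hA hμA).swap]
    refine integral_congr_ae (ae_of_all _ fun s => ?_)
    simp only [map_smul, innerSL_apply_apply, L2.inner_indicatorConstLp_one, smul_eq_mul]
    rw [integral_const_mul]
    congr 1
    exact integral_congr_ae (ae_restrict_of_ae (hcC s))

section TestFunction

variable {E H N : Type*} [NormedAddCommGroup E] [NormedSpace ℝ E] [TopologicalSpace H]
  {I : ModelWithCorners ℝ E H} [TopologicalSpace N] [ChartedSpace H N] [MeasurableSpace N]
  [BorelSpace N] {ρ : Measure N} [IsFiniteMeasureOnCompacts ρ] {φ : N → ℂ}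

theorem IsTestFunction.integrable (hφ : IsTestFunction I φ) : Integrable φ ρ :=
  hφ.1.continuous.integrable_of_hasCompactSupport hφ.2

theorem IsTestFunction.memLp (hφ : IsTestFunction I φ) : MemLp φ 2 ρ :=
  hφ.1.continuous.memLp_of_hasCompactSupport hφ.2

end TestFunction

section Convolution

variable {G M : Type*} [Group G] [TopologicalSpace G] [IsTopologicalGroup G]
  [SecondCountableTopology G] [MeasurableSpace G] [BorelSpace G]
  [TopologicalSpace M] [R1Space M] [SecondCountableTopology M] [MeasurableSpace M] [BorelSpace M]
  [MulAction Gᵐᵒᵖ M] [ContinuousSMul Gᵐᵒᵖ M]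

theorem measurable_op_smul : Measurable fun p : M × G => op p.2 • p.1 :=
  ((continuous_op.comp continuous_snd).smul continuous_fst).measurable

variable {μ : Measure M} [SMulInvariantMeasure Gᵐᵒᵖ M μ]

theorem rightTranslation_ae_eq (s : G) (F : Lp ℂ 2 μ) :
    rightTranslation μ s F =ᵐ[μ] fun x => F (op s • x) :=
  Lp.coeFn_compMeasurePreserving F (measurePreserving_smul (op s) μ)

theorem rightTranslation_one (F : Lp ℂ 2 μ) : rightTranslation μ (1 : G) F = F := by
  refine Lp.ext ((rightTranslation_ae_eq _ _).trans (ae_of_all _ fun x => ?_))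
  simp

theorem rightTranslation_mul (s t : G) (F : Lp ℂ 2 μ) :
    rightTranslation μ s (rightTranslation μ t F) = rightTranslation μ (s * t) F := by
  refine Lp.ext ?_
  filter_upwards [rightTranslation_ae_eq s (rightTranslation μ t F),
    rightTranslation_ae_eq (s * t) F,
    (measurePreserving_smul (op s) μ).quasiMeasurePreserving.ae (rightTranslation_ae_eq t F)]
    with x h1 h2 h3
  rw [h1, h2, h3, op_mul, mul_smul]

theorem inner_rightTranslation_left (s : G) (F F' : Lp ℂ 2 μ) :
    ⟪rightTranslation μ s F, F'⟫_ℂ = ⟪F, rightTranslation μ s⁻¹ F'⟫_ℂ := by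
  rw [← (rightTranslation μ s).inner_map_map F, rightTranslation_mul, mul_inv_cancel,
    rightTranslation_one]

variable [IsLocallyFiniteMeasure μ] [μ.InnerRegularCompactLTTop]

/-- Joint continuity of the action makes s ↦ (x ↦ x s) continuous for the compact-open topology, and
composition with measure-preserving maps is continuous in that topology on L² of a regular measure.
-/
theorem continuous_rightTranslation (F : Lp ℂ 2 μ) :
    Continuous fun s : G => rightTranslation μ s F := by
  let g : C(G, C(M, M)) := (ContinuousMap.mk (fun p : G × M => op p.1 • p.2)
    ((continuous_op.comp continuous_fst).smul continuous_snd)).curry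
  exact (continuous_const (y := F)).compMeasurePreservingLp g.continuous
    (fun s => measurePreserving_smul (op s) μ) ENNReal.ofNat_ne_top

/-- The right convolution `F * φ = ∫ φ(s) R_{s⁻¹} F ds` of `F ∈ L²(M)` with `φ : G → ℂ`. -/
def rightConv (haar : Measure G) (φ : G → ℂ) (F : Lp ℂ 2 μ) : Lp ℂ 2 μ :=
  ∫ s, φ s • rightTranslation μ s⁻¹ F ∂haar

variable {haar : Measure G} {φ : G → ℂ}

theorem integrable_smul_rightTranslation (hφ : Integrable φ haar) (F : Lp ℂ 2 μ) :
    Integrable (fun s => φ s • rightTranslation μ s⁻¹ F) haar := by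
  refine Integrable.mono' (hφ.norm.mul_const ‖F‖) (hφ.aestronglyMeasurable.smul
    ((continuous_rightTranslation F).comp continuous_inv).aestronglyMeasurable)
    (ae_of_all _ fun s => ?_)
  rw [norm_smul, (rightTranslation μ s⁻¹).norm_map]

/-- Right convolution with an integrable function is a bounded operator. -/
theorem exists_clm_eq_rightConv (hφ : Integrable φ haar) :
    ∃ L : Lp ℂ 2 μ →L[ℂ] Lp ℂ 2 μ, ∀ F, L F = rightConv haar φ F := by
  refine ⟨LinearMap.mkContinuous
    { toFun := rightConv haar φ
      map_add' := fun F F' => ?_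
      map_smul' := fun c F => ?_ } (∫ s, ‖φ s‖ ∂haar) fun F => ?_, fun F => rfl⟩
  · simp only [rightConv, map_add, smul_add]
    exact integral_add (integrable_smul_rightTranslation hφ F)
      (integrable_smul_rightTranslation hφ F')
  · simp only [rightConv, map_smul, smul_comm _ c, RingHom.id_apply]
    exact integral_smul c _
  · change ‖rightConv haar φ F‖ ≤ _
    rw [← integral_mul_const]
    refine norm_integral_le_of_norm_le (hφ.norm.mul_const _) (ae_of_all _ fun s => ?_)
    rw [norm_smul, (rightTranslation μ s⁻¹).norm_map]

theorem rightConv_ae_eq [SFinite haar] [SigmaFinite μ] (hφ : Integrable φ haar) {F : Lp ℂ 2 μ}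
    {f : M → ℂ} (hf : StronglyMeasurable f) (hFf : F =ᵐ[μ] f) :
    rightConv haar φ F =ᵐ[μ] fun x => ∫ s, φ s * f (op s⁻¹ • x) ∂haar := by
  refine integral_smul_Lp_ae_eq (C := fun z : G × M => f (op z.1⁻¹ • z.2))
    hφ.aestronglyMeasurable (integrable_smul_rightTranslation hφ F) ?_ fun s => ?_
  · refine (hf.comp_measurable (measurable_op_smul.comp
      (measurable_snd.prodMk measurable_fst.inv))).aestronglyMeasurable
  · exact (rightTranslation_ae_eq _ _).trans
      ((measurePreserving_smul (op s⁻¹) μ).quasiMeasurePreserving.ae hFf)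

theorem IsApproxId.tendsto_rightConv {EG HG : Type*} [NormedAddCommGroup EG] [NormedSpace ℝ EG]
    [TopologicalSpace HG] {IG : ModelWithCorners ℝ EG HG} [ChartedSpace HG G]
    [IsFiniteMeasureOnCompacts haar] {φ : ℕ → G → ℝ} (hφ : IsApproxId IG haar φ) (F : Lp ℂ 2 μ) :
    Tendsto (fun n => rightConv haar (fun s => (φ n s : ℂ)) F) atTop (𝓝 F) := by
  have h := hφ.tendsto_integral_smul ((continuous_rightTranslation F).comp continuous_inv)
  simp only [Function.comp_apply, inv_one, rightTranslation_one] at h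
  exact h

end Convolution

/-! ### Equivariant operators on `L²(G)` -/

section Equivariant

variable {EG HG G M : Type*} [NormedAddCommGroup EG] [NormedSpace ℝ EG]
  [TopologicalSpace HG] {IG : ModelWithCorners ℝ EG HG} [Group G] [TopologicalSpace G]
  [ChartedSpace HG G] [IsTopologicalGroup G] [T2Space G] [LocallyCompactSpace G]
  [SecondCountableTopology G] [MeasurableSpace G] [BorelSpace G]
  {haar : Measure G} [haar.IsHaarMeasure] [haar.IsMulRightInvariant]
  [haar.InnerRegularCompactLTTop]
  [TopologicalSpace M] [R1Space M] [SecondCountableTopology M] [MeasurableSpace M] [BorelSpace M]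
  [MulAction Gᵐᵒᵖ M] [ContinuousSMul Gᵐᵒᵖ M]
  {μ : Measure M} [SMulInvariantMeasure Gᵐᵒᵖ M μ] [IsLocallyFiniteMeasure μ]
  [μ.InnerRegularCompactLTTop]

/-- `T` commutes with the right translations by `G`. -/
def IsEquivariant (T : Lp ℂ 2 haar →L[ℂ] Lp ℂ 2 μ) : Prop :=
  ∀ (s : G) (u : Lp ℂ 2 haar), T (rightTranslation haar s u) = rightTranslation μ s (T u)

/-- `T u = F * u` for all test functions `u`. -/
def IsConvolution (IG : ModelWithCorners ℝ EG HG) (T : Lp ℂ 2 haar →L[ℂ] Lp ℂ 2 μ)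
    (F : Lp ℂ 2 μ) : Prop :=
  ∀ φ : G → ℂ, IsTestFunction IG φ → ∀ u : Lp ℂ 2 haar, u =ᵐ[haar] φ → T u = rightConv haar φ F

/-- The bounded operator T passes through the Bochner integral. Hence T(φₙ * v) = (T φₙ) * v, so the
values on an approximate identity determine T on test functions. -/
theorem IsEquivariant.map_rightConv {T : Lp ℂ 2 haar →L[ℂ] Lp ℂ 2 μ} (hT : IsEquivariant T)
    {φ : G → ℂ} (hφ : Integrable φ haar) (u : Lp ℂ 2 haar) :
    T (rightConv haar φ u) = rightConv haar φ (T u) := by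
  rw [rightConv, ← T.integral_comp_comm (integrable_smul_rightTranslation hφ u)]
  simp only [map_smul, hT _ _]
  rfl

/-- The substitution s ↦ t s⁻¹ preserves the measure because the group is unimodular. -/
theorem integral_mul_swap_convolution (f φ : G → ℂ) (t : G) :
    ∫ s, φ s * f (t * s⁻¹) ∂haar = ∫ s, f s * φ (s⁻¹ * t) ∂haar := by
  have := isInvInvariant_of_isMulRightInvariant haar
  rw [← integral_div_left_eq_self (fun s => f s * φ (s⁻¹ * t)) haar t]
  refine integral_congr_ae (ae_of_all _ fun s => ?_)
  simp [div_eq_mul_inv, mul_comm]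

/-- The function f * φ is a superposition of left translates of φ and also of right translates of f.
So the operators L_f in the definition of the trace are the case M = G of convolution operators. -/
theorem isLeftConvolution_iff {f : Lp ℂ 2 haar} {A : Lp ℂ 2 haar →L[ℂ] Lp ℂ 2 haar} :
    IsLeftConvolution IG f A ↔ IsConvolution IG A f := by
  refine forall₂_congr fun φ hφ => forall₂_congr fun u hu => ?_
  have h := rightConv_ae_eq (haar := haar) hφ.integrable (Lp.stronglyMeasurable f)
    (EventuallyEq.refl _ _)
  have h' : rightConv haar φ f =ᵐ[haar] fun t => ∫ s, f s * φ (s⁻¹ * t) ∂haar := by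
    refine h.trans (ae_of_all _ fun t => ?_)
    exact integral_mul_swap_convolution (haar := haar) f φ t
  exact ⟨fun H => Lp.ext (H.trans h'.symm), fun H => H ▸ h'⟩

theorem IsConvolution.tendsto {T : Lp ℂ 2 haar →L[ℂ] Lp ℂ 2 μ} {F : Lp ℂ 2 μ}
    (hT : IsConvolution IG T F) {φ : ℕ → G → ℝ} (hφ : IsApproxId IG haar φ) :
    Tendsto (fun n => T ((hφ.isTestFunction n).memLp.toLp _)) atTop (𝓝 F) := by
  refine (hφ.tendsto_rightConv F).congr fun n => ?_
  exact (hT _ (hφ.isTestFunction n) _ (MemLp.coeFn_toLp _)).symm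

/-- The left convolution of a test function with an approximate identity converges. -/
theorem IsApproxId.tendsto_rightConv_toLp {φ : ℕ → G → ℝ} (hφ : IsApproxId IG haar φ) {v : G → ℂ}
    (hv : IsTestFunction IG v) {u : Lp ℂ 2 haar} (hu : u =ᵐ[haar] v) :
    Tendsto (fun n => rightConv haar v ((hφ.isTestFunction n).memLp.toLp _)) atTop (𝓝 u) := by
  -- Written as ∫ φₙ(s) c(s) ds with c(s) the left translate of v by s, the convolution tends to
  -- c(1) = u by continuity of left translation.
  let c : G → Lp ℂ 2 haar := fun s =>
    Lp.compMeasurePreserving (fun t => s⁻¹ * t) (measurePreserving_mul_left haar s⁻¹) u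
  have hc : Continuous c := by
    let g : C(G, C(G, G)) := (ContinuousMap.mk (fun p : G × G => p.1⁻¹ * p.2)
      (continuous_fst.inv.mul continuous_snd)).curry
    exact (continuous_const (y := u)).compMeasurePreservingLp g.continuous
      (fun s => measurePreserving_mul_left haar s⁻¹) ENNReal.ofNat_ne_top
  have hc1 : c 1 = u := by
    refine Lp.ext ((Lp.coeFn_compMeasurePreserving _ _).trans (ae_of_all _ fun t => ?_))
    simp
  have hlim := hφ.tendsto_integral_smul hc
  rw [hc1] at hlim
  refine hlim.congr fun n => Lp.ext ?_
  have h1 := integral_smul_Lp_ae_eq (ρ := haar) (μ := haar) (φ := fun s => (φ n s : ℂ)) (c := c)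
    (C := fun z : G × G => v (z.1⁻¹ * z.2))
    (hφ.isTestFunction n).1.continuous.aestronglyMeasurable
    (((hφ.isTestFunction n).1.continuous.smul hc).integrable_of_hasCompactSupport
      ((hφ.isTestFunction n).2.smul_right))
    (hv.1.continuous.comp (continuous_fst.inv.mul continuous_snd)).aestronglyMeasurable
    (fun s => (Lp.coeFn_compMeasurePreserving _ _).trans
      ((measurePreserving_mul_left haar s⁻¹).quasiMeasurePreserving.ae hu))
  have h2 := rightConv_ae_eq (haar := haar) hv.integrable
    (hφ.isTestFunction n).1.continuous.stronglyMeasurable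
    (MemLp.coeFn_toLp ((hφ.isTestFunction n).memLp (ρ := haar)))
  refine h1.trans (EventuallyEq.trans (ae_of_all _ fun t => ?_) h2.symm)
  exact (integral_mul_swap_convolution (haar := haar) (fun s => (φ n s : ℂ)) v t).symm

/-- An equivariant operator is a convolution operator as soon as its values on an approximate
identity converge weakly along some filter. -/
theorem IsEquivariant.isConvolution_of_tendsto_inner {T : Lp ℂ 2 haar →L[ℂ] Lp ℂ 2 μ}
    (hT : IsEquivariant T) {φ : ℕ → G → ℝ} (hφ : IsApproxId IG haar φ) {l : Filter ℕ} [l.NeBot]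
    (hl : l ≤ atTop) {F : Lp ℂ 2 μ}
    (hF : ∀ g : Lp ℂ 2 μ, Tendsto (fun n => ⟪g, T ((hφ.isTestFunction n).memLp.toLp _)⟫_ℂ) l
      (𝓝 ⟪g, F⟫_ℂ)) : IsConvolution IG T F := by
  intro v hv u hu
  refine ext_inner_left ℂ fun g => ?_
  obtain ⟨L, hL⟩ := exists_clm_eq_rightConv (μ := μ) (hv.integrable (ρ := haar))
  have h1 : Tendsto (fun n => ⟪g, T (rightConv haar v ((hφ.isTestFunction n).memLp.toLp _))⟫_ℂ) l
      (𝓝 ⟪g, T u⟫_ℂ) :=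
    tendsto_const_nhds.inner
      ((T.continuous.tendsto u).comp ((hφ.tendsto_rightConv_toLp hv hu).mono_left hl))
  refine tendsto_nhds_unique h1 ?_
  -- Right convolution with v is bounded, so its adjoint moves to the other side of the inner
  -- product and weak convergence is enough.
  simp only [hT.map_rightConv hv.integrable, ← hL]
  simpa only [ContinuousLinearMap.adjoint_inner_left] using hF (L.adjoint g)

theorem IsEquivariant.isConvolution_of_tendsto {T : Lp ℂ 2 haar →L[ℂ] Lp ℂ 2 μ}
    (hT : IsEquivariant T) {φ : ℕ → G → ℝ} (hφ : IsApproxId IG haar φ) {F : Lp ℂ 2 μ}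
    (hF : Tendsto (fun n => T ((hφ.isTestFunction n).memLp.toLp _)) atTop (𝓝 F)) :
    IsConvolution IG T F :=
  hT.isConvolution_of_tendsto_inner hφ le_rfl fun _ => tendsto_const_nhds.inner hF

/-- A bounded sequence in a Hilbert space has a weak limit along an ultrafilter. -/
theorem exists_weak_limit {E : Type*} [NormedAddCommGroup E] [InnerProductSpace ℂ E]
    [CompleteSpace E] {x : ℕ → E} {b : ℝ} (hx : ∀ n, ‖x n‖ ≤ b) (U : Ultrafilter ℕ) :
    ∃ F : E, ∀ g : E, Tendsto (fun n => ⟪g, x n⟫_ℂ) U (𝓝 ⟪g, F⟫_ℂ) := by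
  let f : ℕ → WeakDual ℂ E := fun n =>
    StrongDual.toWeakDual (InnerProductSpace.toDual ℂ E (x n))
  -- Banach–Alaoglu: the ultrafilter converges in the weak-* compact ball. The dual pairing is ⟪x n,
  -- g⟫, so conjugation restores the required order at the end.
  have hK := WeakDual.isCompact_closedBall (𝕜 := ℂ) (0 : StrongDual ℂ E) b
  obtain ⟨ℓ, -, hℓ⟩ := hK.ultrafilter_le_nhds (U.map f) (by
    rw [le_principal_iff]
    refine mem_map.mpr (Filter.univ_mem' fun n => ?_)
    simpa [f] using hx n)
  refine ⟨(InnerProductSpace.toDual ℂ E).symm (WeakDual.toStrongDual ℓ), fun g => ?_⟩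
  have h1 : Tendsto (fun n => f n g) U (𝓝 (ℓ g)) :=
    ((WeakDual.eval_continuous g).tendsto ℓ).comp hℓ
  have h2 : Tendsto (fun n => ⟪x n, g⟫_ℂ) U
      (𝓝 ⟪(InnerProductSpace.toDual ℂ E).symm (WeakDual.toStrongDual ℓ), g⟫_ℂ) := by
    rw [InnerProductSpace.toDual_symm_apply]
    exact h1
  have h3 := (Complex.continuous_conj.tendsto _).comp h2
  simpa only [Function.comp_def, inner_conj_symm] using h3

/-- A weak limit along one ultrafilter already gives the convolving vector; this serves when only
boundedness, not convergence, is known beforehand. -/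
theorem IsEquivariant.exists_isConvolution_of_bounded {T : Lp ℂ 2 haar →L[ℂ] Lp ℂ 2 μ}
    (hT : IsEquivariant T) {φ : ℕ → G → ℝ} (hφ : IsApproxId IG haar φ) {b : ℝ}
    (hb : ∀ n, ‖T ((hφ.isTestFunction n).memLp.toLp _)‖ ≤ b) :
    ∃ F, IsConvolution IG T F := by
  obtain ⟨F, hF⟩ := exists_weak_limit hb (hyperfilter ℕ)
  exact ⟨F, hT.isConvolution_of_tendsto_inner hφ (Nat.hyperfilter_le_atTop) hF⟩

theorem norm_apply_eq_of_adjoint_comp_eq {E F F' : Type*} [NormedAddCommGroup E]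
    [InnerProductSpace ℂ E] [CompleteSpace E] [NormedAddCommGroup F] [InnerProductSpace ℂ F]
    [CompleteSpace F] [NormedAddCommGroup F'] [InnerProductSpace ℂ F'] [CompleteSpace F']
    {A : E →L[ℂ] F} {B : E →L[ℂ] F'} (h : A.adjoint ∘L A = B.adjoint ∘L B) (x : E) :
    ‖A x‖ = ‖B x‖ := by
  have h1 : ⟪A x, A x⟫_ℂ = ⟪B x, B x⟫_ℂ := by
    rw [← ContinuousLinearMap.adjoint_inner_left, ← ContinuousLinearMap.adjoint_inner_left]
    exact congrArg (fun T : E →L[ℂ] E => ⟪T x, x⟫_ℂ) h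
  rw [inner_self_eq_norm_sq_to_K, inner_self_eq_norm_sq_to_K] at h1
  have h2 : ‖A x‖ ^ 2 = ‖B x‖ ^ 2 := by exact_mod_cast h1
  exact (sq_eq_sq₀ (norm_nonneg _) (norm_nonneg _)).mp h2

/-- The hypothesis says ‖Tx‖ = ‖Ax‖ for all x. Along an approximate identity the values of A
converge, so those of T are Cauchy, and the two limits have the same norm. -/
theorem IsEquivariant.exists_of_adjoint_comp_eq {N : Type*} [TopologicalSpace N] [R1Space N]
    [SecondCountableTopology N] [MeasurableSpace N] [BorelSpace N] [MulAction Gᵐᵒᵖ N]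
    [ContinuousSMul Gᵐᵒᵖ N] {μ' : Measure N} [SMulInvariantMeasure Gᵐᵒᵖ N μ']
    [IsLocallyFiniteMeasure μ'] [μ'.InnerRegularCompactLTTop]
    [FiniteDimensional ℝ EG] [IsManifold IG ∞ G]
    {T : Lp ℂ 2 haar →L[ℂ] Lp ℂ 2 μ} (hT : IsEquivariant T)
    {A : Lp ℂ 2 haar →L[ℂ] Lp ℂ 2 μ'} {f : Lp ℂ 2 μ'} (hA : IsConvolution IG A f)
    (h : T.adjoint ∘L T = A.adjoint ∘L A) :
    ∃ F, IsConvolution IG T F ∧ ‖F‖ = ‖f‖ := by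
  obtain ⟨φ, hφ⟩ := exists_isApproxId (IG := IG) (haar := haar)
  set x : ℕ → Lp ℂ 2 haar := fun n => (hφ.isTestFunction n).memLp.toLp _
  have hAx : Tendsto (fun n => A (x n)) atTop (𝓝 f) := hA.tendsto hφ
  have hcau : CauchySeq fun n => T (x n) := by
    rw [Metric.cauchySeq_iff]
    intro ε hε
    obtain ⟨N, hN⟩ := Metric.cauchySeq_iff.mp hAx.cauchySeq ε hε
    refine ⟨N, fun m hm k hk => ?_⟩
    have h1 := hN m hm k hk
    rw [dist_eq_norm, ← map_sub] at h1 ⊢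
    rwa [norm_apply_eq_of_adjoint_comp_eq h]
  obtain ⟨F, hF⟩ := cauchySeq_tendsto_of_complete hcau
  refine ⟨F, hT.isConvolution_of_tendsto hφ hF, tendsto_nhds_unique hF.norm ?_⟩
  simpa only [norm_apply_eq_of_adjoint_comp_eq h] using hAx.norm

theorem IsConvolution.unique [FiniteDimensional ℝ EG] [IsManifold IG ∞ G]
    {T : Lp ℂ 2 haar →L[ℂ] Lp ℂ 2 μ} {F F' : Lp ℂ 2 μ}
    (h : IsConvolution IG T F) (h' : IsConvolution IG T F') : F = F' := by
  obtain ⟨φ, hφ⟩ := exists_isApproxId (IG := IG) (haar := haar)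
  exact tendsto_nhds_unique (h.tendsto hφ) (h'.tendsto hφ)

theorem IsEquivariant.commute_adjoint_comp {T : Lp ℂ 2 haar →L[ℂ] Lp ℂ 2 μ}
    (hT : IsEquivariant T) (s : G) :
    Commute (T.adjoint ∘L T) (rightTranslation haar s).toContinuousLinearMap := by
  refine ContinuousLinearMap.ext fun u => ?_
  refine ext_inner_left ℂ fun v => ?_
  change ⟪v, T.adjoint (T (rightTranslation haar s u))⟫_ℂ =
    ⟪v, rightTranslation haar s (T.adjoint (T u))⟫_ℂ
  have h1 := inner_rightTranslation_left s⁻¹ v (T.adjoint (T u))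
  have h2 := inner_rightTranslation_left s⁻¹ (T v) (T u)
  rw [inv_inv] at h1 h2
  rw [← h1, ContinuousLinearMap.adjoint_inner_right, ContinuousLinearMap.adjoint_inner_right,
    hT, hT, h2]

/-- The absolute value of an operator between Hilbert spaces. -/
theorem exists_absoluteValue {E F : Type*} [NormedAddCommGroup E] [InnerProductSpace ℂ E]
    [CompleteSpace E] [NormedAddCommGroup F] [InnerProductSpace ℂ F] [CompleteSpace F]
    (T : E →L[ℂ] F) : ∃ S : E →L[ℂ] E, T.adjoint ∘L T = S.adjoint ∘L S ∧
      ∀ R : E →L[ℂ] E, Commute (T.adjoint ∘L T) R → Commute S R := by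
  have hpos : 0 ≤ T.adjoint ∘L T :=
    (ContinuousLinearMap.nonneg_iff_isPositive _).mpr
      (ContinuousLinearMap.isPositive_adjoint_comp_self T)
  -- The square root comes from the functional calculus of T*T, so it commutes with whatever T*T
  -- commutes with.
  refine ⟨CFC.sqrt (T.adjoint ∘L T), ?_, fun R hR => hR.cfcₙ_nnreal NNReal.sqrt⟩
  have h1 := CFC.sqrt_mul_sqrt_self (T.adjoint ∘L T) hpos
  have h2 : IsSelfAdjoint (CFC.sqrt (T.adjoint ∘L T)) := (CFC.sqrt_nonneg _).isSelfAdjoint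
  rw [← ContinuousLinearMap.star_eq_adjoint (CFC.sqrt (T.adjoint ∘L T)), h2.star_eq]
  exact h1.symm

/-- The group trace of `T^* T` for an equivariant convolution operator `T`. -/
theorem IsEquivariant.groupTrace_eq [FiniteDimensional ℝ EG] [IsManifold IG ∞ G]
    {T : Lp ℂ 2 haar →L[ℂ] Lp ℂ 2 μ} (hT : IsEquivariant T) {F : Lp ℂ 2 μ}
    (hF : IsConvolution IG T F) : groupTrace IG (T.adjoint ∘L T) = ‖F‖ₑ ^ 2 := by
  refine le_antisymm ?_ ?_
  -- The infimum is attained by |T|, an equivariant operator on L²(G). For the other inequality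
  -- every admissible pair has the norm of F, by uniqueness of the convolving vector.
  · obtain ⟨S, hSS, hSc⟩ := exists_absoluteValue T
    have hS : IsEquivariant S := fun s u =>
      congrArg (fun A : Lp ℂ 2 haar →L[ℂ] Lp ℂ 2 haar => A u) (hSc _ (hT.commute_adjoint_comp s))
    obtain ⟨f, hf, hfF⟩ := hS.exists_of_adjoint_comp_eq hF hSS.symm
    have h3 : ‖F‖ₑ = ‖f‖ₑ := by
      rw [← ofReal_norm, ← ofReal_norm, hfF]
    rw [h3]
    exact iInf_le_of_le S (iInf_le_of_le f (iInf_le _ ⟨isLeftConvolution_iff.mpr hf, hSS⟩))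
  · refine le_iInf fun A => le_iInf fun f => le_iInf fun hAf => ?_
    obtain ⟨F', hF', hn⟩ :=
      hT.exists_of_adjoint_comp_eq (isLeftConvolution_iff.mp hAf.1) hAf.2
    rw [hF.unique hF', ← ofReal_norm, ← ofReal_norm, hn]

theorem IsEquivariant.exists_isConvolution_of_groupTrace_lt_top [FiniteDimensional ℝ EG]
    [IsManifold IG ∞ G] {T : Lp ℂ 2 haar →L[ℂ] Lp ℂ 2 μ} (hT : IsEquivariant T)
    (h : groupTrace IG (T.adjoint ∘L T) < ⊤) : ∃ F, IsConvolution IG T F := by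
  simp only [groupTrace, iInf_lt_iff] at h
  obtain ⟨A, f, hAf, -⟩ := h
  obtain ⟨F, hF, -⟩ := hT.exists_of_adjoint_comp_eq (isLeftConvolution_iff.mp hAf.1) hAf.2
  exact ⟨F, hF⟩

end Equivariant

/-! ### Tensor products of `L²` functions -/

section TensorProduct

variable {α β : Type*} [MeasurableSpace α] [MeasurableSpace β] {ρ : Measure α} {ν : Measure β}
  [SigmaFinite ρ] [SigmaFinite ν]

theorem memLp_mul_prod {f : α → ℂ} {g : β → ℂ} (hf : MemLp f 2 ρ) (hg : MemLp g 2 ν) :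
    MemLp (fun z : α × β => f z.1 * g z.2) 2 (ρ.prod ν) := by
  refine ⟨hf.1.comp_fst.mul hg.1.comp_snd, ?_⟩
  have hf2 := hf.2
  have hg2 := hg.2
  rw [eLpNorm_lt_top_iff_lintegral_rpow_enorm_lt_top two_ne_zero ENNReal.ofNat_ne_top] at *
  simp only [enorm_mul, ENNReal.toReal_ofNat,
    ENNReal.mul_rpow_of_nonneg _ _ (zero_le_two : (0 : ℝ) ≤ 2)] at *
  rw [lintegral_prod_mul (hf.1.enorm.pow_const _) (hg.1.enorm.pow_const _)]
  exact ENNReal.mul_lt_top hf2 hg2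

/-- The function `(a, b) ↦ g(a) conj(h(b))` in `L²`. -/
def coTensor (h : Lp ℂ 2 ν) (g : Lp ℂ 2 ρ) : Lp ℂ 2 (ρ.prod ν) :=
  (memLp_mul_prod (Lp.memLp g) (Lp.memLp h).star).toLp

theorem coTensor_ae_eq (h : Lp ℂ 2 ν) (g : Lp ℂ 2 ρ) :
    coTensor h g =ᵐ[ρ.prod ν] fun z => g z.1 * conj (h z.2) :=
  MemLp.coeFn_toLp _

theorem coTensor_add_left (h h' : Lp ℂ 2 ν) (g : Lp ℂ 2 ρ) :
    coTensor (h + h') g = coTensor h g + coTensor h' g := by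
  refine Lp.ext ?_
  filter_upwards [coTensor_ae_eq (h + h') g, coTensor_ae_eq h g, coTensor_ae_eq h' g,
    Lp.coeFn_add (coTensor h g) (coTensor h' g),
    Measure.quasiMeasurePreserving_snd.ae (Lp.coeFn_add h h')] with z h1 h2 h3 h4 h5
  rw [h1, h4, Pi.add_apply, h2, h3, h5, Pi.add_apply, map_add, mul_add]

theorem coTensor_smul_left (c : ℂ) (h : Lp ℂ 2 ν) (g : Lp ℂ 2 ρ) :
    coTensor (c • h) g = conj c • coTensor h g := by
  refine Lp.ext ?_
  filter_upwards [coTensor_ae_eq (c • h) g, coTensor_ae_eq h g,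
    Lp.coeFn_smul (conj c) (coTensor h g),
    Measure.quasiMeasurePreserving_snd.ae (Lp.coeFn_smul c h)] with z h1 h2 h3 h4
  rw [h1, h3, Pi.smul_apply, h2, h4, Pi.smul_apply, smul_eq_mul, smul_eq_mul, map_mul]
  ring

theorem coTensor_add_right (h : Lp ℂ 2 ν) (g g' : Lp ℂ 2 ρ) :
    coTensor h (g + g') = coTensor h g + coTensor h g' := by
  refine Lp.ext ?_
  filter_upwards [coTensor_ae_eq h (g + g'), coTensor_ae_eq h g, coTensor_ae_eq h g',
    Lp.coeFn_add (coTensor h g) (coTensor h g'),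
    Measure.quasiMeasurePreserving_fst.ae (Lp.coeFn_add g g')] with z h1 h2 h3 h4 h5
  rw [h1, h4, Pi.add_apply, h2, h3, h5, Pi.add_apply, add_mul]

theorem coTensor_smul_right (c : ℂ) (h : Lp ℂ 2 ν) (g : Lp ℂ 2 ρ) :
    coTensor h (c • g) = c • coTensor h g := by
  refine Lp.ext ?_
  filter_upwards [coTensor_ae_eq h (c • g), coTensor_ae_eq h g,
    Lp.coeFn_smul c (coTensor h g),
    Measure.quasiMeasurePreserving_fst.ae (Lp.coeFn_smul c g)] with z h1 h2 h3 h4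
  rw [h1, h3, Pi.smul_apply, h2, h4, Pi.smul_apply, smul_eq_mul, smul_eq_mul]
  ring

/-- The second factor is conjugated, hence the reversed order. This makes the adjoint of
`coTensorCLM h` the slice map k ↦ ∫ k(·, q) h(q) dν(q), which is linear in h. -/
theorem inner_coTensor (h h' : Lp ℂ 2 ν) (g g' : Lp ℂ 2 ρ) :
    ⟪coTensor h g, coTensor h' g'⟫_ℂ = ⟪g, g'⟫_ℂ * ⟪h', h⟫_ℂ := by
  rw [L2.inner_def, L2.inner_def, L2.inner_def, ← integral_prod_mul]
  refine integral_congr_ae ?_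
  filter_upwards [coTensor_ae_eq h g, coTensor_ae_eq h' g'] with z h1 h2
  simp only [h1, h2, RCLike.inner_apply, map_mul, Complex.conj_conj]
  ring

theorem norm_coTensor (h : Lp ℂ 2 ν) (g : Lp ℂ 2 ρ) : ‖coTensor h g‖ = ‖h‖ * ‖g‖ := by
  have h1 := inner_coTensor h h g g
  simp only [inner_self_eq_norm_sq_to_K] at h1
  have h2 : ‖coTensor h g‖ ^ 2 = (‖h‖ * ‖g‖) ^ 2 := by
    rw [mul_pow, mul_comm]
    exact_mod_cast h1
  exact (sq_eq_sq₀ (norm_nonneg _) (by positivity)).mp h2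

/-- `g ↦ g ⊗ conj h` as a bounded operator. -/
def coTensorCLM (h : Lp ℂ 2 ν) : Lp ℂ 2 ρ →L[ℂ] Lp ℂ 2 (ρ.prod ν) :=
  LinearMap.mkContinuous
    { toFun := coTensor h
      map_add' := coTensor_add_right h
      map_smul' := fun c g => coTensor_smul_right c h g } ‖h‖ fun g => (norm_coTensor h g).le

@[simp]
theorem coTensorCLM_apply (h : Lp ℂ 2 ν) (g : Lp ℂ 2 ρ) : coTensorCLM h g = coTensor h g := rfl

/-- `h ↦ ⟪g ⊗ conj h, k⟫` as a bounded functional. -/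
theorem exists_clm_inner_coTensor (g : Lp ℂ 2 ρ) (k : Lp ℂ 2 (ρ.prod ν)) :
    ∃ ℓ : Lp ℂ 2 ν →L[ℂ] ℂ, ∀ h, ℓ h = ⟪coTensor h g, k⟫_ℂ := by
  refine ⟨LinearMap.mkContinuous
    { toFun := fun h => ⟪coTensor h g, k⟫_ℂ
      map_add' := fun h h' => by rw [coTensor_add_left, inner_add_left]
      map_smul' := fun c h => by
        rw [coTensor_smul_left, inner_smul_left, Complex.conj_conj]; rfl } (‖g‖ * ‖k‖)
    fun h => ?_, fun h => rfl⟩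
  change ‖⟪coTensor h g, k⟫_ℂ‖ ≤ _
  refine (norm_inner_le_norm _ _).trans_eq ?_
  rw [norm_coTensor]
  ring

end TensorProduct

/-! ### Families of isometries with orthogonal ranges -/

section Orthogonal

variable {ι K E : Type*} [NormedAddCommGroup K] [InnerProductSpace ℂ K] [CompleteSpace K]
  [NormedAddCommGroup E] [InnerProductSpace ℂ E] [CompleteSpace E]

/-- Bessel's inequality. -/
theorem sum_norm_adjoint_sq_le [DecidableEq ι] {V : ι → K →L[ℂ] E}
    (hV : ∀ i j u v, ⟪V i u, V j v⟫_ℂ = if i = j then ⟪u, v⟫_ℂ else 0) (x : E) (J : Finset ι) :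
    ∑ i ∈ J, ‖(V i).adjoint x‖ ^ 2 ≤ ‖x‖ ^ 2 := by
  set S := ∑ i ∈ J, ‖(V i).adjoint x‖ ^ 2 with hS
  -- This is the projection of x to the span of finitely many ranges: S = ⟪y, x⟫ = ‖y‖², and
  -- Cauchy–Schwarz finishes.
  set y := ∑ i ∈ J, V i ((V i).adjoint x)
  have hS0 : 0 ≤ S := Finset.sum_nonneg fun i _ => by positivity
  have h1 : ⟪y, x⟫_ℂ = S := by
    rw [sum_inner, hS, Complex.ofReal_sum]
    refine Finset.sum_congr rfl fun i _ => ?_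
    rw [← ContinuousLinearMap.adjoint_inner_right, inner_self_eq_norm_sq_to_K]
    simp
  have h2 : ⟪y, y⟫_ℂ = S := by
    rw [sum_inner, hS, Complex.ofReal_sum]
    refine Finset.sum_congr rfl fun i hi => ?_
    simp only [y, inner_sum, hV, Finset.sum_ite_eq, hi, if_true]
    rw [inner_self_eq_norm_sq_to_K]
    simp
  have h3 : ‖y‖ ^ 2 = S := by
    rw [inner_self_eq_norm_sq_to_K] at h2
    have h5 : ((‖y‖ ^ 2 : ℝ) : ℂ) = (S : ℂ) := by
      rw [← h2]
      push_cast
      rfl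
    exact Complex.ofReal_injective h5
  have h4 : S ≤ ‖y‖ * ‖x‖ := by
    have := norm_inner_le_norm (𝕜 := ℂ) y x
    rwa [h1, Complex.norm_real, Real.norm_of_nonneg hS0] at this
  nlinarith [sq_nonneg (‖y‖ - ‖x‖)]

/-- A square-summable family is the family of components of a vector. -/
theorem exists_adjoint_eq_of_summable [DecidableEq ι] {V : ι → K →L[ℂ] E}
    (hV : ∀ i j u v, ⟪V i u, V j v⟫_ℂ = if i = j then ⟪u, v⟫_ℂ else 0) {F : ι → K}
    (hF : ∑' i, ‖F i‖ₑ ^ 2 < ⊤) :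
    ∃ k : E, (∀ i, (V i).adjoint k = F i) ∧ ‖k‖ₑ ^ 2 = ∑' i, ‖F i‖ₑ ^ 2 := by
  -- The V i embed the Hilbert sum of copies of K isometrically, and k is the image of the family F.
  let W : ι → K →ₗᵢ[ℂ] E := fun i =>
    (V i).toLinearMap.isometryOfInner fun u v => by simpa using hV i i u v
  have hW : OrthogonalFamily ℂ (fun _ : ι => K) W := fun i j hij u v => by
    have h := hV i j u v
    rw [if_neg hij] at h
    exact h
  have hen : ∀ i, ‖F i‖ₑ ^ 2 = ENNReal.ofReal (‖F i‖ ^ 2) := fun i => by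
    rw [← ofReal_norm, ENNReal.ofReal_pow (norm_nonneg _)]
  have hsum : Summable fun i => ‖F i‖ ^ 2 := by
    simp only [hen] at hF
    have := ENNReal.summable_toReal hF.ne
    simpa only [ENNReal.toReal_ofReal (sq_nonneg _)] using this
  have hmem : Memℓp F 2 := by
    refine memℓp_gen ?_
    simpa using hsum
  let f : lp (fun _ : ι => K) 2 := ⟨F, hmem⟩
  refine ⟨hW.linearIsometry f, fun i => ?_, ?_⟩
  · refine ext_inner_left ℂ fun u => ?_
    rw [ContinuousLinearMap.adjoint_inner_right]
    have h1 : V i u = hW.linearIsometry (lp.single 2 i u) := by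
      rw [hW.linearIsometry_apply_single]
      rfl
    rw [h1, LinearIsometry.inner_map_map, lp.inner_single_left]
  · rw [← ofReal_norm, LinearIsometry.norm_map, ← ENNReal.ofReal_pow (norm_nonneg _)]
    have h2 : ‖f‖ ^ 2 = ∑' i, ‖F i‖ ^ 2 := by
      have := lp.norm_rpow_eq_tsum (p := 2) (by norm_num) f
      simpa using this
    rw [h2, ENNReal.ofReal_tsum_of_nonneg (fun i => sq_nonneg _) hsum]
    simp only [hen]

end Orthogonal

/-! ### The embeddings `L²(G) ⊗ ψ ⊆ L²(M)` -/

section Embed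

variable {G M : Type*} [Group G] [MulAction Gᵐᵒᵖ M] [MeasurableSpace G] [MeasurableMul G]
  [MeasurableSpace M] {haar : Measure G} [haar.IsMulLeftInvariant] [SigmaFinite haar]
  {μ : Measure M} {ν : Measure (OrbitSpace G M)}
  (e : MeasurableTrivialization G M) (hν : IsQuotientMeasure haar μ ν)

theorem MeasurableTrivialization.embed_ae_eq (ψ : Lp ℂ 2 ν) (u : Lp ℂ 2 haar) :
    e.embed hν ψ u =ᵐ[μ] fun x => u (e.coord x) * ψ (toOrbit G x) :=
  MemLp.coeFn_toLp (e.eLpNorm_tensor hν u ψ).1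

theorem MeasurableTrivialization.measurePreserving_coord (hν : IsQuotientMeasure haar μ ν) :
    MeasurePreserving (fun x => (e.coord x, toOrbit G x)) μ (haar.prod ν) := by
  have h := e.measurePreserving hν
  have h2 : (fun x => (e.coord x, toOrbit G x)) = e.toMeasurableEquiv :=
    funext fun x => (e.apply_eq x).symm
  rwa [h2]

theorem MeasurableTrivialization.quasiMeasurePreserving_coord (hν : IsQuotientMeasure haar μ ν) :
    Measure.QuasiMeasurePreserving e.coord μ haar := by
  have := hν.sigmaFinite
  have h := (Measure.quasiMeasurePreserving_fst (μ := haar) (ν := ν)).comp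
    (e.measurePreserving_coord hν).quasiMeasurePreserving
  exact h

theorem MeasurableTrivialization.quasiMeasurePreserving_toOrbit
    (hν : IsQuotientMeasure haar μ ν) (e : MeasurableTrivialization G M) :
    Measure.QuasiMeasurePreserving (toOrbit G : M → OrbitSpace G M) μ ν := by
  have := hν.sigmaFinite
  have h := (Measure.quasiMeasurePreserving_snd (μ := haar) (ν := ν)).comp
    (e.measurePreserving_coord hν).quasiMeasurePreserving
  exact h

theorem MeasurableTrivialization.embed_add (ψ ψ' : Lp ℂ 2 ν) (u : Lp ℂ 2 haar) :
    e.embed hν (ψ + ψ') u = e.embed hν ψ u + e.embed hν ψ' u := by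
  refine Lp.ext ?_
  filter_upwards [e.embed_ae_eq hν (ψ + ψ') u, e.embed_ae_eq hν ψ u, e.embed_ae_eq hν ψ' u,
    Lp.coeFn_add (e.embed hν ψ u) (e.embed hν ψ' u),
    (e.quasiMeasurePreserving_toOrbit hν).ae (Lp.coeFn_add ψ ψ')] with z h1 h2 h3 h4 h5
  rw [h1, h4, Pi.add_apply, h2, h3, h5, Pi.add_apply, mul_add]

theorem MeasurableTrivialization.embed_smul (c : ℂ) (ψ : Lp ℂ 2 ν) (u : Lp ℂ 2 haar) :
    e.embed hν (c • ψ) u = c • e.embed hν ψ u := by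
  refine Lp.ext ?_
  filter_upwards [e.embed_ae_eq hν (c • ψ) u, e.embed_ae_eq hν ψ u,
    Lp.coeFn_smul c (e.embed hν ψ u),
    (e.quasiMeasurePreserving_toOrbit hν).ae (Lp.coeFn_smul c ψ)] with z h1 h2 h3 h4
  rw [h1, h3, Pi.smul_apply, h2, h4, Pi.smul_apply, smul_eq_mul, smul_eq_mul]
  ring

theorem MeasurableTrivialization.inner_embed (ψ ψ' : Lp ℂ 2 ν) (u u' : Lp ℂ 2 haar) :
    ⟪e.embed hν ψ u, e.embed hν ψ' u'⟫_ℂ = ⟪u, u'⟫_ℂ * ⟪ψ, ψ'⟫_ℂ := by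
  have := hν.sigmaFinite
  rw [L2.inner_def, L2.inner_def, L2.inner_def, ← integral_prod_mul,
    ← (e.measurePreserving hν).integral_comp e.toMeasurableEquiv.measurableEmbedding]
  refine integral_congr_ae ?_
  filter_upwards [e.embed_ae_eq hν ψ u, e.embed_ae_eq hν ψ' u'] with x h1 h2
  have h3 : e.toMeasurableEquiv x = (e.coord x, toOrbit G x) := e.apply_eq x
  simp only [h1, h2, h3, RCLike.inner_apply, map_mul]
  ring

theorem MeasurableTrivialization.norm_embed (ψ : Lp ℂ 2 ν) (u : Lp ℂ 2 haar) :
    ‖e.embed hν ψ u‖ = ‖u‖ * ‖ψ‖ := by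
  have h1 := e.inner_embed hν ψ ψ u u
  simp only [inner_self_eq_norm_sq_to_K] at h1
  have h2 : ‖e.embed hν ψ u‖ ^ 2 = (‖u‖ * ‖ψ‖) ^ 2 := by
    rw [mul_pow]
    exact_mod_cast h1
  exact (sq_eq_sq₀ (norm_nonneg _) (by positivity)).mp h2

theorem MeasurableTrivialization.exists_clm_inner_embed (v : Lp ℂ 2 μ) (u : Lp ℂ 2 haar) :
    ∃ ℓ : Lp ℂ 2 ν →L[ℂ] ℂ, ∀ ψ, ℓ ψ = ⟪v, e.embed hν ψ u⟫_ℂ := by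
  refine ⟨LinearMap.mkContinuous
    { toFun := fun ψ => ⟪v, e.embed hν ψ u⟫_ℂ
      map_add' := fun h h' => by rw [e.embed_add, inner_add_right]
      map_smul' := fun c h => by rw [e.embed_smul, inner_smul_right]; rfl } (‖v‖ * ‖u‖)
    fun h => ?_, fun h => rfl⟩
  change ‖⟪v, e.embed hν h u⟫_ℂ‖ ≤ _
  refine (norm_inner_le_norm _ _).trans_eq ?_
  rw [e.norm_embed]
  ring

theorem MeasurableTrivialization.embed_rightTranslation [haar.IsMulRightInvariant]
    [MeasurableConstSMul Gᵐᵒᵖ M] [SMulInvariantMeasure Gᵐᵒᵖ M μ] (ψ : Lp ℂ 2 ν) (s : G)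
    (u : Lp ℂ 2 haar) :
    e.embed hν ψ (rightTranslation haar s u) = rightTranslation μ s (e.embed hν ψ u) := by
  refine Lp.ext ?_
  have h1 : rightTranslation haar s u =ᵐ[haar] fun t => u (t * s) :=
    Lp.coeFn_compMeasurePreserving u (measurePreserving_smul (op s) haar)
  have h2 : rightTranslation μ s (e.embed hν ψ u) =ᵐ[μ] fun x => e.embed hν ψ u (op s • x) :=
    Lp.coeFn_compMeasurePreserving _ (measurePreserving_smul (op s) μ)
  filter_upwards [e.embed_ae_eq hν ψ (rightTranslation haar s u), h2,
    (measurePreserving_smul (op s) μ).quasiMeasurePreserving.ae (e.embed_ae_eq hν ψ u),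
    (e.quasiMeasurePreserving_coord hν).ae h1] with x h3 h4 h5 h6
  rw [h3, h4, h5, h6, e.coord_smul, toOrbit_smul]

end Embed

/-! ### Functions on a product that are orthogonal to tensor products -/

/-- Rectangles form a π-system generating the product σ-algebra, and the sets over which d
integrates to zero are closed under complements and disjoint unions. -/
theorem ae_eq_zero_of_setIntegral_prod_eq_zero {α β : Type*} [MeasurableSpace α]
    [MeasurableSpace β] {ρ : Measure α} {ν : Measure β} [SFinite ρ] [SFinite ν] {d : α × β → ℂ}
    (hd : Integrable d (ρ.prod ν))
    (h : ∀ S B, MeasurableSet S → MeasurableSet B → ∫ z in S ×ˢ B, d z ∂ρ.prod ν = 0) :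
    d =ᵐ[ρ.prod ν] 0 := by
  refine Integrable.ae_eq_zero_of_forall_setIntegral_eq_zero hd fun s hs hfin => ?_
  clear hfin
  have huniv : ∫ z, d z ∂ρ.prod ν = 0 := by
    have := h Set.univ Set.univ MeasurableSet.univ MeasurableSet.univ
    rwa [Set.univ_prod_univ, Measure.restrict_univ] at this
  induction s, hs using MeasurableSpace.induction_on_inter generateFrom_prod.symm
    isPiSystem_prod with
  | empty => simp
  | basic t ht =>
    obtain ⟨S, hS, B, hB, rfl⟩ := ht
    exact h S B hS hB
  | compl t ht ih => rw [setIntegral_compl ht hd, ih, huniv, sub_zero]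
  | iUnion f hf hm ih =>
    rw [integral_iUnion hm hf hd.integrableOn]
    simp [ih]

section Tensor

variable {E H Y Z : Type*} [NormedAddCommGroup E] [NormedSpace ℝ E] [FiniteDimensional ℝ E]
  [TopologicalSpace H] (I : ModelWithCorners ℝ E H) [TopologicalSpace Y] [ChartedSpace H Y]
  [IsManifold I ∞ Y] [MeasurableSpace Y] [BorelSpace Y] [T2Space Y] [SigmaCompactSpace Y]
  [MeasurableSpace Z] {ρ : Measure Y} [SigmaFinite ρ] {ν : Measure Z} [SigmaFinite ν]

/-- For fixed B, testing in the first variable shows that the integral of d(y, ·) over B vanishes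
for almost every y. The null set depends on B, so the conclusion is drawn from integrals over
rectangles instead of fibre by fibre. -/
theorem ae_eq_zero_of_integral_test_eq_zero {d : Y × Z → ℂ} {D : ℕ → Set Z}
    (hD : ∀ j, MeasurableSet (D j)) (hDu : ⋃ j, D j = Set.univ)
    (hd : ∀ C, IsCompact C → ∀ j, IntegrableOn d (C ×ˢ D j) (ρ.prod ν))
    (h : ∀ j, ∀ B ⊆ D j, MeasurableSet B → ∀ g : Y → ℝ, ContMDiff I 𝓘(ℝ, ℝ) ∞ g →
      HasCompactSupport g → ∫ z in Set.univ ×ˢ B, (g z.1 : ℂ) * d z ∂ρ.prod ν = 0) :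
    d =ᵐ[ρ.prod ν] 0 := by
  have := I.locallyCompactSpace
  have := ChartedSpace.locallyCompactSpace H Y
  have hfib : ∀ j, ∀ B ⊆ D j, MeasurableSet B → ∀ᵐ y ∂ρ, ∫ z in B, d (y, z) ∂ν = 0 := by
    intro j B hB hBm
    have hdB : ∀ C, IsCompact C → Integrable d ((ρ.restrict C).prod (ν.restrict B)) := by
      intro C hC
      rw [Measure.prod_restrict]
      exact (hd C hC j).mono_set (Set.prod_mono_right hB)
    refine ae_eq_zero_of_integral_contMDiff_smul_eq_zero I ?_ fun g hg hgc => ?_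
    · rw [locallyIntegrable_iff]
      exact fun C hC => (hdB C hC).integral_prod_left
    · have hgi : Integrable (fun z : Y × Z => (g z.1 : ℂ) * d z) (ρ.prod (ν.restrict B)) := by
        obtain ⟨c, hc⟩ := hgc.exists_bound_of_continuous hg.continuous
        have h1 : Integrable (fun z : Y × Z => (g z.1 : ℂ) * d z)
            ((ρ.restrict (tsupport g)).prod (ν.restrict B)) := by
          refine (hdB _ hgc).bdd_mul (c := c) ?_ (.of_forall fun z => ?_)
          · exact ((Complex.continuous_ofReal.comp hg.continuous).measurable.comp
              measurable_fst).aestronglyMeasurable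
          · rw [Complex.norm_real]
            exact hc _
        have h2 : (ρ.restrict (tsupport g)).prod (ν.restrict B) =
            (ρ.prod (ν.restrict B)).restrict (tsupport g ×ˢ Set.univ) := by
          rw [← Measure.prod_restrict, Measure.restrict_univ]
        rw [h2] at h1
        refine (integrableOn_iff_integrable_of_support_subset fun z hz => ?_).mp h1
        refine ⟨subset_tsupport _ fun h0 => hz ?_, trivial⟩
        simp [h0]
      have h3 := h j B hB hBm g hg hgc
      rw [← Measure.prod_restrict, Measure.restrict_univ, integral_prod _ hgi] at h3
      rw [← h3]
      refine integral_congr_ae (.of_forall fun y => ?_)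
      simp only [Complex.real_smul]
      rw [integral_const_mul]
  have hCD : ∀ C, IsCompact C → ∀ j, ∀ᵐ z ∂(ρ.prod ν), z ∈ C ×ˢ D j → d z = 0 := by
    intro C hC j
    rw [← ae_restrict_iff' (hC.measurableSet.prod (hD j)), ← Measure.prod_restrict]
    have hInt := hd C hC j
    rw [IntegrableOn, ← Measure.prod_restrict] at hInt
    refine ae_eq_zero_of_setIntegral_prod_eq_zero hInt fun S B hS hB => ?_
    have hInt2 := hInt.integrableOn (s := S ×ˢ B)
    rw [IntegrableOn, ← Measure.prod_restrict, Measure.restrict_restrict hS,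
      Measure.restrict_restrict hB] at hInt2
    rw [← Measure.prod_restrict, Measure.restrict_restrict hS, Measure.restrict_restrict hB,
      integral_prod _ hInt2]
    refine integral_eq_zero_of_ae (ae_restrict_of_ae ?_)
    exact hfib j _ Set.inter_subset_right (hB.inter (hD j))
  have hall : ∀ᵐ z ∂(ρ.prod ν), ∀ i j : ℕ, z ∈ compactCovering Y i ×ˢ D j → d z = 0 := by
    rw [ae_all_iff]
    intro i
    rw [ae_all_iff]
    exact fun j => hCD _ (isCompact_compactCovering Y i) j
  filter_upwards [hall] with z hz
  obtain ⟨i, hi⟩ := exists_mem_compactCovering z.1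
  obtain ⟨j, hj⟩ := Set.mem_iUnion.mp (hDu ▸ Set.mem_univ z.2 : z.2 ∈ ⋃ j, D j)
  exact hz i j ⟨hi, hj⟩

end Tensor

/-! ### Invariant kernels -/

theorem Lp.lintegral_enorm_mul_le {α : Type*} [MeasurableSpace α] {ρ : Measure α}
    (f g : Lp ℂ 2 ρ) : ∫⁻ a, ‖f a‖ₑ * ‖g a‖ₑ ∂ρ ≤ ‖f‖ₑ * ‖g‖ₑ := by
  have h := ENNReal.lintegral_mul_le_Lp_mul_Lq ρ Real.HolderConjugate.two_two
    (Lp.aestronglyMeasurable f).enorm (Lp.aestronglyMeasurable g).enorm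
  refine h.trans_eq ?_
  rw [Lp.enorm_def, Lp.enorm_def,
    eLpNorm_eq_lintegral_rpow_enorm_toReal two_ne_zero ENNReal.ofNat_ne_top,
    eLpNorm_eq_lintegral_rpow_enorm_toReal two_ne_zero ENNReal.ofNat_ne_top]
  simp

theorem Lp.lintegral_enorm_sq {α : Type*} [MeasurableSpace α] {ρ : Measure α} (f : Lp ℂ 2 ρ) :
    ∫⁻ a, ‖f a‖ₑ ^ 2 ∂ρ = ‖f‖ₑ ^ 2 := by
  have h := eLpNorm_nnreal_pow_eq_lintegral (p := 2) (f := f) (μ := ρ) two_ne_zero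
  rw [Lp.enorm_def]
  simpa using h.symm

section Kernel

variable {G M : Type*} [Group G] [TopologicalSpace G] [IsTopologicalGroup G]
  [SecondCountableTopology G] [MeasurableSpace G] [BorelSpace G]
  {haar : Measure G} [haar.IsMulLeftInvariant] [SigmaFinite haar]
  [TopologicalSpace M] [R1Space M] [SecondCountableTopology M] [MeasurableSpace M] [BorelSpace M]
  [MulAction Gᵐᵒᵖ M] [ContinuousSMul Gᵐᵒᵖ M]
  {μ : Measure M} [SMulInvariantMeasure Gᵐᵒᵖ M μ] [SigmaFinite μ]
  {ν : Measure (OrbitSpace G M)} (e : MeasurableTrivialization G M)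

/-- The measure-preserving map `(x, y) ↦ (τ y, x (τ y)⁻¹, y G)` from `M × M` to `G × M × M / G`. -/
def MeasurableTrivialization.pairCoord (z : M × M) : G × (M × OrbitSpace G M) :=
  (e.coord z.2, (op (e.coord z.2)⁻¹ • z.1, toOrbit G z.2))

/-- The invariant kernel `K(x, y) = k(x (τ y)⁻¹, y G)` on `M × M`. -/
def MeasurableTrivialization.kernel (k : M × OrbitSpace G M → ℂ) (z : M × M) : ℂ :=
  k (e.pairCoord z).2

theorem measurePreserving_skew_smul (ν : Measure (OrbitSpace G M)) [SigmaFinite ν] :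
    MeasurePreserving (fun p : G × (M × OrbitSpace G M) => (p.1, (op p.1 • p.2.1, p.2.2)))
      (haar.prod (μ.prod ν)) (haar.prod (μ.prod ν)) := by
  refine (MeasurePreserving.id haar).skew_product
    (g := fun s (p : M × OrbitSpace G M) => (op s • p.1, p.2)) ?_ (.of_forall fun s => ?_)
  · have h1 := measurable_op_smul (G := G) (M := M)
    have h2 : Measurable fun p : G × (M × OrbitSpace G M) => (p.2.1, p.1) := by fun_prop
    exact (h1.comp h2).prodMk (by fun_prop)
  · exact ((measurePreserving_smul (op s) μ).prod (MeasurePreserving.id ν)).map_eq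

/-- The trivialization in the second variable is followed by the skew translation x ↦ x s⁻¹, which
preserves the product because μ is invariant. -/
theorem MeasurableTrivialization.measurePreserving_pairCoord (hν : IsQuotientMeasure haar μ ν) :
    MeasurePreserving e.pairCoord (μ.prod μ) (haar.prod (μ.prod ν)) := by
  have := hν.sigmaFinite
  have h1 : MeasurePreserving
      (fun z : M × M => ((e.coord z.2, toOrbit G z.2), z.1)) (μ.prod μ) ((haar.prod ν).prod μ) :=
    ((e.measurePreserving_coord hν).prod (MeasurePreserving.id μ)).comp
      Measure.measurePreserving_swap
  have h2 : MeasurePreserving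
      (fun p : (G × OrbitSpace G M) × M => (p.1, op p.1.1⁻¹ • p.2))
      ((haar.prod ν).prod μ) ((haar.prod ν).prod μ) := by
    refine (MeasurePreserving.id (haar.prod ν)).skew_product
      (g := fun s x => op s.1⁻¹ • x) ?_ (.of_forall fun s => ?_)
    · have h1 := measurable_op_smul (G := G) (M := M)
      have h2 : Measurable fun p : (G × OrbitSpace G M) × M => (p.2, p.1.1⁻¹) := by fun_prop
      exact h1.comp h2
    · exact (measurePreserving_smul (op s.1⁻¹) μ).map_eq
  have h3 := measurePreserving_prodAssoc haar ν μ
  have h4 : MeasurePreserving (Prod.map id Prod.swap) (haar.prod (ν.prod μ))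
      (haar.prod (μ.prod ν)) :=
    (MeasurePreserving.id haar).prod Measure.measurePreserving_swap
  exact h4.comp (h3.comp (h2.comp h1))

theorem MeasurableTrivialization.quasiMeasurePreserving_pairCoord_snd
    (hν : IsQuotientMeasure haar μ ν) :
    Measure.QuasiMeasurePreserving (fun z => (e.pairCoord z).2) (μ.prod μ) (μ.prod ν) := by
  have := hν.sigmaFinite
  have h := (Measure.quasiMeasurePreserving_snd (μ := haar) (ν := μ.prod ν)).comp
    (e.measurePreserving_pairCoord hν).quasiMeasurePreserving
  exact h

theorem MeasurableTrivialization.aestronglyMeasurable_kernel (hν : IsQuotientMeasure haar μ ν)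
    {k : M × OrbitSpace G M → ℂ} (hk : AEStronglyMeasurable k (μ.prod ν)) :
    AEStronglyMeasurable (e.kernel k) (μ.prod μ) :=
  hk.comp_quasiMeasurePreserving (e.quasiMeasurePreserving_pairCoord_snd hν)

/-- Pairing an invariant kernel with a tensor product. -/
theorem MeasurableTrivialization.integral_kernel [IsLocallyFiniteMeasure μ]
    [μ.InnerRegularCompactLTTop] [SigmaFinite ν] (hν : IsQuotientMeasure haar μ ν)
    (k : Lp ℂ 2 (μ.prod ν))
    (χ : Lp ℂ 2 μ) (β : Lp ℂ 2 ν) {u : G → ℂ} (hu : Integrable u haar) :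
    Integrable (fun z : M × M => e.kernel k z *
      (conj (χ z.1) * (u (e.coord z.2) * β (toOrbit G z.2)))) (μ.prod μ) ∧
    ∫ z : M × M, e.kernel k z *
      (conj (χ z.1) * (u (e.coord z.2) * β (toOrbit G z.2))) ∂(μ.prod μ) =
      ⟪χ, rightConv haar u ((coTensorCLM β).adjoint k)⟫_ℂ := by
  set h : G × (M × OrbitSpace G M) → ℂ := fun p =>
    u p.1 * (k p.2 * (conj (χ (op p.1 • p.2.1)) * β p.2.2)) with hh
  have hcomp : (fun z : M × M => e.kernel k z *
      (conj (χ z.1) * (u (e.coord z.2) * β (toOrbit G z.2)))) = h ∘ e.pairCoord := by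
    funext z
    simp only [hh, Function.comp_apply, MeasurableTrivialization.kernel,
      MeasurableTrivialization.pairCoord, smul_smul, ← op_mul, inv_mul_cancel, op_one, one_smul]
    ring
  have hm : AEStronglyMeasurable h (haar.prod (μ.prod ν)) := by
    refine hu.1.comp_fst.mul ((Lp.aestronglyMeasurable k).comp_snd.mul ?_)
    refine AEStronglyMeasurable.mul ?_ (Lp.aestronglyMeasurable β).comp_snd.comp_snd
    have h1 := (Lp.aestronglyMeasurable χ).comp_quasiMeasurePreserving
      ((Measure.quasiMeasurePreserving_fst (μ := μ) (ν := ν)).comp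
        ((Measure.quasiMeasurePreserving_snd (μ := haar) (ν := μ.prod ν)).comp
          (measurePreserving_skew_smul (haar := haar) (μ := μ) ν).quasiMeasurePreserving))
    exact Complex.continuous_conj.comp_aestronglyMeasurable h1
  have hfib : ∀ s, (fun p => h (s, p)) =ᵐ[μ.prod ν] fun p =>
      u s * (k p * conj (coTensor β (rightTranslation μ s χ) p)) := by
    intro s
    filter_upwards [coTensor_ae_eq β (rightTranslation μ s χ),
      Measure.quasiMeasurePreserving_fst.ae (rightTranslation_ae_eq s χ)] with p h1 h2
    rw [h1, h2]
    simp only [hh, map_mul, Complex.conj_conj]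
  -- For each s, Cauchy–Schwarz bounds the inner integral by |u(s)| ‖k‖ ‖β‖ ‖χ‖, since translating χ
  -- does not change its norm.
  have hInt : Integrable h (haar.prod (μ.prod ν)) := by
    refine ⟨hm, ?_⟩
    rw [HasFiniteIntegral, lintegral_prod _ hm.enorm]
    calc ∫⁻ s, ∫⁻ p, ‖h (s, p)‖ₑ ∂(μ.prod ν) ∂haar
        ≤ ∫⁻ s, ‖u s‖ₑ * (‖k‖ₑ * (‖β‖ₑ * ‖χ‖ₑ)) ∂haar := by
          refine lintegral_mono fun s => ?_
          have h1 : ∫⁻ p, ‖h (s, p)‖ₑ ∂(μ.prod ν) = ‖u s‖ₑ *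
              ∫⁻ p, ‖k p‖ₑ * ‖coTensor β (rightTranslation μ s χ) p‖ₑ ∂(μ.prod ν) := by
            rw [← lintegral_const_mul' _ _ enorm_ne_top]
            refine lintegral_congr_ae ?_
            filter_upwards [hfib s] with p hp
            rw [hp, enorm_mul, enorm_mul, RCLike.enorm_conj]
          rw [h1]
          refine mul_le_mul_right ((Lp.lintegral_enorm_mul_le _ _).trans_eq ?_) _
          congr 1
          rw [← ofReal_norm, norm_coTensor, LinearIsometry.norm_map,
            ENNReal.ofReal_mul (norm_nonneg _), ofReal_norm, ofReal_norm]
      _ < ⊤ := by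
          rw [lintegral_mul_const'' _ hu.1.enorm]
          exact ENNReal.mul_lt_top hu.2 (ENNReal.mul_lt_top enorm_lt_top
            (ENNReal.mul_lt_top enorm_lt_top enorm_lt_top))
  have hmp := e.measurePreserving_pairCoord hν
  rw [hcomp]
  refine ⟨hmp.integrable_comp_of_integrable hInt, ?_⟩
  have h2 := integral_map (f := h) hmp.measurable.aemeasurable (by rwa [hmp.map_eq])
  rw [hmp.map_eq] at h2
  change ∫ z, h (e.pairCoord z) ∂(μ.prod μ) = _
  rw [← h2, integral_prod _ hInt, rightConv,
    ← integral_inner (integrable_smul_rightTranslation hu _)]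
  refine integral_congr_ae (.of_forall fun s => ?_)
  beta_reduce
  rw [integral_congr_ae (hfib s), integral_const_mul, inner_smul_right,
    ← inner_rightTranslation_left, ContinuousLinearMap.adjoint_inner_right, L2.inner_def]
  simp only [RCLike.inner_apply, coTensorCLM_apply]

/-- In the local trivialization, the times at which an orbit is in N lie in a left translate of a
fixed compact subset of G, whose Haar measure does not depend on the orbit. -/
theorem exists_open_forall_measure_le [LocallyCompactSpace G] [IsFiniteMeasureOnCompacts haar]
    {W : Set M} (hW : IsOpen W) (hWG : ∀ y ∈ W, ∀ g : G, op g • y ∈ W) {τ : M → G}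
    (hτ : ContinuousOn τ W) (hτG : ∀ y ∈ W, ∀ g : G, τ (op g • y) = τ y * g) {x : M}
    (hx : x ∈ W) :
    ∃ N, IsOpen N ∧ x ∈ N ∧ ∃ c : ℝ≥0∞, c < ⊤ ∧ ∀ y, haar {s | op s • y ∈ N} ≤ c := by
  obtain ⟨C, hC, hCx⟩ := exists_compact_mem_nhds (τ x)
  refine ⟨W ∩ τ ⁻¹' interior C, hτ.isOpen_inter_preimage hW isOpen_interior,
    ⟨hx, mem_interior_iff_mem_nhds.mpr hCx⟩, haar C, hC.measure_lt_top, fun y => ?_⟩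
  by_cases hy : y ∈ W
  · calc haar {s | op s • y ∈ W ∩ τ ⁻¹' interior C}
        ≤ haar ((fun s => τ y * s) ⁻¹' C) := by
          refine measure_mono fun s hs => ?_
          have := interior_subset hs.2
          rwa [hτG y hy] at this
      _ = haar C := measure_preimage_mul _ _ _
  · have : {s : G | op s • y ∈ W ∩ τ ⁻¹' interior C} = ∅ := by
      refine Set.eq_empty_of_forall_notMem fun s hs => hy ?_
      have := hWG _ hs.1 s⁻¹
      rwa [smul_smul, ← op_mul, mul_inv_cancel, op_one, one_smul] at this
    rw [this, measure_empty]
    exact bot_le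

/-- In the coordinates (s, p) on M × M the kernel does not depend on s, so the s-integral only
measures the time an orbit spends in N. -/
theorem MeasurableTrivialization.lintegral_kernel_sq_le [SigmaFinite ν]
    (hν : IsQuotientMeasure haar μ ν) (k : Lp ℂ 2 (μ.prod ν)) {N : Set M} (hN : MeasurableSet N)
    {c : ℝ≥0∞} (hc : ∀ y, haar {s | op s • y ∈ N} ≤ c) :
    ∫⁻ z in Set.univ ×ˢ N, ‖e.kernel k z‖ₑ ^ 2 ∂(μ.prod μ) ≤ c * ‖k‖ₑ ^ 2 := by
  set h : G × (M × OrbitSpace G M) → ℝ≥0∞ := fun p =>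
    N.indicator 1 (op p.1 • e.section p.2.2) * ‖k p.2‖ₑ ^ 2 with hh
  have hsm : Measurable fun p : G × (M × OrbitSpace G M) => op p.1 • e.section p.2.2 := by
    have h1 := measurable_op_smul (G := G) (M := M)
    have h2 : Measurable fun p : G × (M × OrbitSpace G M) => (e.section p.2.2, p.1) :=
      (e.measurable_section.comp (measurable_snd.comp measurable_snd)).prodMk measurable_fst
    exact h1.comp h2
  have hm : AEMeasurable h (haar.prod (μ.prod ν)) :=
    ((measurable_one.indicator hN).comp hsm).aemeasurable.mul
      ((Lp.aestronglyMeasurable k).comp_snd.enorm.pow_const 2)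
  have hcomp : ∀ z, (Set.univ ×ˢ N).indicator (fun z => ‖e.kernel k z‖ₑ ^ 2) z =
      h (e.pairCoord z) := by
    intro z
    have h1 : op (e.pairCoord z).1 • e.section (e.pairCoord z).2.2 = z.2 := e.smul_section z.2
    simp only [hh, h1]
    by_cases hz : z.2 ∈ N
    · rw [Set.indicator_of_mem (show z ∈ Set.univ ×ˢ N from ⟨trivial, hz⟩),
        Set.indicator_of_mem hz]
      simp [MeasurableTrivialization.kernel]
    · rw [Set.indicator_of_notMem (fun h => hz h.2), Set.indicator_of_notMem hz, zero_mul]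
  have hmp := e.measurePreserving_pairCoord hν
  rw [← lintegral_indicator (MeasurableSet.univ.prod hN), lintegral_congr hcomp]
  have h2 := lintegral_map' (f := h) (by rwa [hmp.map_eq]) hmp.measurable.aemeasurable
  rw [hmp.map_eq] at h2
  rw [← h2, lintegral_prod_symm _ hm, ← Lp.lintegral_enorm_sq, ← lintegral_const_mul'' _
    ((Lp.aestronglyMeasurable k).enorm.pow_const 2)]
  refine lintegral_mono fun p => ?_
  simp only [hh]
  have h3 : Measurable fun s : G => op s • e.section p.2 :=
    (measurable_op_smul (G := G) (M := M)).comp (measurable_const.prodMk measurable_id)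
  have h4 : Measurable fun s : G => N.indicator (1 : M → ℝ≥0∞) (op s • e.section p.2) :=
    (measurable_one.indicator hN).comp h3
  rw [lintegral_mul_const _ h4]
  refine mul_le_mul_left ?_ _
  exact (lintegral_indicator_one (h3 hN)).trans_le (hc _)

/-- The kernel is constant along orbits, so global square-integrability is not to be expected. It
does hold over M × N when orbits spend bounded time in N, and small products have finite measure. -/
theorem MeasurableTrivialization.locallyIntegrable_kernel [LocallyCompactSpace G]
    [IsFiniteMeasureOnCompacts haar] [IsLocallyFiniteMeasure μ] [SigmaFinite ν]
    (hν : IsQuotientMeasure haar μ ν)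
    (hloc : ∀ x : M, ∃ W : Set M, IsOpen W ∧ x ∈ W ∧ (∀ y ∈ W, ∀ g : G, op g • y ∈ W) ∧
      ∃ τ : M → G, ContinuousOn τ W ∧ ∀ y ∈ W, ∀ g : G, τ (op g • y) = τ y * g)
    (k : Lp ℂ 2 (μ.prod ν)) : LocallyIntegrable (e.kernel k) (μ.prod μ) := by
  rintro ⟨x, y⟩
  obtain ⟨W, hW, hyW, hWG, τ, hτ, hτG⟩ := hloc y
  obtain ⟨N, hN, hyN, c, hc, hcN⟩ :=
    exists_open_forall_measure_le (haar := haar) hW hWG hτ hτG hyW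
  obtain ⟨N₁, hxN₁, hN₁o, hN₁⟩ := μ.exists_isOpen_measure_lt_top x
  obtain ⟨N₂, hyN₂, hN₂o, hN₂⟩ := μ.exists_isOpen_measure_lt_top y
  have hopen : IsOpen (N₁ ×ˢ (N ∩ N₂)) := hN₁o.prod (hN.inter hN₂o)
  refine ⟨N₁ ×ˢ (N ∩ N₂), hopen.mem_nhds ⟨hxN₁, hyN, hyN₂⟩, ?_⟩
  have hfin : IsFiniteMeasure ((μ.prod μ).restrict (N₁ ×ˢ (N ∩ N₂))) := by
    refine ⟨?_⟩
    rw [Measure.restrict_apply_univ, Measure.prod_prod]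
    exact ENNReal.mul_lt_top hN₁ ((measure_mono Set.inter_subset_right).trans_lt hN₂)
  have hmem : MemLp (e.kernel k) 2 ((μ.prod μ).restrict (N₁ ×ˢ (N ∩ N₂))) := by
    refine ⟨(e.aestronglyMeasurable_kernel hν (Lp.aestronglyMeasurable k)).restrict, ?_⟩
    rw [eLpNorm_lt_top_iff_lintegral_rpow_enorm_lt_top two_ne_zero ENNReal.ofNat_ne_top]
    simp only [ENNReal.toReal_ofNat, ENNReal.rpow_two]
    calc ∫⁻ z in N₁ ×ˢ (N ∩ N₂), ‖e.kernel k z‖ₑ ^ 2 ∂(μ.prod μ)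
        ≤ ∫⁻ z in Set.univ ×ˢ N, ‖e.kernel k z‖ₑ ^ 2 ∂(μ.prod μ) :=
          lintegral_mono_set (Set.prod_mono (Set.subset_univ _) Set.inter_subset_left)
      _ ≤ c * ‖k‖ₑ ^ 2 := e.lintegral_kernel_sq_le hν k hN.measurableSet hcN
      _ < ⊤ := ENNReal.mul_lt_top hc (ENNReal.pow_lt_top enorm_lt_top)
  exact hmem.integrable one_le_two

end Kernel

/-! ### Schwartz kernels and transposes -/

section Schwartz

variable {E H M : Type*} [NormedAddCommGroup E] [NormedSpace ℝ E] [FiniteDimensional ℝ E]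
  [TopologicalSpace H] {I : ModelWithCorners ℝ E H} [TopologicalSpace M] [ChartedSpace H M]
  [IsManifold I ∞ M] [T2Space M] [SecondCountableTopology M] [SigmaCompactSpace M]
  [LocallyCompactSpace M] [MeasurableSpace M] [BorelSpace M] {μ : Measure M}
  [IsLocallyFiniteMeasure μ]

theorem isTestFunction_ofReal {g : M → ℝ} (hg : ContMDiff I 𝓘(ℝ, ℝ) ∞ g)
    (hgc : HasCompactSupport g) : IsTestFunction I fun x => (g x : ℂ) :=
  ⟨Complex.ofRealCLM.contMDiff.comp hg, hgc.comp_left Complex.ofReal_zero⟩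

theorem Lp.eq_of_inner_test_eq (I : ModelWithCorners ℝ E H) [IsManifold I ∞ M] {v w : Lp ℂ 2 μ}
    (h : ∀ g : M → ℝ, ContMDiff I 𝓘(ℝ, ℝ) ∞ g → HasCompactSupport g → ∀ c : Lp ℂ 2 μ,
      c =ᵐ[μ] (fun x => (g x : ℂ)) → ⟪c, v⟫_ℂ = ⟪c, w⟫_ℂ) : v = w := by
  refine Lp.ext (ae_eq_of_integral_contMDiff_smul_eq I
    ((Lp.memLp v).locallyIntegrable one_le_two) ((Lp.memLp w).locallyIntegrable one_le_two) ?_)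
  intro g hg hgc
  have hm : MemLp (fun x => (g x : ℂ)) 2 μ := (isTestFunction_ofReal hg hgc).memLp
  have hi : ∀ f : Lp ℂ 2 μ, ⟪hm.toLp _, f⟫_ℂ = ∫ x, g x • f x ∂μ := fun f => by
    rw [L2.inner_def]
    refine integral_congr_ae ?_
    filter_upwards [hm.coeFn_toLp] with x hx
    rw [hx, RCLike.inner_apply, Complex.conj_ofReal, Complex.real_smul, mul_comm]
  rw [← hi v, ← hi w]
  exact h g hg hgc _ hm.coeFn_toLp

theorem integrable_test_mul {K : M × M → ℂ} (hK : LocallyIntegrable K (μ.prod μ)) {g : M → ℝ}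
    (hg : Continuous g) (hgc : HasCompactSupport g) {C B : Set M} (hC : IsCompact C)
    (hB : B ⊆ C) : Integrable (fun z => (g z.1 : ℂ) * K z) (μ.prod (μ.restrict B)) := by
  obtain ⟨c, hc⟩ := hgc.exists_bound_of_continuous hg
  have h1 : Integrable (fun z => (g z.1 : ℂ) * K z)
      ((μ.restrict (tsupport g)).prod (μ.restrict B)) := by
    have h0 : Integrable K ((μ.restrict (tsupport g)).prod (μ.restrict B)) := by
      rw [Measure.prod_restrict]
      exact (hK.integrableOn_isCompact (hgc.isCompact.prod hC)).mono_set (Set.prod_mono_right hB)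
    refine h0.bdd_mul (c := c) ?_ (.of_forall fun z => ?_)
    · exact ((Complex.continuous_ofReal.comp hg).measurable.comp
        measurable_fst).aestronglyMeasurable
    · rw [Complex.norm_real]
      exact hc _
  have h2 : (μ.restrict (tsupport g)).prod (μ.restrict B) =
      (μ.prod (μ.restrict B)).restrict (tsupport g ×ˢ Set.univ) := by
    rw [← Measure.prod_restrict, Measure.restrict_univ]
  rw [h2] at h1
  refine (integrableOn_iff_integrable_of_support_subset fun z hz => ?_).mp h1
  refine ⟨subset_tsupport _ fun h0 => hz ?_, trivial⟩
  simp [h0]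

theorem integrable_test_mul_test {K : M × M → ℂ} (hK : LocallyIntegrable K (μ.prod μ))
    {φ χ : M → ℂ} (hφ : IsTestFunction I φ) (hχ : IsTestFunction I χ) :
    Integrable (fun z : M × M => K z * (χ z.1 * φ z.2)) (μ.prod μ) := by
  have hc : Continuous fun z : M × M => χ z.1 * φ z.2 :=
    (hχ.1.continuous.comp continuous_fst).mul (hφ.1.continuous.comp continuous_snd)
  have hs : HasCompactSupport fun z : M × M => χ z.1 * φ z.2 := by
    refine HasCompactSupport.intro (hχ.2.isCompact.prod hφ.2.isCompact) fun z hz => ?_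
    by_cases h1 : z.1 ∈ tsupport χ
    · have h2 : z.2 ∉ tsupport φ := fun h2 => hz ⟨h1, h2⟩
      rw [image_eq_zero_of_notMem_tsupport h2, mul_zero]
    · rw [image_eq_zero_of_notMem_tsupport h1, zero_mul]
  refine (hK.integrable_smul_left_of_hasCompactSupport hc hs).congr (.of_forall fun z => ?_)
  simp only [smul_eq_mul]
  ring

variable {A : Lp ℂ 2 μ →L[ℂ] Lp ℂ 2 μ} {K K' : M × M → ℂ}

/-- The kernel of `A` integrated against a test function in the first variable. -/
theorem IsSchwartzKernel.transpose_ae_eq (hK : IsSchwartzKernel I A K) {g : M → ℝ}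
    (hg : ContMDiff I 𝓘(ℝ, ℝ) ∞ g) (hgc : HasCompactSupport g) {c : Lp ℂ 2 μ}
    (hc : c =ᵐ[μ] fun x => (g x : ℂ)) :
    (fun y => ∫ x, (g x : ℂ) * K (x, y) ∂μ) =ᵐ[μ] fun y => conj (A.adjoint c y) := by
  refine ae_eq_of_integral_contMDiff_smul_eq I ?_
    ((Lp.memLp (A.adjoint c)).star.locallyIntegrable one_le_two) fun φ hφ hφc => ?_
  · rw [locallyIntegrable_iff]
    exact fun C hC => (integrable_test_mul hK.1 hg.continuous hgc hC
      (Set.Subset.refl C)).integral_prod_right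
  · have hφt := isTestFunction_ofReal hφ hφc
    have hgt := isTestFunction_ofReal hg hgc
    have hm : MemLp (fun x => (φ x : ℂ)) 2 μ := hφt.memLp
    have h1 := hK.2 _ _ hφt hgt (hm.toLp _) hm.coeFn_toLp
    rw [integral_prod_symm _ (integrable_test_mul_test hK.1 hφt hgt)] at h1
    have h2 : ∫ x, (g x : ℂ) * A (hm.toLp _) x ∂μ = ⟪c, A (hm.toLp _)⟫_ℂ := by
      rw [L2.inner_def]
      refine integral_congr_ae ?_
      filter_upwards [hc] with x hx
      rw [hx, RCLike.inner_apply, Complex.conj_ofReal, mul_comm]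
    have h3 : ⟪A.adjoint c, hm.toLp _⟫_ℂ = ∫ y, φ y • conj (A.adjoint c y) ∂μ := by
      rw [L2.inner_def]
      refine integral_congr_ae ?_
      filter_upwards [hm.coeFn_toLp] with x hx
      rw [hx, RCLike.inner_apply, Complex.real_smul]
    rw [← h3, ContinuousLinearMap.adjoint_inner_left, ← h2, h1]
    refine integral_congr_ae (.of_forall fun y => ?_)
    simp only [Complex.real_smul]
    rw [← integral_const_mul]
    refine integral_congr_ae (.of_forall fun x => ?_)
    ring

/-- Integrating a kernel of A against a test function g in the first variable gives the conjugate of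
A*g, whichever kernel is used. So the difference is orthogonal to all products of test functions
with indicators. -/
theorem IsSchwartzKernel.ae_eq (hK : IsSchwartzKernel I A K) (hK' : IsSchwartzKernel I A K') :
    K =ᵐ[μ.prod μ] K' := by
  have hd : LocallyIntegrable (K - K') (μ.prod μ) := hK.1.sub hK'.1
  have h0 : K - K' =ᵐ[μ.prod μ] 0 := by
    refine ae_eq_zero_of_integral_test_eq_zero I (D := compactCovering M)
      (fun j => (isCompact_compactCovering M j).measurableSet) (iUnion_compactCovering M)
      (fun C hC j => hd.integrableOn_isCompact (hC.prod (isCompact_compactCovering M j)))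
      fun j B hB hBm g hg hgc => ?_
    have hi := integrable_test_mul hd hg.continuous hgc (isCompact_compactCovering M j) hB
    rw [← Measure.prod_restrict, Measure.restrict_univ, integral_prod_symm _ hi]
    have hm : MemLp (fun x => (g x : ℂ)) 2 μ := (isTestFunction_ofReal hg hgc).memLp
    refine integral_eq_zero_of_ae ?_
    have hiK := integrable_test_mul hK.1 hg.continuous hgc (isCompact_compactCovering M j) hB
    have hiK' := integrable_test_mul hK'.1 hg.continuous hgc (isCompact_compactCovering M j) hB
    filter_upwards [ae_restrict_of_ae (hK.transpose_ae_eq hg hgc hm.coeFn_toLp),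
      ae_restrict_of_ae (hK'.transpose_ae_eq hg hgc hm.coeFn_toLp), hiK.prod_left_ae,
      hiK'.prod_left_ae] with y h1 h2 h3 h4
    simp only [Pi.sub_apply, mul_sub, Pi.zero_apply]
    rw [integral_sub h3 h4, h1, h2, sub_self]
  filter_upwards [h0] with z hz
  exact sub_eq_zero.mp hz

end Schwartz

/-! ### The trace formula -/

section Trace

variable {EG HG G E H M : Type*} [NormedAddCommGroup EG] [NormedSpace ℝ EG]
  [FiniteDimensional ℝ EG]
  [TopologicalSpace HG] {IG : ModelWithCorners ℝ EG HG} [Group G] [TopologicalSpace G]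
  [ChartedSpace HG G] [IsManifold IG ∞ G] [IsTopologicalGroup G] [T2Space G]
  [LocallyCompactSpace G] [SecondCountableTopology G] [MeasurableSpace G] [BorelSpace G]
  {haar : Measure G} [haar.IsHaarMeasure] [haar.IsMulRightInvariant]
  [haar.InnerRegularCompactLTTop]
  [NormedAddCommGroup E] [NormedSpace ℝ E] [FiniteDimensional ℝ E]
  [TopologicalSpace H] {I : ModelWithCorners ℝ E H} [TopologicalSpace M] [ChartedSpace H M]
  [IsManifold I ∞ M] [T2Space M] [SecondCountableTopology M] [LocallyCompactSpace M]
  [MeasurableSpace M] [BorelSpace M]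
  [MulAction Gᵐᵒᵖ M] [ContinuousSMul Gᵐᵒᵖ M]
  {μ : Measure M} [SMulInvariantMeasure Gᵐᵒᵖ M μ] [IsLocallyFiniteMeasure μ]
  [μ.InnerRegularCompactLTTop]
  {ν : Measure (OrbitSpace G M)} [SigmaFinite ν] (e : MeasurableTrivialization G M)
  (hν : IsQuotientMeasure haar μ ν)

theorem MeasurableTrivialization.integral_transpose_kernel
    (hν : IsQuotientMeasure haar μ ν) (k : Lp ℂ 2 (μ.prod ν))
    (c : Lp ℂ 2 μ) (β : Lp ℂ 2 ν) {u : G → ℂ} (hu : Integrable u haar) :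
    Integrable (fun y => (∫ x, e.kernel k (x, y) * conj (c x) ∂μ) *
      (u (e.coord y) * β (toOrbit G y))) μ ∧
    ∫ y, (∫ x, e.kernel k (x, y) * conj (c x) ∂μ) * (u (e.coord y) * β (toOrbit G y)) ∂μ =
      ⟪c, rightConv haar u ((coTensorCLM β).adjoint k)⟫_ℂ := by
  obtain ⟨h1, h2⟩ := e.integral_kernel hν k c β hu
  have h3 : ∀ y, ∫ x, e.kernel k (x, y) * (conj (c x) * (u (e.coord y) * β (toOrbit G y))) ∂μ =
      (∫ x, e.kernel k (x, y) * conj (c x) ∂μ) * (u (e.coord y) * β (toOrbit G y)) := by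
    intro y
    rw [← integral_mul_const]
    simp only [mul_assoc]
  have h4 := h1.integral_prod_right
  simp only [h3] at h4
  rw [integral_prod_symm _ h1] at h2
  simp only [h3] at h2
  exact ⟨h4, h2⟩

theorem MeasurableTrivialization.inner_embed_eq_integral (w : Lp ℂ 2 μ) (β : Lp ℂ 2 ν)
    {v : G → ℂ} {u : Lp ℂ 2 haar} (hu : u =ᵐ[haar] v) :
    Integrable (fun y => conj (w y) * (v (e.coord y) * β (toOrbit G y))) μ ∧
    ∫ y, conj (w y) * (v (e.coord y) * β (toOrbit G y)) ∂μ = ⟪w, e.embed hν β u⟫_ℂ := by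
  have h1 : (fun y => ⟪w y, e.embed hν β u y⟫_ℂ) =ᵐ[μ] fun y => conj (w y) *
      (v (e.coord y) * β (toOrbit G y)) := by
    filter_upwards [e.embed_ae_eq hν β u, (e.quasiMeasurePreserving_coord hν).ae hu] with y h2 h3
    rw [RCLike.inner_apply, h2, h3, mul_comm]
  exact ⟨(L2.integrable_inner w (e.embed hν β u)).congr h1, by
    rw [L2.inner_def, integral_congr_ae h1]⟩

variable {A : Lp ℂ 2 μ →L[ℂ] Lp ℂ 2 μ}

/-- If the kernel of `A` is square-integrable over `(M × M) / G`, the components of `A` are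
convolution operators. -/
theorem MeasurableTrivialization.isConvolution_of_isSchwartzKernel (k : Lp ℂ 2 (μ.prod ν))
    {K : M × M → ℂ} (hK : IsSchwartzKernel I A K) (hKk : K =ᵐ[μ.prod μ] e.kernel k)
    (β : Lp ℂ 2 ν) :
    IsConvolution IG (A ∘L e.embed hν β) ((coTensorCLM β).adjoint k) := by
  intro v hv u hu
  refine Lp.eq_of_inner_test_eq I fun g hg hgc c hc => ?_
  have h1 := hK.transpose_ae_eq hg hgc hc
  have h2 : (fun y => ∫ x, e.kernel k (x, y) * conj (c x) ∂μ) =ᵐ[μ]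
      fun y => conj (A.adjoint c y) := by
    have h3 := Measure.ae_ae_of_ae_prod
      ((Measure.measurePreserving_swap (μ := μ) (ν := μ)).quasiMeasurePreserving.ae hKk)
    filter_upwards [h1, h3] with y h4 h5
    rw [← h4]
    refine integral_congr_ae ?_
    filter_upwards [h5, hc] with x h6 h7
    have h8 : K (x, y) = e.kernel k (x, y) := h6
    rw [h7, h8, Complex.conj_ofReal, mul_comm]
  rw [← (e.integral_transpose_kernel hν k c β hv.integrable).2, ContinuousLinearMap.comp_apply,
    ← ContinuousLinearMap.adjoint_inner_left, ← (e.inner_embed_eq_integral hν _ β hu).2]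
  refine integral_congr_ae ?_
  filter_upwards [h2] with y hy
  rw [hy]

/-- If the components of `A` are the convolution operators given by `k`, then `A` is given by the
kernel of `k`. -/
theorem MeasurableTrivialization.transpose_kernel_ae_eq (k : Lp ℂ 2 (μ.prod ν))
    (h : ∀ β, IsConvolution IG (A ∘L e.embed hν β) ((coTensorCLM β).adjoint k)) (c : Lp ℂ 2 μ) :
    (fun y => ∫ x, e.kernel k (x, y) * conj (c x) ∂μ) =ᵐ[μ] fun y => conj (A.adjoint c y) := by
  set f : M → ℂ := fun y =>
    (∫ x, e.kernel k (x, y) * conj (c x) ∂μ) - conj (A.adjoint c y) with hf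
  have hmp := e.measurePreserving hν
  have hemb := e.toMeasurableEquiv.measurableEmbedding
  set d : G × OrbitSpace G M → ℂ := fun p => f (e.toMeasurableEquiv.symm p) with hd
  have hdf : ∀ y, d (e.toMeasurableEquiv y) = f y := fun y => by
    simp only [hd, MeasurableEquiv.symm_apply_apply]
  have hey : ∀ y, e.toMeasurableEquiv y = (e.coord y, toOrbit G y) := e.apply_eq
  -- Transported to G × X, the difference is orthogonal to all u ⊗ β, so the criterion for products
  -- applies.
  suffices h0 : d =ᵐ[haar.prod ν] 0 by
    filter_upwards [hmp.quasiMeasurePreserving.ae h0] with y hy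
    rw [hdf] at hy
    exact sub_eq_zero.mp hy
  refine ae_eq_zero_of_integral_test_eq_zero IG (D := spanningSets ν)
    (measurableSet_spanningSets ν) (iUnion_spanningSets ν) (fun C hC j => ?_)
    fun j B hB hBm g hg hgc => ?_
  · have hDm := measurableSet_spanningSets ν j
    have hCm := hC.measurableSet
    rw [← hmp.integrableOn_comp_preimage hemb]
    have hu1 : Integrable (C.indicator (fun _ => (1 : ℂ))) haar :=
      (integrable_indicator_iff hCm).mpr (integrableOn_const hC.measure_lt_top.ne)
    have hu2 : MemLp (C.indicator (fun _ => (1 : ℂ))) 2 haar :=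
      memLp_indicator_const 2 hCm _ (Or.inr hC.measure_lt_top.ne)
    -- Choosing u and β to be indicators of C and of a spanning set turns the pairing formulas into
    -- integrability of d on that product.
    set β := indicatorConstLp 2 hDm (measure_spanningSets_lt_top ν j).ne (1 : ℂ) with hβ
    have h1 := (e.integral_transpose_kernel hν k c β hu1).1.sub
      (e.inner_embed_eq_integral hν (A.adjoint c) β hu2.coeFn_toLp).1
    rw [← integrable_indicator_iff (e.toMeasurableEquiv.measurable (hCm.prod hDm))]
    refine h1.congr ?_
    filter_upwards [(e.quasiMeasurePreserving_toOrbit hν).ae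
      (indicatorConstLp_coeFn (p := 2) (hs := hDm)
        (hμs := (measure_spanningSets_lt_top ν j).ne) (c := (1 : ℂ)))] with y hy
    rw [Pi.sub_apply, ← sub_mul, hβ, hy]
    by_cases h2 : y ∈ e.toMeasurableEquiv ⁻¹' (C ×ˢ spanningSets ν j)
    · rw [Set.indicator_of_mem h2, Function.comp_apply, hdf]
      rw [Set.mem_preimage, hey] at h2
      rw [Set.indicator_of_mem h2.1, Set.indicator_of_mem h2.2, mul_one, mul_one]
    · rw [Set.indicator_of_notMem h2]
      rw [Set.mem_preimage, hey] at h2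
      by_cases h3 : e.coord y ∈ C
      · rw [Set.indicator_of_notMem fun h4 => h2 ⟨h3, h4⟩, mul_zero, mul_zero]
      · rw [Set.indicator_of_notMem h3, zero_mul, mul_zero]
  · have hBfin : ν B ≠ ⊤ := ((measure_mono hB).trans_lt (measure_spanningSets_lt_top ν j)).ne
    set β := indicatorConstLp 2 hBm hBfin (1 : ℂ) with hβ
    have hgt := isTestFunction_ofReal hg hgc
    have hm : MemLp (fun x => (g x : ℂ)) 2 haar := hgt.memLp
    have h1 := e.integral_transpose_kernel hν k c β hgt.integrable
    have h2 := e.inner_embed_eq_integral hν (A.adjoint c) β hm.coeFn_toLp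
    have h3 := h β _ hgt _ hm.coeFn_toLp
    rw [← h3, ContinuousLinearMap.comp_apply, ← ContinuousLinearMap.adjoint_inner_left] at h1
    have h4 := integral_sub h1.1 h2.1
    rw [h1.2, h2.2, sub_self] at h4
    rw [← hmp.setIntegral_preimage_emb hemb, ← h4, ← integral_indicator
      (e.toMeasurableEquiv.measurable (MeasurableSet.univ.prod hBm))]
    refine integral_congr_ae ?_
    filter_upwards [(e.quasiMeasurePreserving_toOrbit hν).ae
      (indicatorConstLp_coeFn (p := 2) (hs := hBm) (hμs := hBfin) (c := (1 : ℂ)))] with y hy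
    rw [← sub_mul, hβ, hy]
    by_cases h5 : y ∈ e.toMeasurableEquiv ⁻¹' (Set.univ ×ˢ B)
    · rw [Set.indicator_of_mem h5, hdf, hey]
      rw [Set.mem_preimage, hey] at h5
      rw [Set.indicator_of_mem h5.2, mul_one, mul_comm]
    · rw [Set.indicator_of_notMem h5]
      rw [Set.mem_preimage, hey] at h5
      rw [Set.indicator_of_notMem fun h6 => h5 ⟨trivial, h6⟩, mul_zero, mul_zero]

theorem MeasurableTrivialization.isSchwartzKernel_kernel
    (hloc : ∀ x : M, ∃ W : Set M, IsOpen W ∧ x ∈ W ∧ (∀ y ∈ W, ∀ g : G, op g • y ∈ W) ∧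
      ∃ τ : M → G, ContinuousOn τ W ∧ ∀ y ∈ W, ∀ g : G, τ (op g • y) = τ y * g)
    (k : Lp ℂ 2 (μ.prod ν))
    (h : ∀ β, IsConvolution IG (A ∘L e.embed hν β) ((coTensorCLM β).adjoint k)) :
    IsSchwartzKernel I A (e.kernel k) := by
  have hK := e.locallyIntegrable_kernel hν hloc k
  refine ⟨hK, fun φ χ hφ hχ u hu => ?_⟩
  have hm : MemLp χ 2 μ := hχ.memLp
  have hc := hm.star.coeFn_toLp
  set c := hm.star.toLp _
  rw [integral_prod_symm _ (integrable_test_mul_test hK hφ hχ)]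
  have h1 : ∫ x, χ x * A u x ∂μ = ⟪c, A u⟫_ℂ := by
    rw [L2.inner_def]
    refine integral_congr_ae ?_
    filter_upwards [hc] with x hx
    rw [hx, RCLike.inner_apply, mul_comm, Pi.star_apply, RCLike.star_def, Complex.conj_conj]
  rw [h1, ← ContinuousLinearMap.adjoint_inner_left, L2.inner_def]
  refine integral_congr_ae ?_
  filter_upwards [hu, e.transpose_kernel_ae_eq hν k h c] with y h2 h3
  rw [RCLike.inner_apply, h2, ← h3, ← integral_const_mul]
  refine integral_congr_ae ?_
  filter_upwards [hc] with x hx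
  rw [hx, Pi.star_apply, RCLike.star_def, Complex.conj_conj]
  ring

/-- After pairing with a fixed vector both sides are bounded linear functionals of β that agree on a
basis. -/
theorem MeasurableTrivialization.isConvolution_of_hilbertBasis {ι : Type*}
    (ψ : HilbertBasis ι ℂ (Lp ℂ 2 ν)) (k : Lp ℂ 2 (μ.prod ν))
    (h : ∀ l, IsConvolution IG (A ∘L e.embed hν (ψ l)) ((coTensorCLM (ψ l)).adjoint k))
    (β : Lp ℂ 2 ν) : IsConvolution IG (A ∘L e.embed hν β) ((coTensorCLM β).adjoint k) := by
  intro v hv u hu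
  refine ext_inner_left ℂ fun c => ?_
  obtain ⟨L, hL⟩ := exists_clm_eq_rightConv (μ := μ) (hv.integrable (ρ := haar))
  obtain ⟨ℓ₁, hℓ₁⟩ := e.exists_clm_inner_embed hν (A.adjoint c) u
  obtain ⟨ℓ₂, hℓ₂⟩ := exists_clm_inner_coTensor (L.adjoint c) k
  have h1 : ∀ β, ℓ₁ β = ⟪c, (A ∘L e.embed hν β) u⟫_ℂ := fun β => by
    rw [hℓ₁, ContinuousLinearMap.adjoint_inner_left, ContinuousLinearMap.comp_apply]
  have h2 : ∀ β, ℓ₂ β = ⟪c, rightConv haar v ((coTensorCLM β).adjoint k)⟫_ℂ := fun β => by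
    rw [hℓ₂, ← hL, ← ContinuousLinearMap.adjoint_inner_left,
      ContinuousLinearMap.adjoint_inner_right, coTensorCLM_apply]
  rw [← h1, ← h2]
  have h3 : ℓ₁ = ℓ₂ := by
    refine ContinuousLinearMap.ext_on
      (Submodule.dense_iff_topologicalClosure_eq_top.mpr ψ.dense_span) ?_
    rintro _ ⟨l, rfl⟩
    rw [h1, h2, h l v hv u hu]
  rw [h3]

theorem MeasurableTrivialization.isEquivariant_comp_embed (hA : IsInvariantOperator G A)
    (β : Lp ℂ 2 ν) : IsEquivariant (A ∘L e.embed hν β) := fun s u => by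
  rw [ContinuousLinearMap.comp_apply, e.embed_rightTranslation, hA s,
    ContinuousLinearMap.comp_apply]

theorem MeasurableTrivialization.invariantTrace_adjoint_comp {ι : Type*}
    (ψ : HilbertBasis ι ℂ (Lp ℂ 2 ν)) :
    invariantTrace IG e hν ψ (A.adjoint ∘L A) = ∑' l, groupTrace IG
      ((A ∘L e.embed hν (ψ l)).adjoint ∘L (A ∘L e.embed hν (ψ l))) := by
  simp only [invariantTrace, ContinuousLinearMap.adjoint_comp, ContinuousLinearMap.comp_assoc]

theorem inner_coTensorCLM_hilbertBasis {ι : Type*} [DecidableEq ι]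
    (ψ : HilbertBasis ι ℂ (Lp ℂ 2 ν)) (i j : ι) (u v : Lp ℂ 2 μ) :
    ⟪coTensorCLM (ψ i) u, coTensorCLM (ψ j) v⟫_ℂ = if i = j then ⟪u, v⟫_ℂ else 0 := by
  rw [coTensorCLM_apply, coTensorCLM_apply, inner_coTensor,
    orthonormal_iff_ite.mp ψ.orthonormal j i]
  by_cases h : i = j
  · simp [h]
  · simp [h, Ne.symm h]

/-- An invariant operator with `Tr_G (A^* A) < ∞` has a square-integrable kernel. -/
theorem MeasurableTrivialization.exists_kernel_of_invariantTrace_lt_top {ι : Type*}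
    (ψ : HilbertBasis ι ℂ (Lp ℂ 2 ν)) (hA : IsInvariantOperator G A)
    (hTr : invariantTrace IG e hν ψ (A.adjoint ∘L A) < ⊤) :
    ∃ k : Lp ℂ 2 (μ.prod ν),
      (∀ β, IsConvolution IG (A ∘L e.embed hν β) ((coTensorCLM β).adjoint k)) ∧
      ‖k‖ₑ ^ 2 = invariantTrace IG e hν ψ (A.adjoint ∘L A) := by
  classical
  rw [e.invariantTrace_adjoint_comp] at hTr ⊢
  have hF : ∀ l, ∃ F, IsConvolution IG (A ∘L e.embed hν (ψ l)) F := fun l =>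
    (e.isEquivariant_comp_embed hν hA (ψ l)).exists_isConvolution_of_groupTrace_lt_top
      ((ENNReal.le_tsum l).trans_lt hTr)
  choose F hF using hF
  have hsum : ∀ l, groupTrace IG ((A ∘L e.embed hν (ψ l)).adjoint ∘L
      (A ∘L e.embed hν (ψ l))) = ‖F l‖ₑ ^ 2 := fun l =>
    (e.isEquivariant_comp_embed hν hA (ψ l)).groupTrace_eq (hF l)
  simp only [hsum] at hTr ⊢
  obtain ⟨k, hk, hkn⟩ := exists_adjoint_eq_of_summable
    (V := fun l => coTensorCLM (ρ := μ) (ψ l)) (inner_coTensorCLM_hilbertBasis ψ) hTr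
  refine ⟨k, e.isConvolution_of_hilbertBasis hν ψ k fun l => ?_, hkn⟩
  rw [hk l]
  exact hF l

/-- The slices of k along an orthonormal family satisfy Bessel's inequality. Finiteness is all that
is needed here; the exact value follows from uniqueness of the kernel. -/
theorem MeasurableTrivialization.invariantTrace_lt_top_of_kernel {ι : Type*}
    (ψ : HilbertBasis ι ℂ (Lp ℂ 2 ν)) (hA : IsInvariantOperator G A) (k : Lp ℂ 2 (μ.prod ν))
    (hk : ∀ β, IsConvolution IG (A ∘L e.embed hν β) ((coTensorCLM β).adjoint k)) :
    invariantTrace IG e hν ψ (A.adjoint ∘L A) < ⊤ := by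
  classical
  rw [e.invariantTrace_adjoint_comp]
  refine lt_of_le_of_lt (b := ENNReal.ofReal (‖k‖ ^ 2)) ?_ ENNReal.ofReal_lt_top
  rw [ENNReal.tsum_eq_iSup_sum]
  refine iSup_le fun J => ?_
  refine le_trans (le_of_eq ?_) (ENNReal.ofReal_le_ofReal
    (sum_norm_adjoint_sq_le (V := fun l => coTensorCLM (ρ := μ) (ψ l))
      (inner_coTensorCLM_hilbertBasis ψ) k J))
  rw [ENNReal.ofReal_sum_of_nonneg fun i _ => sq_nonneg _]
  refine Finset.sum_congr rfl fun l _ => ?_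
  rw [(e.isEquivariant_comp_embed hν hA (ψ l)).groupTrace_eq (hk (ψ l)),
    ENNReal.ofReal_pow (norm_nonneg _), ofReal_norm]

end Trace

/-! ### Descent of the kernel to the orbit space of `M × M` -/

section Trace

variable {EG HG G E H M : Type*} [NormedAddCommGroup EG] [NormedSpace ℝ EG]
  [FiniteDimensional ℝ EG]
  [TopologicalSpace HG] {IG : ModelWithCorners ℝ EG HG} [Group G] [TopologicalSpace G]
  [ChartedSpace HG G] [IsManifold IG ∞ G] [IsTopologicalGroup G] [T2Space G]
  [LocallyCompactSpace G] [SecondCountableTopology G] [MeasurableSpace G] [BorelSpace G]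
  {haar : Measure G} [haar.IsHaarMeasure] [haar.IsMulRightInvariant]
  [haar.InnerRegularCompactLTTop]
  [NormedAddCommGroup E] [NormedSpace ℝ E] [FiniteDimensional ℝ E]
  [TopologicalSpace H] {I : ModelWithCorners ℝ E H} [TopologicalSpace M] [ChartedSpace H M]
  [IsManifold I ∞ M] [T2Space M] [SecondCountableTopology M] [LocallyCompactSpace M]
  [MeasurableSpace M] [BorelSpace M]
  [MulAction Gᵐᵒᵖ M] [ContinuousSMul Gᵐᵒᵖ M]
  {μ : Measure M} [SMulInvariantMeasure Gᵐᵒᵖ M μ] [IsLocallyFiniteMeasure μ]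
  [μ.InnerRegularCompactLTTop]
  {ν : Measure (OrbitSpace G M)} [SigmaFinite ν] (e : MeasurableTrivialization G M)
  (hν : IsQuotientMeasure haar μ ν)

variable {ν₂ : Measure (OrbitSpace G (M × M))} {A : Lp ℂ 2 μ →L[ℂ] Lp ℂ 2 μ}

theorem MeasurableTrivialization.kernel_comp_pairEquiv (κ : OrbitSpace G (M × M) → ℂ) (z : M × M) :
    e.kernel (κ ∘ e.pairEquiv measurable_op_smul) z = κ (toOrbit G z) := by
  have h : (e.pairCoord z).2 = (e.pairEquiv measurable_op_smul).symm (toOrbit G z) :=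
    (e.pairEquiv_symm_toOrbit _ z).symm
  rw [MeasurableTrivialization.kernel, h, Function.comp_apply, MeasurableEquiv.apply_symm_apply]

/-- The set where the two kernels differ corresponds to G × {f ≠ f'}, and G has nonzero Haar
measure. -/
theorem MeasurableTrivialization.ae_eq_of_kernel_ae_eq (hν : IsQuotientMeasure haar μ ν)
    {f f' : M × OrbitSpace G M → ℂ}
    (hf : AEStronglyMeasurable f (μ.prod ν)) (hf' : AEStronglyMeasurable f' (μ.prod ν))
    (h : e.kernel f =ᵐ[μ.prod μ] e.kernel f') : f =ᵐ[μ.prod ν] f' := by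
  have hN : NullMeasurableSet {p | f p ≠ f' p} (μ.prod ν) :=
    (nullMeasurableSet_eq_fun hf.aemeasurable hf'.aemeasurable).compl
  have hmp := e.measurePreserving_pairCoord hν
  have h1 : (μ.prod μ) (e.pairCoord ⁻¹' (Set.univ ×ˢ {p | f p ≠ f' p})) = 0 := by
    refine measure_mono_null ?_ h
    rintro z ⟨-, hz⟩
    exact hz
  have h2 : NullMeasurableSet ((Set.univ : Set G) ×ˢ {p | f p ≠ f' p})
      (haar.prod (μ.prod ν)) := by
    rw [Set.univ_prod]
    exact hN.preimage Measure.quasiMeasurePreserving_snd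
  rw [hmp.measure_preimage h2, Measure.prod_prod, mul_eq_zero] at h1
  exact h1.resolve_left (NeZero.ne _)

theorem MeasurableTrivialization.exists_isSchwartzKernel_of_invariantTrace_lt_top
    (hν₂ : IsQuotientMeasure haar (μ.prod μ) ν₂)
    (hloc : ∀ x : M, ∃ W : Set M, IsOpen W ∧ x ∈ W ∧ (∀ y ∈ W, ∀ g : G, op g • y ∈ W) ∧
      ∃ τ : M → G, ContinuousOn τ W ∧ ∀ y ∈ W, ∀ g : G, τ (op g • y) = τ y * g) {ι : Type*}
    (ψ : HilbertBasis ι ℂ (Lp ℂ 2 ν)) (hA : IsInvariantOperator G A)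
    (hTr : invariantTrace IG e hν ψ (A.adjoint ∘L A) < ⊤) :
    ∃ κ : OrbitSpace G (M × M) → ℂ, MemLp κ 2 ν₂ ∧
      IsSchwartzKernel I A (fun z => κ (toOrbit G z)) ∧
      invariantTrace IG e hν ψ (A.adjoint ∘L A) = ∫⁻ q, ‖κ q‖ₑ ^ 2 ∂ν₂ := by
  obtain ⟨k, hk, hkn⟩ := e.exists_kernel_of_invariantTrace_lt_top hν ψ hA hTr
  have hmp := (e.measurePreserving_pairEquiv hν hν₂ measurable_op_smul).symm
  refine ⟨k ∘ (e.pairEquiv measurable_op_smul).symm, (Lp.memLp k).comp_measurePreserving hmp,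
    ?_, ?_⟩
  · convert e.isSchwartzKernel_kernel (I := I) hν hloc k hk using 2 with z
    rw [← e.kernel_comp_pairEquiv (k ∘ (e.pairEquiv measurable_op_smul).symm) z]
    congr 1
    funext p
    simp
  · rw [← hkn, ← Lp.lintegral_enorm_sq]
    exact (hmp.lintegral_comp_emb (e.pairEquiv measurable_op_smul).symm.measurableEmbedding
      fun p => ‖k p‖ₑ ^ 2).symm

/-- If the trace is finite, the kernel constructed from it has the right norm and agrees with κ by
uniqueness. If it is infinite, κ cannot be square-integrable, since that would force a finite trace.
-/
theorem MeasurableTrivialization.invariantTrace_eq_lintegral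
    (hν₂ : IsQuotientMeasure haar (μ.prod μ) ν₂)
    (hloc : ∀ x : M, ∃ W : Set M, IsOpen W ∧ x ∈ W ∧ (∀ y ∈ W, ∀ g : G, op g • y ∈ W) ∧
      ∃ τ : M → G, ContinuousOn τ W ∧ ∀ y ∈ W, ∀ g : G, τ (op g • y) = τ y * g) {ι : Type*}
    (ψ : HilbertBasis ι ℂ (Lp ℂ 2 ν)) (hA : IsInvariantOperator G A)
    {κ : OrbitSpace G (M × M) → ℂ} (hκ : AEStronglyMeasurable κ ν₂)
    (hK : IsSchwartzKernel I A (fun z => κ (toOrbit G z))) :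
    invariantTrace IG e hν ψ (A.adjoint ∘L A) = ∫⁻ q, ‖κ q‖ₑ ^ 2 ∂ν₂ := by
  have hmp := e.measurePreserving_pairEquiv hν hν₂ measurable_op_smul
  by_cases hTr : invariantTrace IG e hν ψ (A.adjoint ∘L A) < ⊤
  · obtain ⟨κ', hκ', hK', hTr'⟩ :=
      e.exists_isSchwartzKernel_of_invariantTrace_lt_top (I := I) hν hν₂ hloc ψ hA hTr
    rw [hTr']
    have h1 : e.kernel (κ ∘ e.pairEquiv measurable_op_smul) =ᵐ[μ.prod μ]
        e.kernel (κ' ∘ e.pairEquiv measurable_op_smul) := by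
      filter_upwards [hK.ae_eq hK'] with z hz
      rw [e.kernel_comp_pairEquiv, e.kernel_comp_pairEquiv]
      exact hz
    have h2 := e.ae_eq_of_kernel_ae_eq hν (hκ.comp_measurePreserving hmp)
      (hκ'.1.comp_measurePreserving hmp) h1
    rw [← hmp.lintegral_comp_emb (e.pairEquiv measurable_op_smul).measurableEmbedding,
      ← hmp.lintegral_comp_emb (e.pairEquiv measurable_op_smul).measurableEmbedding]
    refine lintegral_congr_ae ?_
    filter_upwards [h2] with p hp
    have hp' : κ (e.pairEquiv measurable_op_smul p) = κ' (e.pairEquiv measurable_op_smul p) := hp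
    rw [hp']
  · rw [not_lt_top_iff.mp hTr]
    by_contra hne
    have hfin : ∫⁻ q, ‖κ q‖ₑ ^ 2 ∂ν₂ < ⊤ := lt_top_iff_ne_top.mpr (Ne.symm hne)
    have hmem : MemLp κ 2 ν₂ := by
      refine ⟨hκ, ?_⟩
      rw [eLpNorm_lt_top_iff_lintegral_rpow_enorm_lt_top two_ne_zero ENNReal.ofNat_ne_top]
      simpa only [ENNReal.toReal_ofNat, ENNReal.rpow_two] using hfin
    have hkm := hmem.comp_measurePreserving hmp
    have hKk : (fun z => κ (toOrbit G z)) =ᵐ[μ.prod μ] e.kernel (hkm.toLp _) := by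
      filter_upwards [(e.quasiMeasurePreserving_pairCoord_snd hν).ae hkm.coeFn_toLp] with z hz
      rw [← e.kernel_comp_pairEquiv κ z]
      exact hz.symm
    exact hTr (e.invariantTrace_lt_top_of_kernel hν ψ hA (hkm.toLp _)
      (e.isConvolution_of_isSchwartzKernel hν (hkm.toLp _) hK hKk))

end Trace

/-! ### Hilbert–Schmidt estimates -/

section HilbertSchmidt

variable {ι ι' E F : Type*} [NormedAddCommGroup E] [InnerProductSpace ℂ E] [CompleteSpace E]
  [NormedAddCommGroup F] [InnerProductSpace ℂ F] [CompleteSpace F]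

theorem enorm_sq_eq_tsum_inner (b : HilbertBasis ι ℂ E) (x : E) :
    ‖x‖ₑ ^ 2 = ∑' i, ‖⟪b i, x⟫_ℂ‖ₑ ^ 2 := by
  have h2 : ‖b.repr x‖ ^ 2 = ∑' i, ‖b.repr x i‖ ^ 2 := by
    have := lp.norm_rpow_eq_tsum (p := 2) (by norm_num) (b.repr x)
    simpa using this
  have hs : Summable fun i => ‖b.repr x i‖ ^ 2 := by
    have := (lp.memℓp (b.repr x)).summable (by norm_num)
    simpa using this
  rw [← ofReal_norm, ← ENNReal.ofReal_pow (norm_nonneg _), ← b.repr.norm_map, h2,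
    ENNReal.ofReal_tsum_of_nonneg (fun i => sq_nonneg _) hs]
  refine tsum_congr fun i => ?_
  rw [b.repr_apply_apply, ENNReal.ofReal_pow (norm_nonneg _), ofReal_norm]

/-- Both sides are the double sum of |⟪h i, S (b j)⟫|², the squared Hilbert–Schmidt norm. -/
theorem tsum_enorm_adjoint_sq (S : E →L[ℂ] F) (b : HilbertBasis ι ℂ E) (h : HilbertBasis ι' ℂ F) :
    ∑' i, ‖S.adjoint (h i)‖ₑ ^ 2 = ∑' j, ‖S (b j)‖ₑ ^ 2 := by
  simp only [enorm_sq_eq_tsum_inner b (S.adjoint _), enorm_sq_eq_tsum_inner h (S _)]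
  rw [ENNReal.tsum_comm]
  refine tsum_congr fun j => tsum_congr fun i => ?_
  rw [ContinuousLinearMap.adjoint_inner_right, ← ofReal_norm, ← ofReal_norm, norm_inner_symm]

/-- Basis vectors are at distance √2, so balls of radius 1/2 around them are disjoint. Countability
later allows a sum over a basis to be exchanged with an integral over G. -/
theorem HilbertBasis.countable [TopologicalSpace.SeparableSpace E] (b : HilbertBasis ι ℂ E) :
    Countable ι := by
  refine Pairwise.countable_of_isOpen_disjoint (s := fun i => Metric.ball (b i) 2⁻¹)
    (fun i j hij => ?_) (fun i => Metric.isOpen_ball) fun i => Metric.nonempty_ball.mpr (by norm_num)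
  refine Metric.ball_disjoint_ball ?_
  have h1 : ‖b i - b j‖ ^ 2 = 2 := by
    have h2 := norm_sub_sq (𝕜 := ℂ) (b i) (b j)
    rw [b.orthonormal.2 hij, b.orthonormal.1, b.orthonormal.1] at h2
    rw [h2]
    norm_num
  rw [dist_eq_norm]
  nlinarith [norm_nonneg (b i - b j)]

variable {α : Type*} [MeasurableSpace α] {ρ : Measure α}

theorem Lp.coeFn_sum_smul (J : Finset ι) (a : ι → ℂ) (f : ι → Lp ℂ 2 ρ) :
    (∑ j ∈ J, a j • f j : Lp ℂ 2 ρ) =ᵐ[ρ] fun x => ∑ j ∈ J, a j * f j x := by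
  classical
  induction J using Finset.induction_on with
  | empty =>
    filter_upwards [Lp.coeFn_zero ℂ 2 ρ] with x hx
    simpa using hx
  | insert i J hi ih =>
    rw [Finset.sum_insert hi]
    filter_upwards [ih, Lp.coeFn_add (a i • f i) (∑ j ∈ J, a j • f j),
      Lp.coeFn_smul (a i) (f i)] with x h1 h2 h3
    rw [h2, Pi.add_apply, h1, h3, Pi.smul_apply, smul_eq_mul, Finset.sum_insert hi]

theorem Orthonormal.norm_sum_smul_sq {b : ι → E} (hb : Orthonormal ℂ b) (J : Finset ι)
    (a : ι → ℂ) : ‖∑ j ∈ J, a j • b j‖ ^ 2 = ∑ j ∈ J, ‖a j‖ ^ 2 := by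
  have h1 := hb.inner_sum a a J
  rw [inner_self_eq_norm_sq_to_K] at h1
  have h2 : ((‖∑ j ∈ J, a j • b j‖ ^ 2 : ℝ) : ℂ) = ((∑ j ∈ J, ‖a j‖ ^ 2 : ℝ) : ℂ) := by
    push_cast
    refine h1.trans (Finset.sum_congr rfl fun j _ => ?_)
    rw [Complex.conj_mul']
  exact Complex.ofReal_injective h2

/-- An operator into `L²` of a finite measure with values in bounded functions is
Hilbert–Schmidt. -/
theorem tsum_enorm_sq_le_of_bounded {b : ι → E} (hb : Orthonormal ℂ b) (S : E →L[ℂ] Lp ℂ 2 ρ)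
    {c : ℝ} (hS : ∀ u, ∀ᵐ x ∂ρ, ‖S u x‖ ≤ c * ‖u‖) :
    ∑' j, ‖S (b j)‖ₑ ^ 2 ≤ ENNReal.ofReal (c ^ 2) * ρ Set.univ := by
  rw [ENNReal.tsum_eq_iSup_sum]
  refine iSup_le fun J => ?_
  have h1 : ∀ a : J → ℂ, ∀ᵐ x ∂ρ, ‖∑ j, a j * S (b j) x‖ ^ 2 ≤ c ^ 2 * ∑ j, ‖a j‖ ^ 2 := by
    intro a
    have hbJ : Orthonormal ℂ fun j : J => b j := hb.comp _ Subtype.val_injective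
    filter_upwards [hS (∑ j, a j • b j), Lp.coeFn_sum_smul Finset.univ a fun j : J => S (b j)]
      with x h2 h3
    rw [map_sum] at h2
    simp only [map_smul] at h2
    rw [h3] at h2
    rw [← Orthonormal.norm_sum_smul_sq hbJ Finset.univ a, ← mul_pow]
    exact pow_le_pow_left₀ (norm_nonneg _) h2 2
  -- The exceptional null set depends on the coefficients a; a countable dense set of them gives one
  -- null set, and continuity in a gives all the others.
  have h2 : ∀ᵐ x ∂ρ, ∀ n, ‖∑ j, TopologicalSpace.denseSeq (J → ℂ) n j * S (b j) x‖ ^ 2 ≤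
      c ^ 2 * ∑ j, ‖TopologicalSpace.denseSeq (J → ℂ) n j‖ ^ 2 :=
    ae_all_iff.mpr fun n => h1 _
  have h3 : ∀ᵐ x ∂ρ, ∑ j ∈ J, ‖S (b j) x‖ₑ ^ 2 ≤ ENNReal.ofReal (c ^ 2) := by
    filter_upwards [h2] with x hx
    have h4 : ∀ a : J → ℂ, ‖∑ j, a j * S (b j) x‖ ^ 2 ≤ c ^ 2 * ∑ j, ‖a j‖ ^ 2 := by
      intro a
      refine (TopologicalSpace.denseRange_denseSeq (J → ℂ)).induction_on
        (p := fun a : J → ℂ => ‖∑ j, a j * S (b j) x‖ ^ 2 ≤ c ^ 2 * ∑ j, ‖a j‖ ^ 2) a ?_ hx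
      exact isClosed_le (by fun_prop) (by fun_prop)
    -- With these coefficients the inequality reads s² ≤ c² s, hence s ≤ c².
    have h5 := h4 fun j => conj (S (b j) x)
    set s := ∑ j ∈ J, ‖S (b j) x‖ ^ 2 with hs
    have h6 : ∑ j : J, conj (S (b j) x) * S (b j) x = (s : ℂ) := by
      rw [hs, ← Finset.sum_coe_sort J fun j => ‖S (b j) x‖ ^ 2]
      push_cast
      exact Finset.sum_congr rfl fun j _ => Complex.conj_mul' _
    have h7 : ∑ j : J, ‖conj (S (b j) x)‖ ^ 2 = s := by
      rw [hs, ← Finset.sum_coe_sort J fun j => ‖S (b j) x‖ ^ 2]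
      exact Finset.sum_congr rfl fun j _ => by rw [RCLike.norm_conj]
    have hs0 : 0 ≤ s := Finset.sum_nonneg fun j _ => sq_nonneg _
    rw [h6, h7, Complex.norm_real, Real.norm_of_nonneg hs0] at h5
    have h8 : s ≤ c ^ 2 := by
      rcases hs0.eq_or_lt with h0 | h0
      · rw [← h0]
        positivity
      · exact le_of_mul_le_mul_right (by rwa [← sq]) h0
    refine le_trans (le_of_eq ?_) (ENNReal.ofReal_le_ofReal h8)
    rw [hs, ENNReal.ofReal_sum_of_nonneg fun i _ => sq_nonneg _]
    exact Finset.sum_congr rfl fun j _ => by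
      rw [ENNReal.ofReal_pow (norm_nonneg _), ofReal_norm]
  calc ∑ j ∈ J, ‖S (b j)‖ₑ ^ 2 = ∫⁻ x, ∑ j ∈ J, ‖S (b j) x‖ₑ ^ 2 ∂ρ := by
        rw [lintegral_finsetSum' _ fun j _ => (Lp.aestronglyMeasurable _).enorm.pow_const 2]
        exact Finset.sum_congr rfl fun j _ => (Lp.lintegral_enorm_sq _).symm
    _ ≤ ∫⁻ _, ENNReal.ofReal (c ^ 2) ∂ρ := lintegral_mono_ae h3
    _ = _ := lintegral_const _

end HilbertSchmidt

/-- Uniform boundedness: an operator with values in functions bounded near `x₀`. -/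
theorem exists_nhds_bound_of_forall {E M : Type*} [NormedAddCommGroup E] [NormedSpace ℂ E]
    [CompleteSpace E] [TopologicalSpace M] [FirstCountableTopology M] [MeasurableSpace M]
    {μ : Measure M} (P : E →L[ℂ] Lp ℂ 2 μ) (x₀ : M)
    (h : ∀ u, ∃ N ∈ 𝓝 x₀, ∃ C : ℝ, ∀ᵐ x ∂μ, x ∈ N → ‖P u x‖ ≤ C) :
    ∃ N ∈ 𝓝 x₀, ∃ c : ℝ, 0 ≤ c ∧ ∀ u, ∀ᵐ x ∂μ, x ∈ N → ‖P u x‖ ≤ c * ‖u‖ := by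
  obtain ⟨N, hN⟩ := (𝓝 x₀).exists_antitone_basis
  -- Baire's theorem for the sets on which a given neighbourhood and bound work. They are closed
  -- because an L²-convergent sequence has an almost everywhere convergent subsequence.
  set F : ℕ × ℕ → Set E := fun p => {u | ∀ᵐ x ∂μ, x ∈ N p.1 → ‖P u x‖ ≤ p.2} with hF
  have hclosed : ∀ p, IsClosed (F p) := by
    intro p
    refine IsSeqClosed.isClosed fun u v hu huv => ?_
    have h1 : Tendsto (fun n => P (u n)) atTop (𝓝 (P v)) := (P.continuous.tendsto v).comp huv
    obtain ⟨ns, -, hns⟩ := (tendstoInMeasure_of_tendsto_Lp h1).exists_seq_tendsto_ae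
    have h2 : ∀ᵐ x ∂μ, ∀ n, x ∈ N p.1 → ‖P (u n) x‖ ≤ p.2 := ae_all_iff.mpr hu
    filter_upwards [hns, h2] with x h3 h4 hx
    exact le_of_tendsto' h3.norm fun n => h4 _ hx
  have hU : ⋃ p, F p = Set.univ := by
    refine Set.eq_univ_of_forall fun u => Set.mem_iUnion.mpr ?_
    obtain ⟨N', hN', C, hC⟩ := h u
    obtain ⟨i, -, hi⟩ := hN.1.mem_iff.mp hN'
    obtain ⟨k, hk⟩ := exists_nat_ge C
    refine ⟨(i, k), ?_⟩
    filter_upwards [hC] with x hx hxN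
    exact (hx (hi hxN)).trans hk
  obtain ⟨⟨i, k⟩, u₀, hu₀⟩ := nonempty_interior_of_iUnion_of_closed hclosed hU
  obtain ⟨r, hr, hball⟩ := Metric.mem_nhds_iff.mp (mem_interior_iff_mem_nhds.mp hu₀)
  refine ⟨N i, hN.1.mem_of_mem trivial, 4 * k / r, by positivity, fun u => ?_⟩
  rcases eq_or_ne u 0 with rfl | hu
  · rw [map_zero, norm_zero, mul_zero]
    filter_upwards [Lp.coeFn_zero ℂ 2 μ] with x hx _
    rw [hx]
    simp
  have hun : 0 < ‖u‖ := norm_pos_iff.mpr hu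
  -- The multiple t u has norm r/2, so u₀ + t u stays in the ball; subtracting u₀ gives t |P u| ≤ 2k
  -- and thus the constant 4k/r.
  set t : ℝ := r / (2 * ‖u‖) with ht
  have htp : 0 < t := by positivity
  have h1 : u₀ + (t : ℂ) • u ∈ F (i, k) := by
    refine hball ?_
    rw [Metric.mem_ball, dist_eq_norm, add_sub_cancel_left, norm_smul, Complex.norm_real,
      Real.norm_of_nonneg htp.le, ht]
    have : r / (2 * ‖u‖) * ‖u‖ = r / 2 := by field_simp
    rw [this]
    linarith
  have h2 : u₀ ∈ F (i, k) := hball (Metric.mem_ball_self hr)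
  have h3 : P (u₀ + (t : ℂ) • u) = P u₀ + (t : ℂ) • P u := by rw [map_add, map_smul]
  rw [hF, Set.mem_ofPred_eq, h3] at h1
  filter_upwards [h1, h2, Lp.coeFn_add (P u₀) ((t : ℂ) • P u), Lp.coeFn_smul (t : ℂ) (P u)]
    with x h4 h5 h6 h7 hx
  have h8 := h4 hx
  have h9 := h5 hx
  rw [h6, Pi.add_apply, h7, Pi.smul_apply, smul_eq_mul] at h8
  have h10 : ‖(t : ℂ) * P u x‖ ≤ 2 * k := by
    have h11 := norm_sub_le (P u₀ x + (t : ℂ) * P u x) (P u₀ x)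
    rw [add_sub_cancel_left] at h11
    linarith
  rw [norm_mul, Complex.norm_real, Real.norm_of_nonneg htp.le, ht] at h10
  have h12 : 4 * k / r * ‖u‖ = 2 * k / (r / (2 * ‖u‖)) := by
    field_simp
    ring
  rw [h12, le_div_iff₀ (by positivity), mul_comm]
  exact h10

/-! ### Invariant operators with locally bounded values -/

/-- Cauchy–Schwarz against the constant 1 for the probability measure with density w. -/
theorem sq_lintegral_mul_le {α : Type*} [MeasurableSpace α] {ρ : Measure α} {w f : α → ℝ≥0∞}
    (hw : Measurable w) (hf : Measurable f) (hw1 : ∫⁻ a, w a ∂ρ = 1) :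
    (∫⁻ a, w a * f a ∂ρ) ^ 2 ≤ ∫⁻ a, w a * f a ^ 2 ∂ρ := by
  have h := ENNReal.lintegral_mul_le_Lp_mul_Lq (ρ.withDensity w) Real.HolderConjugate.two_two
    hf.aemeasurable (measurable_one : Measurable (1 : α → ℝ≥0∞)).aemeasurable
  rw [lintegral_withDensity_eq_lintegral_mul _ hw (hf.mul measurable_one),
    lintegral_withDensity_eq_lintegral_mul _ hw (hf.pow_const _),
    lintegral_withDensity_eq_lintegral_mul _ hw (measurable_one.pow_const _)] at h
  simp only [Pi.mul_apply, Pi.one_apply, mul_one, ENNReal.one_rpow, hw1] at h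
  have h2 := pow_le_pow_left₀ bot_le h 2
  rw [← ENNReal.rpow_two, ← ENNReal.rpow_two, ← ENNReal.rpow_mul] at h2
  simpa using h2

section Bounded

variable {EG HG G M : Type*} [NormedAddCommGroup EG] [NormedSpace ℝ EG]
  [FiniteDimensional ℝ EG]
  [TopologicalSpace HG] {IG : ModelWithCorners ℝ EG HG} [Group G] [TopologicalSpace G]
  [ChartedSpace HG G] [IsManifold IG ∞ G] [IsTopologicalGroup G] [T2Space G]
  [LocallyCompactSpace G] [SecondCountableTopology G] [MeasurableSpace G] [BorelSpace G]
  {haar : Measure G} [haar.IsHaarMeasure] [haar.IsMulRightInvariant]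
  [haar.InnerRegularCompactLTTop]
  [TopologicalSpace M] [T2Space M] [SecondCountableTopology M] [LocallyCompactSpace M]
  [MeasurableSpace M] [BorelSpace M]
  [MulAction Gᵐᵒᵖ M] [ContinuousSMul Gᵐᵒᵖ M]
  {μ : Measure M} [SMulInvariantMeasure Gᵐᵒᵖ M μ] [IsLocallyFiniteMeasure μ]
  [μ.InnerRegularCompactLTTop]

/-- Compactness of the base reduces this to a neighbourhood of one orbit. If N' V ⊆ C with V a
neighbourhood of 1, an orbit meeting N' spends in C at least the Haar measure of V, by left
invariance. -/
theorem exists_set_forall_bound [CompactSpace (OrbitSpace G M)] (haar : Measure G)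
    [haar.IsHaarMeasure] {E : Type*} [NormedAddCommGroup E] [NormedSpace ℂ E]
    (P : E →L[ℂ] Lp ℂ 2 μ)
    (h : ∀ x₀, ∃ N ∈ 𝓝 x₀, ∃ c : ℝ, 0 ≤ c ∧ ∀ u, ∀ᵐ x ∂μ, x ∈ N → ‖P u x‖ ≤ c * ‖u‖) :
    ∃ C, MeasurableSet C ∧ μ C < ⊤ ∧
      (∃ c : ℝ, 0 ≤ c ∧ ∀ u, ∀ᵐ x ∂μ, x ∈ C → ‖P u x‖ ≤ c * ‖u‖) ∧
      ∃ c₀ : ℝ≥0∞, c₀ ≠ 0 ∧ ∀ x : M, c₀ ≤ haar {t | op t • x ∈ C} := by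
  have key := (isCompact_univ (X := OrbitSpace G M)).induction_on
    (p := fun Q => ∃ C, MeasurableSet C ∧ μ C < ⊤ ∧
      (∃ c : ℝ, 0 ≤ c ∧ ∀ u, ∀ᵐ x ∂μ, x ∈ C → ‖P u x‖ ≤ c * ‖u‖) ∧
      ∃ c₀ : ℝ≥0∞, c₀ ≠ 0 ∧ ∀ x : M, toOrbit G x ∈ Q → c₀ ≤ haar {t | op t • x ∈ C})
    ?_ ?_ ?_ ?_
  · obtain ⟨C, h1, h2, h3, c₀, h4, h5⟩ := key
    exact ⟨C, h1, h2, h3, c₀, h4, fun x => h5 x trivial⟩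
  · exact ⟨∅, MeasurableSet.empty, by simp, ⟨0, le_rfl, fun u => by simp⟩, 1, one_ne_zero,
      fun x hx => hx.elim⟩
  · rintro Q Q' hQ ⟨C, h1, h2, h3, c₀, h4, h5⟩
    exact ⟨C, h1, h2, h3, c₀, h4, fun x hx => h5 x (hQ hx)⟩
  · rintro Q Q' ⟨C, h1, h2, ⟨c, hc, h3⟩, c₀, h4, h5⟩ ⟨C', h1', h2', ⟨c', hc', h3'⟩, c₀', h4', h5'⟩
    refine ⟨C ∪ C', h1.union h1', measure_union_lt_top h2 h2',
      ⟨max c c', le_max_of_le_left hc, fun u => ?_⟩, min c₀ c₀', ?_, ?_⟩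
    · filter_upwards [h3 u, h3' u] with x h6 h7 hx
      rcases hx with hx | hx
      · exact (h6 hx).trans (mul_le_mul_of_nonneg_right (le_max_left _ _) (norm_nonneg _))
      · exact (h7 hx).trans (mul_le_mul_of_nonneg_right (le_max_right _ _) (norm_nonneg _))
    · rcases min_choice c₀ c₀' with h | h <;> rw [h] <;> assumption
    · rintro x (hx | hx)
      · exact (min_le_left _ _).trans ((h5 x hx).trans
          (measure_mono fun t ht => Set.mem_union_left _ ht))
      · exact (min_le_right _ _).trans ((h5' x hx).trans
          (measure_mono fun t ht => Set.mem_union_right _ ht))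
  · intro q _
    obtain ⟨x₀, rfl⟩ := Quotient.exists_rep q
    obtain ⟨N, hN, c, hc, hb⟩ := h x₀
    obtain ⟨N₁, hN₁x, hN₁o, hN₁⟩ := μ.exists_isOpen_measure_lt_top x₀
    set C := interior N ∩ N₁ with hC
    have hCo : IsOpen C := isOpen_interior.inter hN₁o
    have hCx : x₀ ∈ C := ⟨mem_interior_iff_mem_nhds.mpr hN, hN₁x⟩
    have hcont : Continuous fun p : M × G => op p.2 • p.1 := by fun_prop
    have hpre : (fun p : M × G => op p.2 • p.1) ⁻¹' C ∈ 𝓝 (x₀, (1 : G)) := by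
      refine (hCo.preimage hcont).mem_nhds ?_
      rw [Set.mem_preimage, op_one, one_smul]
      exact hCx
    obtain ⟨N', V, hN'o, hN'x, hVo, hV1, hNV⟩ := mem_nhds_prod_iff'.mp hpre
    refine ⟨toOrbit G '' N', ?_, C, hCo.measurableSet,
      (measure_mono Set.inter_subset_right).trans_lt hN₁, ⟨c, hc, fun u => ?_⟩, haar V,
      (hVo.measure_pos haar ⟨1, hV1⟩).ne', ?_⟩
    · rw [nhdsWithin_univ]
      have hopen : IsOpenMap (toOrbit G : M → OrbitSpace G M) := isOpenMap_quotient_mk'_mul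
      exact (hopen _ hN'o).mem_nhds ⟨x₀, hN'x, rfl⟩
    · filter_upwards [hb u] with x hx hxC
      exact hx (interior_subset hxC.1)
    · rintro x ⟨y, hy, hyx⟩
      obtain ⟨g, rfl⟩ := exists_smul_eq_of_toOrbit_eq hyx.symm
      rw [← measure_preimage_mul haar g V]
      refine measure_mono fun t ht => ?_
      have h6 := hNV (Set.mk_mem_prod hy ht)
      rw [Set.mem_preimage] at h6
      rwa [Set.mem_ofPred_eq, smul_smul, ← op_mul]

/-- By Tonelli and invariance the right-hand side is the integral of |v(y)|² times the time the
orbit of y spends in C. -/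
theorem mul_enorm_sq_le_lintegral {C : Set M} (hC : MeasurableSet C) {c₀ : ℝ≥0∞}
    (hc₀ : ∀ x : M, c₀ ≤ haar {t | op t • x ∈ C}) (v : Lp ℂ 2 μ) :
    c₀ * ‖v‖ₑ ^ 2 ≤ ∫⁻ t : G, ∫⁻ x in C, ‖rightTranslation μ t⁻¹ v x‖ₑ ^ 2 ∂μ ∂haar := by
  have h1 : ∀ t : G, ∫⁻ x in C, ‖rightTranslation μ t⁻¹ v x‖ₑ ^ 2 ∂μ =
      ∫⁻ y, C.indicator 1 (op t • y) * ‖v y‖ₑ ^ 2 ∂μ := by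
    intro t
    rw [← lintegral_indicator hC, ← (measurePreserving_smul (op t) μ).lintegral_comp_emb
      (measurableEmbedding_const_smul (op t))]
    refine lintegral_congr_ae ?_
    filter_upwards [(measurePreserving_smul (op t) μ).quasiMeasurePreserving.ae
      (rightTranslation_ae_eq t⁻¹ v)] with y hy
    by_cases h2 : op t • y ∈ C
    · rw [Set.indicator_of_mem h2, Set.indicator_of_mem h2, hy, smul_smul, ← op_mul,
        mul_inv_cancel, op_one, one_smul, Pi.one_apply, one_mul]
    · rw [Set.indicator_of_notMem h2, Set.indicator_of_notMem h2, zero_mul]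
  have hsm : Measurable fun p : G × M => op p.1 • p.2 :=
    (measurable_op_smul (G := G) (M := M)).comp measurable_swap
  have hm : AEMeasurable (fun p : G × M => C.indicator (1 : M → ℝ≥0∞) (op p.1 • p.2) *
      ‖v p.2‖ₑ ^ 2) (haar.prod μ) :=
    ((measurable_one.indicator hC).comp hsm).aemeasurable.mul
      ((Lp.aestronglyMeasurable v).comp_snd.enorm.pow_const 2)
  simp only [h1]
  rw [lintegral_lintegral_swap hm, ← Lp.lintegral_enorm_sq, ← lintegral_const_mul'' _
    ((Lp.aestronglyMeasurable v).enorm.pow_const 2)]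
  refine lintegral_mono fun y => ?_
  have h3 : Measurable fun s : G => op s • y := hsm.comp (measurable_id.prodMk measurable_const)
  have h4 : Measurable fun s : G => C.indicator (1 : M → ℝ≥0∞) (op s • y) :=
    (measurable_one.indicator hC).comp h3
  rw [lintegral_mul_const _ h4]
  exact mul_le_mul_left ((hc₀ y).trans_eq (lintegral_indicator_one (h3 hC)).symm) _

/-- Young's inequality for convolution with a probability density. -/
theorem lintegral_inner_rightTranslation_le {φ : G → ℝ} (hφ : Continuous φ)
    (hφi : Integrable φ haar) (hφ0 : ∀ s, 0 ≤ φ s) (hφ1 : ∫ s, φ s ∂haar = 1)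
    {u : Lp ℂ 2 haar} (hu : u =ᵐ[haar] fun s => (φ s : ℂ)) (g : Lp ℂ 2 haar) :
    ∫⁻ t, ‖⟪g, rightTranslation haar t⁻¹ u⟫_ℂ‖ₑ ^ 2 ∂haar ≤ ‖g‖ₑ ^ 2 := by
  obtain ⟨g', hg', hgg'⟩ := Lp.aestronglyMeasurable g
  set w : G → ℝ≥0∞ := fun s => ENNReal.ofReal (φ s) with hw
  have hwm : Measurable w := hφ.measurable.ennreal_ofReal
  have hw1 : ∫⁻ s, w s ∂haar = 1 := by
    rw [hw, ← ofReal_integral_eq_lintegral_ofReal hφi (.of_forall hφ0), hφ1, ENNReal.ofReal_one]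
  have hgm : Measurable fun p : G × G => ‖g' (p.1 * p.2)‖ₑ :=
    (hg'.measurable.comp measurable_mul).enorm
  -- The pairing is the average of conj g(r t) over r with probability density φ.
  have h1 : ∀ t, ‖⟪g, rightTranslation haar t⁻¹ u⟫_ℂ‖ₑ ^ 2 ≤
      ∫⁻ r, w r * ‖g' (r * t)‖ₑ ^ 2 ∂haar := by
    intro t
    have hgt : Measurable fun r => ‖g' (r * t)‖ₑ := hgm.comp (measurable_id.prodMk measurable_const)
    refine le_trans ?_ (sq_lintegral_mul_le hwm hgt hw1)
    refine pow_le_pow_left₀ bot_le ?_ 2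
    rw [← inner_rightTranslation_left, L2.inner_def]
    refine (enorm_integral_le_lintegral_enorm _).trans_eq (lintegral_congr_ae ?_)
    filter_upwards [hu, rightTranslation_ae_eq t g,
      (measurePreserving_smul (op t) haar).quasiMeasurePreserving.ae hgg'] with r h2 h3 h4
    have h5 : g (op t • r) = g' (r * t) := h4
    rw [RCLike.inner_apply, h2, h3, h5, enorm_mul, RCLike.enorm_conj, ← ofReal_norm,
      Complex.norm_real, Real.norm_of_nonneg (hφ0 r)]
  have hm : AEMeasurable (fun p : G × G => w p.2 * ‖g' (p.2 * p.1)‖ₑ ^ 2) (haar.prod haar) :=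
    ((hwm.comp measurable_snd).mul ((hgm.comp measurable_swap).pow_const 2)).aemeasurable
  calc ∫⁻ t, ‖⟪g, rightTranslation haar t⁻¹ u⟫_ℂ‖ₑ ^ 2 ∂haar
      ≤ ∫⁻ t, ∫⁻ r, w r * ‖g' (r * t)‖ₑ ^ 2 ∂haar ∂haar := lintegral_mono h1
    _ = ∫⁻ r, ∫⁻ t, w r * ‖g' (r * t)‖ₑ ^ 2 ∂haar ∂haar := lintegral_lintegral_swap hm
    _ = ∫⁻ r, w r * ‖g‖ₑ ^ 2 ∂haar := by
        refine lintegral_congr fun r => ?_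
        rw [lintegral_const_mul' _ _ ENNReal.ofReal_ne_top,
          lintegral_mul_left_eq_self (fun t => ‖g' t‖ₑ ^ 2) r, ← Lp.lintegral_enorm_sq]
        congr 1
        refine lintegral_congr_ae ?_
        filter_upwards [hgg'] with t ht
        rw [ht]
    _ = ‖g‖ₑ ^ 2 := by rw [lintegral_mul_const _ hwm, hw1, one_mul]

variable {ν : Measure (OrbitSpace G M)} [SigmaFinite ν] (e : MeasurableTrivialization G M)
  (hν : IsQuotientMeasure haar μ ν) {P : Lp ℂ 2 μ →L[ℂ] Lp ℂ 2 μ}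

/-- Averaging over translates replaces P by its restriction S to C, at the price of translating u.
Expanding in a basis f of L²(C), Young's inequality removes u from each coefficient, and Bessel's
inequality over l leaves ∑ ‖S* f i‖², the Hilbert–Schmidt norm of S. The bound depends neither on
the approximate identity nor on J. -/
theorem MeasurableTrivialization.mul_sum_enorm_sq_le {ι : Type*}
    (ψ : HilbertBasis ι ℂ (Lp ℂ 2 ν)) (hP : IsInvariantOperator G P) {C : Set M}
    (hC : MeasurableSet C) {c : ℝ}
    (hb : ∀ u, ∀ᵐ x ∂μ, x ∈ C → ‖P u x‖ ≤ c * ‖u‖) {c₀ : ℝ≥0∞}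
    (hc₀ : ∀ x : M, c₀ ≤ haar {t | op t • x ∈ C}) {φ : G → ℝ} (hφ : Continuous φ)
    (hφi : Integrable φ haar) (hφ0 : ∀ s, 0 ≤ φ s) (hφ1 : ∫ s, φ s ∂haar = 1)
    {u : Lp ℂ 2 haar} (hu : u =ᵐ[haar] fun s => (φ s : ℂ)) (J : Finset ι) :
    c₀ * ∑ l ∈ J, ‖P (e.embed hν (ψ l) u)‖ₑ ^ 2 ≤ ENNReal.ofReal (c ^ 2) * μ C := by
  classical
  set S : Lp ℂ 2 μ →L[ℂ] Lp ℂ 2 (μ.restrict C) := LpToLpRestrictCLM M ℂ ℂ μ 2 C ∘L P with hS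
  have hSae : ∀ v, S v =ᵐ[μ.restrict C] P v := fun v => LpToLpRestrictCLM_coeFn ℂ C (P v)
  obtain ⟨_, b, _⟩ := exists_hilbertBasis ℂ (Lp ℂ 2 μ)
  obtain ⟨_, f, _⟩ := exists_hilbertBasis ℂ (Lp ℂ 2 (μ.restrict C))
  have : Fact ((2 : ℝ≥0∞) ≠ ⊤) := ⟨ENNReal.ofNat_ne_top⟩
  have hcount := HilbertBasis.countable f
  have hSt : ∀ l (t : G), ∫⁻ x in C, ‖rightTranslation μ t⁻¹ (P (e.embed hν (ψ l) u)) x‖ₑ ^ 2 ∂μ =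
      ‖S (e.embed hν (ψ l) (rightTranslation haar t⁻¹ u))‖ₑ ^ 2 := by
    intro l t
    rw [← Lp.lintegral_enorm_sq, ← hP, ← e.embed_rightTranslation]
    refine lintegral_congr_ae ?_
    filter_upwards [hSae (e.embed hν (ψ l) (rightTranslation haar t⁻¹ u))] with x hx
    rw [hx]
  have hSl : ∀ l (t : G), ‖S (e.embed hν (ψ l) (rightTranslation haar t⁻¹ u))‖ₑ ^ 2 =
      ∑' i, ‖⟪(e.embed hν (ψ l)).adjoint (S.adjoint (f i)),
        rightTranslation haar t⁻¹ u⟫_ℂ‖ₑ ^ 2 := by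
    intro l t
    rw [enorm_sq_eq_tsum_inner f]
    refine tsum_congr fun i => ?_
    rw [ContinuousLinearMap.adjoint_inner_left, ContinuousLinearMap.adjoint_inner_left]
  have hV : ∀ i j v w, ⟪e.embed hν (ψ i) v, e.embed hν (ψ j) w⟫_ℂ =
      if i = j then ⟪v, w⟫_ℂ else 0 := by
    intro i j v w
    rw [e.inner_embed, orthonormal_iff_ite.mp ψ.orthonormal i j]
    by_cases h : i = j <;> simp [h]
  calc c₀ * ∑ l ∈ J, ‖P (e.embed hν (ψ l) u)‖ₑ ^ 2
      ≤ ∑ l ∈ J, ∑' i, ‖(e.embed hν (ψ l)).adjoint (S.adjoint (f i))‖ₑ ^ 2 := by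
        rw [Finset.mul_sum]
        refine Finset.sum_le_sum fun l _ => ?_
        refine (mul_enorm_sq_le_lintegral (haar := haar) hC hc₀ _).trans ?_
        simp only [hSt, hSl]
        rw [lintegral_tsum fun i => ?_]
        · exact ENNReal.tsum_le_tsum fun i =>
            lintegral_inner_rightTranslation_le hφ hφi hφ0 hφ1 hu _
        · have hcont : Continuous fun t : G => ⟪(e.embed hν (ψ l)).adjoint (S.adjoint (f i)),
              rightTranslation haar t⁻¹ u⟫_ℂ :=
            continuous_const.inner ((continuous_rightTranslation u).comp continuous_inv)
          exact (hcont.measurable.enorm.pow_const 2).aemeasurable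
    _ = ∑' i, ∑ l ∈ J, ‖(e.embed hν (ψ l)).adjoint (S.adjoint (f i))‖ₑ ^ 2 :=
        (Summable.tsum_finsetSum fun _ _ => ENNReal.summable).symm
    _ ≤ ∑' i, ‖S.adjoint (f i)‖ₑ ^ 2 := by
        refine ENNReal.tsum_le_tsum fun i => ?_
        have h1 := ENNReal.ofReal_le_ofReal (sum_norm_adjoint_sq_le hV (S.adjoint (f i)) J)
        rw [ENNReal.ofReal_sum_of_nonneg fun i _ => sq_nonneg _] at h1
        simpa only [ENNReal.ofReal_pow (norm_nonneg _), ofReal_norm] using h1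
    _ = ∑' j, ‖S (b j)‖ₑ ^ 2 := tsum_enorm_adjoint_sq S b f
    _ ≤ ENNReal.ofReal (c ^ 2) * (μ.restrict C) Set.univ := by
        refine tsum_enorm_sq_le_of_bounded b.orthonormal S fun v => ?_
        filter_upwards [hSae v, (ae_restrict_iff' hC).mpr (hb v)] with x h1 h2
        rw [h1]
        exact h2
    _ = ENNReal.ofReal (c ^ 2) * μ C := by rw [Measure.restrict_apply_univ]

/-- An invariant operator whose values are locally bounded functions is of finite trace. -/
theorem MeasurableTrivialization.invariantTrace_lt_top_of_bounded
    [CompactSpace (OrbitSpace G M)] {ι : Type*} (ψ : HilbertBasis ι ℂ (Lp ℂ 2 ν))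
    (hP : IsInvariantOperator G P)
    (h : ∀ u x₀, ∃ N ∈ 𝓝 x₀, ∃ c : ℝ, ∀ᵐ x ∂μ, x ∈ N → ‖P u x‖ ≤ c) :
    invariantTrace IG e hν ψ (P.adjoint ∘L P) < ⊤ := by
  obtain ⟨C, hC, hCfin, ⟨c, -, hb⟩, c₀, hc₀, hcC⟩ := exists_set_forall_bound haar P
    fun x₀ => exists_nhds_bound_of_forall P x₀ fun u => h u x₀
  obtain ⟨φ, hφ⟩ := exists_isApproxId (IG := IG) (haar := haar)
  set B := ENNReal.ofReal (c ^ 2) * μ C / c₀ with hB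
  have hBtop : B < ⊤ :=
    ENNReal.div_lt_top (ENNReal.mul_lt_top ENNReal.ofReal_lt_top hCfin).ne hc₀
  have hφm : ∀ n, MemLp (fun s => (φ n s : ℂ)) 2 haar := fun n => (hφ.isTestFunction n).memLp
  have hsum : ∀ n (J : Finset ι),
      ∑ l ∈ J, ‖P (e.embed hν (ψ l) ((hφm n).toLp _))‖ₑ ^ 2 ≤ B := by
    intro n J
    have hcont : Continuous (φ n) := (hφ.contMDiff n).continuous
    have h1 := e.mul_sum_enorm_sq_le hν ψ hP hC hb hcC hcont
      (hcont.integrable_of_hasCompactSupport (hφ.compact n)) (hφ.nonneg n)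
      (hφ.integral_eq_one n) (hφm n).coeFn_toLp J
    rw [hB, ENNReal.le_div_iff_mul_le (Or.inl hc₀)
      (Or.inr (ENNReal.mul_lt_top ENNReal.ofReal_lt_top hCfin).ne), mul_comm]
    exact h1
  have hF : ∀ l, ∃ F, IsConvolution IG (P ∘L e.embed hν (ψ l)) F := by
    intro l
    -- A single term of the uniform estimate bounds the values on the approximate identity.
    refine (e.isEquivariant_comp_embed hν hP (ψ l)).exists_isConvolution_of_bounded hφ
      (b := √B.toReal) fun n => ?_
    have h1 := hsum n {l}
    rw [Finset.sum_singleton, ← ofReal_norm, ← ENNReal.ofReal_pow (norm_nonneg _),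
      ENNReal.ofReal_le_iff_le_toReal hBtop.ne] at h1
    exact Real.le_sqrt_of_sq_le h1
  choose F hF using hF
  rw [e.invariantTrace_adjoint_comp]
  refine lt_of_le_of_lt ?_ hBtop
  rw [ENNReal.tsum_eq_iSup_sum]
  refine iSup_le fun J => ?_
  simp only [fun l => (e.isEquivariant_comp_embed hν hP (ψ l)).groupTrace_eq (hF l)]
  -- Once the F l exist, the convergence is in norm, so the bound on finite sums passes to the
  -- limit.
  have hlim : Tendsto (fun n => ∑ l ∈ J, ‖P (e.embed hν (ψ l) ((hφm n).toLp _))‖ₑ ^ 2) atTop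
      (𝓝 (∑ l ∈ J, ‖F l‖ₑ ^ 2)) := by
    refine tendsto_finsetSum J fun l _ => ?_
    exact ((ENNReal.continuous_pow 2).tendsto _).comp
      ((continuous_enorm.tendsto _).comp ((hF l).tendsto hφ))
  exact le_of_tendsto' hlim fun n => hsum n J

end Bounded

end InvariantTrace

end

/-! ### The main theorem -/

theorem mainTheorem5
    {m n : ℕ} [NeZero n] {G M : Type*}
    -- a unimodular Lie group `G` with Haar measure
    [Group G] [TopologicalSpace G] [T2Space G] [SecondCountableTopology G]
    [ChartedSpace (EuclideanSpace ℝ (Fin m)) G] [LieGroup (𝓡 m) ∞ G]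
    [IsTopologicalGroup G] [LocallyCompactSpace G] [MeasurableSpace G] [BorelSpace G]
    (haar : Measure G) [haar.IsHaarMeasure] [haar.IsMulRightInvariant]
    -- a smooth manifold `M`, possibly with boundary
    [TopologicalSpace M] [T2Space M] [SecondCountableTopology M]
    [ChartedSpace (EuclideanHalfSpace n) M] [IsManifold (𝓡∂ n) ∞ M]
    [MeasurableSpace M] [BorelSpace M]
    -- a right action of `G` for which `M` is a principal bundle with compact base
    [MulAction Gᵐᵒᵖ M] [ContinuousSMul Gᵐᵒᵖ M]
    (hM : InvariantTrace.IsPrincipalBundle (𝓡 m) (𝓡∂ n) G M)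
    -- an invariant smooth positive measure on `M`
    (μ : Measure M) [SMulInvariantMeasure Gᵐᵒᵖ M μ]
    (hμ : InvariantTrace.IsSmoothMeasure (𝓡∂ n) μ) :
    -- the quotient measures and a measurable global trivialization exist
    (∃ ν : Measure (InvariantTrace.OrbitSpace G M),
      InvariantTrace.IsQuotientMeasure haar μ ν) ∧
    (∃ ν₂ : Measure (InvariantTrace.OrbitSpace G (M × M)),
      InvariantTrace.IsQuotientMeasure haar (μ.prod μ) ν₂) ∧
    Nonempty (InvariantTrace.MeasurableTrivialization G M) ∧
    -- and for every choice of these and of an orthonormal basis of `L²(M / G)`: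
    ∀ (ν : Measure (InvariantTrace.OrbitSpace G M))
      (hν : InvariantTrace.IsQuotientMeasure haar μ ν)
      (ν₂ : Measure (InvariantTrace.OrbitSpace G (M × M)))
      (_ : InvariantTrace.IsQuotientMeasure haar (μ.prod μ) ν₂)
      (e : InvariantTrace.MeasurableTrivialization G M)
      {ι : Type*} (ψ : HilbertBasis ι ℂ (Lp ℂ 2 ν)),
      -- `Tr_G (A^* A) = ∫ |K_A|²` for every invariant bounded operator `A`, both sides being
      -- infinite when `K_A` is not a square-integrable function on `(M × M) / G`
      (∀ A : Lp ℂ 2 μ →L[ℂ] Lp ℂ 2 μ, InvariantTrace.IsInvariantOperator G A →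
        (∀ κ : InvariantTrace.OrbitSpace G (M × M) → ℂ, AEStronglyMeasurable κ ν₂ →
          InvariantTrace.IsSchwartzKernel (𝓡∂ n) A (fun z => κ (InvariantTrace.toOrbit G z)) →
          InvariantTrace.invariantTrace (𝓡 m) e hν ψ (A.adjoint ∘L A) =
            ∫⁻ q, ‖κ q‖ₑ ^ 2 ∂ν₂) ∧
        (InvariantTrace.invariantTrace (𝓡 m) e hν ψ (A.adjoint ∘L A) < ⊤ →
          ∃ κ : InvariantTrace.OrbitSpace G (M × M) → ℂ, MemLp κ 2 ν₂ ∧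
            InvariantTrace.IsSchwartzKernel (𝓡∂ n) A
              (fun z => κ (InvariantTrace.toOrbit G z)))) ∧
      -- an invariant self-adjoint projection with image in `H^∞(M)` has a Schwartz kernel that
      -- is square-integrable on `(M × M) / G`, and has finite trace
      (∀ P : Lp ℂ 2 μ →L[ℂ] Lp ℂ 2 μ, InvariantTrace.IsInvariantOperator G P →
        IsStarProjection P →
        (∀ (u : Lp ℂ 2 μ) (s : ℕ), InvariantTrace.MemSobolev G (𝓡∂ n) s (P u)) →
        (∃ κ : InvariantTrace.OrbitSpace G (M × M) → ℂ, MemLp κ 2 ν₂ ∧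
          InvariantTrace.IsSchwartzKernel (𝓡∂ n) P
            (fun z => κ (InvariantTrace.toOrbit G z)) ∧
          InvariantTrace.invariantTrace (𝓡 m) e hν ψ (P.adjoint ∘L P) =
            ∫⁻ q, ‖κ q‖ₑ ^ 2 ∂ν₂) ∧
        InvariantTrace.invariantTrace (𝓡 m) e hν ψ P < ⊤) := by
  have hloc : ∀ x : M, ∃ W : Set M, IsOpen W ∧ x ∈ W ∧ (∀ y ∈ W, ∀ g : G, op g • y ∈ W) ∧
      ∃ τ : M → G, ContinuousOn τ W ∧ ∀ y ∈ W, ∀ g : G, τ (op g • y) = τ y * g := fun x => by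
    obtain ⟨W, hW, hx, hWG, τ, hτ, hτG⟩ := hM.locallyTrivial x
    exact ⟨W, hW, hx, hWG, τ, hτ.continuousOn, hτG⟩
  have hcompact := hM.compact_base
  have hlf : IsLocallyFiniteMeasure μ := hμ.isLocallyFiniteMeasure
  have hH : LocallyCompactSpace (EuclideanHalfSpace n) := (𝓡∂ n).locallyCompactSpace
  have hMlc : LocallyCompactSpace M := ChartedSpace.locallyCompactSpace (EuclideanHalfSpace n) M
  have hinv : haar.IsInvInvariant := InvariantTrace.isInvInvariant_of_isMulRightInvariant haar
  have hsmul : Measurable fun p : M × G => op p.2 • p.1 := InvariantTrace.measurable_op_smul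
  have hsmul₂ : Measurable fun p : (M × M) × G => op p.2 • p.1 :=
    InvariantTrace.measurable_op_smul
  have hμ₂ : SMulInvariantMeasure Gᵐᵒᵖ (M × M) (μ.prod μ) := ⟨fun c s hs =>
    ((measurePreserving_smul c μ).prod (measurePreserving_smul c μ)).measure_preimage
      hs.nullMeasurableSet⟩
  obtain ⟨e₀⟩ := InvariantTrace.exists_measurableTrivialization hsmul hloc
  refine ⟨InvariantTrace.exists_isQuotientMeasure haar μ hsmul e₀.measurable_coord e₀.coord_smul,
    InvariantTrace.exists_isQuotientMeasure haar (μ.prod μ) hsmul₂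
      (e₀.measurable_coord.comp measurable_snd) fun z g => e₀.coord_smul z.2 g, ⟨e₀⟩, ?_⟩
  intro ν hν ν₂ hν₂ e ι ψ
  have hσ := hν.sigmaFinite
  refine ⟨fun A hA => ⟨fun κ hκ hK => e.invariantTrace_eq_lintegral hν hν₂ hloc ψ hA hκ hK,
    fun hTr => ?_⟩, fun P hP hproj hsob => ?_⟩
  · obtain ⟨κ, hκ, hK, -⟩ := e.exists_isSchwartzKernel_of_invariantTrace_lt_top
      (I := 𝓡∂ n) hν hν₂ hloc ψ hA hTr
    exact ⟨κ, hκ, hK⟩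
  · have hTr : InvariantTrace.invariantTrace (𝓡 m) e hν ψ (P.adjoint ∘L P) < ⊤ :=
      -- Of smoothness of all orders only the order n, the dimension of M, is needed.
      e.invariantTrace_lt_top_of_bounded hν ψ hP fun u x₀ => (hsob u n).exists_bound_nhds hμ x₀
    refine ⟨e.exists_isSchwartzKernel_of_invariantTrace_lt_top hν hν₂ hloc ψ hP hTr, ?_⟩
    have hPP : P.adjoint ∘L P = P := by
      have h1 : P.adjoint = P := hproj.isSelfAdjoint
      rw [h1]
      exact hproj.isIdempotentElem
    rwa [hPP] at hTr
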